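/- **Setting.** Let $f$ be a transcendental entire function. $S(f)$ is the closure of the set of critical and finite asymptotic values of $f$, $AV(f)$ the set of finite asymptotic values, $I(f)=\{z: f^n(z)\to\infty\}$ the escaping set, $J(f)$ the Julia set, and $P(f)=\overline{\bigcup_{n\ge0}f^n(S(f))}$. A *ray tail* of $f$ with finite endpoint $z$ is (the trace of) an injective curve $\gamma:[t_0,\infty)\to I(f)$, $t_0>0$, $\gamma(t_0)=z$, such that for every $n\ge1$ the map $t\mapsto f^n(\gamma(t))$ is injective with $f^n(\gamma(t))\to\infty$ as $t\to\infty$, and such that $f^n(\gamma(t))\to\infty$ uniformly in $t$ as $n\to\infty$. The function $f$ is *criniferous* if for every $z\in I(f)$ there is $N$ such that $f^n(z)$ lies in a ray tail for all $n\ge N$. Assume that $S(f)$ is bounded, that $f$ is criniferous, that $J(f)\cap AV(f)=\emptyset$, that $P(f)\setminus I(f)$ is bounded, and that $S_I:=S(f)\cap I(f)$ is finite. For each $z\in S_I$ let $\gamma_z$ be a ray tail with finite endpoint $z$. Let $D\supset S(f)\cup(P(f)\setminus I(f))$ be a bounded Jordan domain and let $\delta\subset\mathbb C\setminus\overline{f^{-1}(\mathbb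 C\setminus D)}$ be an arc that connects a point of $\overline D$ to infinity and meets $\overline D$ only in that point. Put $W_{-1}=\mathbb C\setminus(\overline D\cup\delta)$ and assume that $D,\delta$ are chosen so that, whenever a connected component $\tau$ of $f^{-n}(W_{-1})$, $n\ge1$, contains a point $z\in S_I$, then $\gamma_z\subset\tau$. For $n\ge0$ define inductively $$X_n=\bigcup_{z\in W_{n-1}\cap S_I}\gamma_z,\qquad W_n=f^{-1}(W_{n-1}\setminus X_n).$$ The connected components of $W_n$ are the *fundamental hands* of level $n$. **Proposition.** Every fundamental hand (of any level $n\ge0$) is unbounded and simply connected, and any two distinct fundamental hands of the same level are disjoint. Moreover, for each $n\ge1$, $f$ maps each fundamental hand $\tau$ of level $n$ univalently into a fundamental hand $\tilde\tau$ of level $n-1$; more precisely, $f$ is injective on $\tau$ and $f(\tau)$ is a connected component of $\tilde\tau\setminus X_n$ (in particular $f(\tau)=\tilde\tau$ if $\tilde\tau\cap X_n=\emptyset$). -/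

import Mathlib

open Set Filter Topology

/-! ### Entire functions: singular values, escaping set, Julia set -/

/-- `f` is a transcendental entire function. -/
def IsTranscendentalEntire (f : ℂ → ℂ) : Prop :=
  Differentiable ℂ f ∧ ¬ ∃ p : Polynomial ℂ, ∀ z, f z = p.eval z

/-- `CV(f)`: the set of critical values of `f`. -/
def criticalValues (f : ℂ → ℂ) : Set ℂ := f '' {z | deriv f z = 0}

/-- `AV(f)`: the (finite) asymptotic values of `f`, i.e. the limits of `f` along curves
that tend to infinity. -/
def asymptoticValues (f : ℂ → ℂ) : Set ℂ :=
  {a | ∃ c : ℝ → ℂ, ContinuousOn c (Ici 0) ∧ Tendsto c atTop (Bornology.cobounded ℂ) ∧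
    Tendsto (fun t => f (c t)) atTop (𝓝 a)}

/-- `S(f)`: the singular set of `f`. -/
def singularSet (f : ℂ → ℂ) : Set ℂ := closure (criticalValues f ∪ asymptoticValues f)

/-- `P(f)`: the postsingular set of `f`. -/
def postsingularSet (f : ℂ → ℂ) : Set ℂ := closure (⋃ n : ℕ, f^[n] '' singularSet f)

/-- The Eremenko-Lyubich class `𝓑`. -/
def ClassB (f : ℂ → ℂ) : Prop :=
  IsTranscendentalEntire f ∧ Bornology.IsBounded (singularSet f)

/-- `I(f)`: the escaping set of `f`. -/
def escapingSet (f : ℂ → ℂ) : Set ℂ :=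
  {z | Tendsto (fun n : ℕ => f^[n] z) atTop (Bornology.cobounded ℂ)}

/-- The Fatou set of `f`: the points with a neighbourhood on which the iterates of `f` form a
normal family, i.e. every subsequence of the iterates has a further subsequence that converges
locally uniformly, either to a finite function or to infinity. -/
def fatouSet (f : ℂ → ℂ) : Set ℂ :=
  {z | ∃ r > 0, ∀ φ : ℕ → ℕ, StrictMono φ → ∃ ψ : ℕ → ℕ, StrictMono ψ ∧
    ((∃ g : ℂ → ℂ, TendstoLocallyUniformlyOn (fun k => f^[φ (ψ k)]) g atTop (Metric.ball z r)) ∨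
      ∀ K ⊆ Metric.ball z r, IsCompact K → ∀ R : ℝ, ∀ᶠ k in atTop,
        ∀ w ∈ K, R < ‖f^[φ (ψ k)] w‖)}

/-- `J(f)`: the Julia set of `f`. -/
def juliaSet (f : ℂ → ℂ) : Set ℂ := (fatouSet f)ᶜ

/-! ### Ray tails and criniferous functions -/

/-- The curve `c : [t₀, ∞) → I(f)` is a ray tail of `f`. -/
def IsRayTailCurve (f : ℂ → ℂ) (t₀ : ℝ) (c : ℝ → ℂ) : Prop :=
  0 < t₀ ∧ ContinuousOn c (Ici t₀) ∧ InjOn c (Ici t₀) ∧ MapsTo c (Ici t₀) (escapingSet f) ∧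
  (∀ n : ℕ, 1 ≤ n → InjOn (fun t => f^[n] (c t)) (Ici t₀) ∧
    Tendsto (fun t => f^[n] (c t)) atTop (Bornology.cobounded ℂ)) ∧
  ∀ R : ℝ, ∃ N : ℕ, ∀ n ≥ N, ∀ t ∈ Ici t₀, R < ‖f^[n] (c t)‖

/-- The set `T` is (the trace of) a ray tail of `f` with finite endpoint `z`. -/
def IsRayTailFrom (f : ℂ → ℂ) (z : ℂ) (T : Set ℂ) : Prop :=
  ∃ (t₀ : ℝ) (c : ℝ → ℂ), IsRayTailCurve f t₀ c ∧ c t₀ = z ∧ T = c '' Ici t₀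

/-- `f` is criniferous: every escaping point is eventually mapped into ray tails. -/
def Criniferous (f : ℂ → ℂ) : Prop :=
  ∀ z ∈ escapingSet f, ∃ N : ℕ, ∀ n ≥ N, ∃ (w : ℂ) (T : Set ℂ),
    IsRayTailFrom f w T ∧ f^[n] z ∈ T

/-- `S_I = S(f) ∩ I(f)`: the escaping singular values. -/
def escapingSingularSet (f : ℂ → ℂ) : Set ℂ := singularSet f ∩ escapingSet f

/-! ### The domain `W₋₁` -/

/-- `D` is a bounded Jordan domain: a bounded domain whose boundary is a Jordan curve. -/
def IsJordanDomain (D : Set ℂ) : Prop :=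
  IsOpen D ∧ IsConnected D ∧ Bornology.IsBounded D ∧
    ∃ c : Circle → ℂ, Continuous c ∧ Function.Injective c ∧ range c = frontier D

/-- `δ` is an arc that connects a point of the closure of `D` to infinity, lies otherwise outside
the closure of `D`, and avoids the closure of `f⁻¹(ℂ \ D)`. -/
def IsCutArc (f : ℂ → ℂ) (D δ : Set ℂ) : Prop :=
  ∃ c : ℝ → ℂ, ContinuousOn c (Ici 0) ∧ InjOn c (Ici 0) ∧
    Tendsto c atTop (Bornology.cobounded ℂ) ∧ c 0 ∈ closure D ∧ (∀ t > 0, c t ∉ closure D) ∧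
    δ = c '' Ici 0 ∧ δ ⊆ (closure (f ⁻¹' Dᶜ))ᶜ

/-- `W₋₁ = ℂ \ (closure D ∪ δ)`. -/
def baseDomain (D δ : Set ℂ) : Set ℂ := (closure D ∪ δ)ᶜ

/-- The choice of `D` and `δ` is compatible with the tails `γ z`, `z ∈ S_I`: `D` is a Jordan domain
containing `S(f)` and `P(f) \ I(f)`, `δ` is an arc as above, and every component of `f⁻ⁿ(W₋₁)`,
`n ≥ 1`, that contains a point `z ∈ S_I` contains the whole tail `γ z`. -/
def IsCompatibleChoice (f : ℂ → ℂ) (γ : ℂ → Set ℂ) (D δ : Set ℂ) : Prop :=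
  IsJordanDomain D ∧ singularSet f ∪ (postsingularSet f \ escapingSet f) ⊆ D ∧
    IsCutArc f D δ ∧
    ∀ n : ℕ, 1 ≤ n → ∀ z ∈ escapingSingularSet f, z ∈ f^[n] ⁻¹' baseDomain D δ →
      γ z ⊆ connectedComponentIn (f^[n] ⁻¹' baseDomain D δ) z

/-! ### Fundamental hands -/

/-- The union of the tails `γ z` over the points `z ∈ V ∩ S_I`. -/
def tailsOver (f : ℂ → ℂ) (γ : ℂ → Set ℂ) (V : Set ℂ) : Set ℂ :=
  ⋃ z ∈ V ∩ escapingSingularSet f, γ z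

/-- `handStage f γ W n` is the set `W_{n-1}` (so the index is shifted by one): `W_{-1} = W` and
`W_n = f⁻¹(W_{n-1} \ X_n)`, where `X_n` is the union of the tails `γ z` over
`z ∈ W_{n-1} ∩ S_I`. -/
def handStage (f : ℂ → ℂ) (γ : ℂ → Set ℂ) (W : Set ℂ) : ℕ → Set ℂ
  | 0 => W
  | n + 1 => f ⁻¹' (handStage f γ W n \ tailsOver f γ (handStage f γ W n))

/-- `X_n`: the union of the tails `γ z` over `z ∈ W_{n-1} ∩ S_I`. -/
def removedTails (f : ℂ → ℂ) (γ : ℂ → Set ℂ) (W : Set ℂ) (n : ℕ) : Set ℂ :=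
  tailsOver f γ (handStage f γ W n)

/-- `U` is a connected component of the set `V`. -/
def IsComponentOf (U V : Set ℂ) : Prop := ∃ z ∈ V, U = connectedComponentIn V z

/-- `τ` is a fundamental hand of level `n`: a connected component of `W_n`. -/
def IsFundamentalHand (f : ℂ → ℂ) (γ : ℂ → Set ℂ) (W : Set ℂ) (n : ℕ) (τ : Set ℂ) : Prop :=
  IsComponentOf τ (handStage f γ W (n + 1))

/-!
Call a plane set `S` *good* if `z - c` has a continuous logarithm on every compact subset of `S`,
for every `c ∉ S`; components of good open sets are simply connected. If an open set `V` contains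
no singular value and has simply connected components, then `f` maps every component of `f⁻¹(V)`
homeomorphically onto a component of `V`, so `f⁻¹(V)` is good again. The sets `W_{n-1} \ X_n`
contain no singular value: the escaping ones lie on the removed tails, and the others have orbits
that never enter `W₋₁`. They are good by induction, since each removed tail joins its points to
infinity. This gives all assertions except unboundedness.

If a component of `W_{n-1} \ X_n` were bounded, then its image under `fⁿ` would contain a bounded
component `O` of `W₋₁ \ Z`, where `Z ⊆ W₋₁` is the union of the images under `fʲ`, `j ≤ n`, of the
tails removed at stage `j`. For `a ∈ O`, the function `z - a` has a continuous logarithm on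
`∂D ∪ δ`, which does not meet `Z`. It also has one on `Z ∩ ∂O`, because all points of `Z` escape
uniformly: expansion of functions in the class `𝓑` in logarithmic coordinates shows that no open
set escapes uniformly, and then the maximum principle forbids bounded components of the complement
of `Z`. Together these give a continuous logarithm of `z - a` on the boundary of `O`, which
contradicts Brouwer's no-retraction theorem.
-/

/-! ### Continuous logarithms -/

/-- `g` has a continuous logarithm on `s`. The logarithm is a function on the whole space that
takes arbitrary values off `s`. -/
def HasContinuousLogOn {X : Type*} [TopologicalSpace X] (g : X → ℂ) (s : Set X) : Prop :=
  ∃ L : X → ℂ, ContinuousOn L s ∧ ∀ x ∈ s, Complex.exp (L x) = g x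

namespace HasContinuousLogOn

variable {X Y : Type*} [TopologicalSpace X] [TopologicalSpace Y] {g h : X → ℂ} {s t : Set X}

theorem mono (hg : HasContinuousLogOn g s) (hts : t ⊆ s) : HasContinuousLogOn g t := by
  obtain ⟨L, hL, hLe⟩ := hg
  exact ⟨L, hL.mono hts, fun x hx => hLe x (hts hx)⟩

theorem congr (hg : HasContinuousLogOn g s) (hgh : EqOn g h s) : HasContinuousLogOn h s := by
  obtain ⟨L, hL, hLe⟩ := hg
  exact ⟨L, hL, fun x hx => (hLe x hx).trans (hgh hx)⟩

theorem mul (hg : HasContinuousLogOn g s) (hh : HasContinuousLogOn h s) :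
    HasContinuousLogOn (fun x => g x * h x) s := by
  obtain ⟨L, hL, hLe⟩ := hg
  obtain ⟨M, hM, hMe⟩ := hh
  exact ⟨fun x => L x + M x, hL.add hM, fun x hx => by rw [Complex.exp_add, hLe x hx, hMe x hx]⟩

end HasContinuousLogOn

theorem hasContinuousLogOn_const {X : Type*} [TopologicalSpace X] {a : ℂ} (ha : a ≠ 0) (s : Set X) :
    HasContinuousLogOn (fun _ => a) s :=
  ⟨fun _ => Complex.log a, continuousOn_const, fun _ _ => Complex.exp_log ha⟩

theorem hasContinuousLogOn_of_mapsTo_slitPlane {X : Type*} [TopologicalSpace X] {g : X → ℂ}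
    {s : Set X} (hg : ContinuousOn g s) (hs : MapsTo g s Complex.slitPlane) :
    HasContinuousLogOn g s :=
  ⟨fun x => Complex.log (g x), hg.clog hs,
    fun _ hx => Complex.exp_log (Complex.slitPlane_ne_zero (hs hx))⟩

theorem hasContinuousLogOn_of_isSimplyConnected {X : Type*} [TopologicalSpace X]
    [LocallyPathConnectedSpace X] {U : Set X} (hU : IsSimplyConnected U) (hUo : IsOpen U)
    {g : X → ℂ} (hg : ContinuousOn g U) (h0 : ∀ z ∈ U, g z ≠ 0) : HasContinuousLogOn g U :=
  Complex.exists_continuousOn_eqOn_exp_comp hU hUo hg (by rintro ⟨z, hz, h⟩; exact h0 z hz h)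

theorem hasContinuousLogOn_of_convex {E : Type*} [NormedAddCommGroup E] [NormedSpace ℝ E]
    {U : Set E} (hU : Convex ℝ U) (hUo : IsOpen U) {g : E → ℂ} (hg : ContinuousOn g U)
    (h0 : ∀ z ∈ U, g z ≠ 0) : HasContinuousLogOn g U := by
  rcases U.eq_empty_or_nonempty with rfl | hne
  · exact ⟨g, hg, by simp⟩
  have : ContractibleSpace U := hU.contractibleSpace hne
  exact hasContinuousLogOn_of_isSimplyConnected (SimplyConnectedSpace.ofContractible U) hUo hg h0

theorem exists_continuous_log {E : Type*} [NormedAddCommGroup E] [NormedSpace ℝ E] {g : E → ℂ}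
    (hg : Continuous g) (h0 : ∀ z, g z ≠ 0) :
    ∃ L : E → ℂ, Continuous L ∧ ∀ z, Complex.exp (L z) = g z := by
  obtain ⟨L, hL, hLe⟩ := hasContinuousLogOn_of_convex convex_univ isOpen_univ hg.continuousOn
    fun z _ => h0 z
  exact ⟨L, continuousOn_univ.1 hL, fun z => hLe z (mem_univ z)⟩

theorem log_sub_log_eq_of_isPreconnected {X : Type*} [TopologicalSpace X] {S : Set X}
    (hS : IsPreconnected S) {L M : X → ℂ} (hL : ContinuousOn L S) (hM : ContinuousOn M S)
    (h : ∀ x ∈ S, Complex.exp (L x) = Complex.exp (M x)) {x y : X} (hx : x ∈ S) (hy : y ∈ S) :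
    L x - L y = M x - M y := by
  have hexp : Complex.exp (L y - M y) = 1 := by
    rw [Complex.exp_sub, h y hy, div_self (Complex.exp_ne_zero _)]
  have key : EqOn L (fun z => M z + (L y - M y)) S :=
    Complex.isCoveringMap_exp.eqOn_of_comp_eqOn hS hL (hM.add continuousOn_const)
      (fun z hz => by ext; simp [Complex.exp_add, hexp, h z hz]) hy (by simp)
  linear_combination key hx

theorem exists_continuousOn_glue {X Y : Type*} [TopologicalSpace X] [TopologicalSpace Y]
    {A B : Set X} (hA : IsClosed A) (hB : IsClosed B) {f g : X → Y}
    (hf : ContinuousOn f A) (hg : ContinuousOn g B) (h : EqOn f g (A ∩ B)) :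
    ∃ k : X → Y, ContinuousOn k (A ∪ B) ∧ EqOn k f A ∧ EqOn k g B := by
  classical
  have hkA : EqOn (A.piecewise f g) f A := piecewise_eqOn A f g
  have hkB : EqOn (A.piecewise f g) g B := by
    intro z hz
    by_cases hz' : z ∈ A
    · rw [hkA hz', h ⟨hz', hz⟩]
    · exact piecewise_eq_of_notMem A f g hz'
  exact ⟨_, (hf.congr hkA).union_of_isClosed (hg.congr hkB) hA hB, hkA, hkB⟩

theorem HasContinuousLogOn.union_of_subsingleton_inter {X : Type*} [TopologicalSpace X]
    {g : X → ℂ} {A B : Set X} (hA : IsClosed A) (hB : IsClosed B) (hAB : (A ∩ B).Subsingleton)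
    (hgA : HasContinuousLogOn g A) (hgB : HasContinuousLogOn g B) :
    HasContinuousLogOn g (A ∪ B) := by
  obtain ⟨L, hL, hLe⟩ := hgA
  obtain ⟨M, hM, hMe⟩ := hgB
  obtain ⟨a, ha, hLM⟩ : ∃ a : ℂ, Complex.exp a = 1 ∧ ∀ z ∈ A ∩ B, L z = M z + a := by
    rcases hAB.eq_empty_or_singleton with h | ⟨p, h⟩
    · exact ⟨0, Complex.exp_zero, by simp [h]⟩
    have hp : p ∈ A ∩ B := h ▸ mem_singleton p
    refine ⟨L p - M p, ?_, by simp [h]⟩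
    rw [Complex.exp_sub, hLe p hp.1, ← hMe p hp.2, div_self (Complex.exp_ne_zero _)]
  obtain ⟨k, hk, hkA, hkB⟩ := exists_continuousOn_glue (g := fun z => M z + a) hA hB hL
    (hM.add continuousOn_const) hLM
  refine ⟨k, hk, ?_⟩
  rintro z (hz | hz)
  · rw [hkA hz, hLe z hz]
  · rw [hkB hz, Complex.exp_add, ha, mul_one, hMe z hz]

/-! ### Winding numbers and Borsuk's criterion -/

theorem eq_zero_of_hasContinuousLogOn_zpow_sphere {a : ℂ} {r : ℝ} (hr : 0 < r) {m : ℤ}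
    (h : HasContinuousLogOn (fun z => (z - a) ^ m) (Metric.sphere a r)) : m = 0 := by
  obtain ⟨L, hL, hLe⟩ := h
  have hmem (θ : ℝ) : circleMap a r θ ∈ Metric.sphere a r := circleMap_mem_sphere a hr.le θ
  have hlog : Complex.exp (Real.log r) = r := by rw [← Complex.ofReal_exp, Real.exp_log hr]
  have key := log_sub_log_eq_of_isPreconnected (isPreconnected_univ (α := ℝ))
    (L := fun θ => L (circleMap a r θ)) (M := fun θ : ℝ => m * (Real.log r + θ * Complex.I))
    (hL.comp_continuous (continuous_circleMap a r) hmem).continuousOn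
    (Continuous.continuousOn (by fun_prop)) (fun θ _ => by
      rw [hLe _ (hmem θ), Complex.exp_int_mul, Complex.exp_add, hlog]
      simp [circleMap]) (mem_univ (2 * Real.pi)) (mem_univ 0)
  have hclosed : circleMap a r (2 * Real.pi) = circleMap a r 0 := by
    simpa using periodic_circleMap a r 0
  have hm : (m : ℂ) * (2 * Real.pi * Complex.I) = 0 := by
    simp only [hclosed, sub_self] at key
    push_cast at key
    linear_combination -key
  simpa [Real.pi_ne_zero] using hm

/-- The integer `m` is the winding number around `0` of the loop `g`. -/
theorem exists_log_add_period_eq {g : ℝ → ℂ} (hg : Continuous g) (h0 : ∀ θ, g θ ≠ 0) {T : ℝ}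
    (hper : Function.Periodic g T) :
    ∃ (l : ℝ → ℂ) (m : ℤ), Continuous l ∧ (∀ θ, Complex.exp (l θ) = g θ) ∧
      ∀ θ, l (θ + T) = l θ + m * (2 * Real.pi * Complex.I) := by
  obtain ⟨l, hl, hle⟩ := exists_continuous_log hg h0
  have hexp (θ : ℝ) : Complex.exp (l (θ + T)) = Complex.exp (l θ) := by rw [hle, hle, hper]
  obtain ⟨m, hm⟩ := Complex.exp_eq_exp_iff_exists_int.1 (hexp 0)
  refine ⟨l, m, hl, hle, fun θ => ?_⟩
  have := log_sub_log_eq_of_isPreconnected (isPreconnected_univ (α := ℝ))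
    (L := fun θ => l (θ + T)) (Continuous.continuousOn (by fun_prop))
    hl.continuousOn (fun θ _ => hexp θ) (mem_univ θ) (mem_univ 0)
  linear_combination this + hm

theorem eq_zero_of_eqOn_frontier_zpow {Y : Set ℂ} (hY : IsOpen Y) (hYb : Bornology.IsBounded Y)
    {a : ℂ} (ha : a ∈ Y) {m : ℤ} {F : ℂ → ℂ} (hF : ContinuousOn F (closure Y))
    (hF0 : ∀ z ∈ closure Y, F z ≠ 0) (hFm : ∀ z ∈ frontier Y, F z = (z - a) ^ m) : m = 0 := by
  have hne (z : ℂ) (hz : z ∈ Yᶜ) : z - a ≠ 0 := sub_ne_zero.2 (ne_of_mem_of_not_mem ha hz).symm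
  obtain ⟨G, hG, hGF, hGm⟩ := exists_continuousOn_glue (g := fun z => (z - a) ^ m)
    isClosed_closure hY.isClosed_compl hF
    (fun z hz => ((continuous_id.sub continuous_const).continuousAt.zpow₀ m
      (Or.inl (hne z hz))).continuousWithinAt)
    (by rwa [← sdiff_eq, ← hY.frontier_eq])
  have hcover (z : ℂ) : z ∈ closure Y ∪ Yᶜ := (em (z ∈ Y)).imp (fun h => subset_closure h) id
  rw [eq_univ_of_forall hcover, continuousOn_univ] at hG
  have hG0 (z : ℂ) : G z ≠ 0 := by
    rcases hcover z with hz | hz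
    · rw [hGF hz]; exact hF0 z hz
    · rw [hGm hz]; exact zpow_ne_zero _ (hne z hz)
  obtain ⟨H, hH, hHe⟩ := exists_continuous_log hG hG0
  obtain ⟨r, hr⟩ := hYb.subset_ball a
  refine eq_zero_of_hasContinuousLogOn_zpow_sphere (Metric.pos_of_mem_ball (hr ha))
    ⟨H, hH.continuousOn, fun z hz => (hHe z).trans (hGm fun hzY => ?_)⟩
  exact (Metric.mem_ball.1 (hr hzY)).ne (Metric.mem_sphere.1 hz)

theorem not_hasContinuousLogOn_frontier {Y : Set ℂ} (hY : IsOpen Y) (hYb : Bornology.IsBounded Y)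
    {a : ℂ} (ha : a ∈ Y) : ¬ HasContinuousLogOn (fun z => z - a) (frontier Y) := by
  rintro ⟨L, hL, hLe⟩
  obtain ⟨M, hM⟩ := ContinuousMap.exists_restrict_eq isClosed_frontier
    ⟨_, continuousOn_iff_continuous_domRestrict.1 hL⟩
  have hML (z : ℂ) (hz : z ∈ frontier Y) : M z = L z :=
    DFunLike.congr_fun hM ⟨z, hz⟩
  exact one_ne_zero (eq_zero_of_eqOn_frontier_zpow hY hYb ha (m := 1)
    (F := fun z => Complex.exp (M z)) (by fun_prop) (fun _ _ => Complex.exp_ne_zero _)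
    (fun z hz => by simp [hML z hz, hLe z hz]))

/-! ### Sets with logarithm branches -/

/-- Over every compact subset of `S`, and for every point `c` outside `S`, the function
`z ↦ z - c` has a continuous logarithm: no cycle in `S` winds around a point outside `S`. -/
def HasLogBranches (S : Set ℂ) : Prop :=
  ∀ K ⊆ S, IsCompact K → ∀ c ∉ S, HasContinuousLogOn (fun z => z - c) K

theorem HasLogBranches.inter {S T : Set ℂ} (hS : HasLogBranches S) (hT : HasLogBranches T) :
    HasLogBranches (S ∩ T) := by
  intro K hK hKc c hc
  by_cases h : c ∈ S
  · exact hT K (hK.trans inter_subset_right) hKc c fun h' => hc ⟨h, h'⟩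
  · exact hS K (hK.trans inter_subset_left) hKc c h

theorem isCompact_frontier_of_isBounded {X : Type*} [PseudoMetricSpace X] [ProperSpace X]
    {Y : Set X} (hYb : Bornology.IsBounded Y) : IsCompact (frontier Y) :=
  hYb.isCompact_closure.of_isClosed_subset isClosed_frontier frontier_subset_closure

theorem HasLogBranches.subset_of_frontier_subset {S Y : Set ℂ} (hS : HasLogBranches S)
    (hY : IsOpen Y) (hYb : Bornology.IsBounded Y) (hfr : frontier Y ⊆ S) : Y ⊆ S := fun a ha =>
  not_not.1 fun haS => not_hasContinuousLogOn_frontier hY hYb ha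
    (hS _ hfr (isCompact_frontier_of_isBounded hYb) a haS)

theorem hasContinuousLogOn_sub_of_norm_sub_lt {K : Set ℂ} {c₀ c₁ : ℂ}
    (hlt : ∀ z ∈ K, ‖c₁ - c₀‖ < ‖z - c₀‖) (h : HasContinuousLogOn (fun z => z - c₀) K) :
    HasContinuousLogOn (fun z => z - c₁) K := by
  have hpos (z : ℂ) (hz : z ∈ K) : 0 < ‖z - c₀‖ := (norm_nonneg _).trans_lt (hlt z hz)
  have hne (z : ℂ) (hz : z ∈ K) : z - c₀ ≠ 0 := norm_pos_iff.1 (hpos z hz)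
  have hslit : MapsTo (fun z => 1 + (c₀ - c₁) / (z - c₀)) K Complex.slitPlane := fun z hz =>
    Complex.mem_slitPlane_of_norm_lt_one (by
      rw [norm_div, norm_sub_rev c₀ c₁, div_lt_one (hpos z hz)]
      exact hlt z hz)
  have hcont : ContinuousOn (fun z => 1 + (c₀ - c₁) / (z - c₀)) K :=
    continuousOn_const.add (continuousOn_const.div (by fun_prop) hne)
  refine (h.mul (hasContinuousLogOn_of_mapsTo_slitPlane hcont hslit)).congr fun z hz => ?_
  have := hne z hz
  field_simp
  ring

theorem hasContinuousLogOn_sub_of_norm_lt {K : Set ℂ} {c : ℂ} (h : ∀ z ∈ K, ‖z‖ < ‖c‖) :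
    HasContinuousLogOn (fun z => z - c) K := by
  rcases eq_or_ne c 0 with rfl | hc
  · exact ⟨id, continuousOn_id, fun z hz => absurd (h z hz) (by simp)⟩
  have hslit : MapsTo (fun z => 1 + -(z / c)) K Complex.slitPlane := fun z hz =>
    Complex.mem_slitPlane_of_norm_lt_one (by
      rw [norm_neg, norm_div, div_lt_one (norm_pos_iff.2 hc)]
      exact h z hz)
  refine ((hasContinuousLogOn_const (neg_ne_zero.2 hc) K).mul
    (hasContinuousLogOn_of_mapsTo_slitPlane (by fun_prop) hslit)).congr fun z _ => ?_
  field_simp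
  ring

theorem eventually_hasContinuousLogOn_sub_iff {K : Set ℂ} (hK : IsClosed K) {c : ℂ} (hc : c ∉ K) :
    ∀ᶠ c' in 𝓝 c, (HasContinuousLogOn (fun z => z - c) K ↔
      HasContinuousLogOn (fun z => z - c') K) := by
  obtain ⟨ε, hε, hball⟩ := Metric.isOpen_iff.1 hK.isOpen_compl c hc
  filter_upwards [Metric.ball_mem_nhds c (half_pos hε)] with c' hc'
  have hdist (z : ℂ) (hz : z ∈ K) : ε ≤ dist z c := not_lt.1 fun h => hball (Metric.mem_ball.2 h) hz
  rw [Metric.mem_ball] at hc'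
  refine ⟨hasContinuousLogOn_sub_of_norm_sub_lt fun z hz => ?_,
    hasContinuousLogOn_sub_of_norm_sub_lt fun z hz => ?_⟩
  · rw [← dist_eq_norm, ← dist_eq_norm]
    linarith [hdist z hz]
  · rw [← dist_eq_norm, ← dist_eq_norm, dist_comm c c']
    linarith [hdist z hz, dist_triangle z c' c]

theorem hasLogBranches_of_unbounded {S : Set ℂ}
    (h : ∀ c ∉ S, ∃ C ⊆ Sᶜ, IsPreconnected C ∧ c ∈ C ∧ ¬ Bornology.IsBounded C) :
    HasLogBranches S := by
  intro K hK hKc c hc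
  obtain ⟨C, hCS, hC, hcC, hCb⟩ := h c hc
  obtain ⟨R, hR⟩ := hKc.isBounded.exists_norm_le
  obtain ⟨c', hc'C, hc'R⟩ : ∃ c' ∈ C, R < ‖c'‖ := by
    by_contra! hcon
    exact hCb (isBounded_iff_forall_norm_le.2 ⟨R, hcon⟩)
  have hlog : HasContinuousLogOn (fun z => z - c') K :=
    hasContinuousLogOn_sub_of_norm_lt fun z hz => (hR z hz).trans_lt hc'R
  refine (hC.induction₂ (fun x y => HasContinuousLogOn (fun z => z - x) K ↔
    HasContinuousLogOn (fun z => z - y) K) (fun x hx => ?_) (fun _ _ _ _ _ _ => Iff.trans)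
    (fun _ _ _ _ => Iff.symm) hcC hc'C).2 hlog
  exact nhdsWithin_le_nhds
    (eventually_hasContinuousLogOn_sub_iff hKc.isClosed fun hxK => hCS hx (hK hxK))

/-! ### Jordan curves and arcs to infinity -/

theorem exists_continuous_comp_circle_eq {Z : Type*} [TopologicalSpace Z] [T2Space Z]
    [NormalSpace Z] {c : Circle → Z} (hc : Continuous c) (hinj : Function.Injective c) {H : ℝ → ℂ}
    (hH : Continuous H) (hper : Function.Periodic H (2 * Real.pi)) :
    ∃ h : Z → ℂ, Continuous h ∧ ∀ θ, h (c (Circle.exp θ)) = H θ := by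
  have hq := Circle.isCoveringMap_exp.isQuotientMap Circle.exp_surjective
  have hfac : Function.FactorsThrough H Circle.exp := by
    intro x y hxy
    obtain ⟨m, hm⟩ := Circle.exp_eq_exp.1 hxy
    rw [hm]
    exact hper.int_mul m y
  let g := hq.lift (f := ⟨Circle.exp, Circle.exp.continuous⟩) ⟨H, hH⟩ hfac
  have hg (θ : ℝ) : g (Circle.exp θ) = H θ :=
    DFunLike.congr_fun (hq.lift_comp (f := ⟨Circle.exp, Circle.exp.continuous⟩) ⟨H, hH⟩ hfac) θ
  obtain ⟨h, hh⟩ := ContinuousMap.exists_extension (hc.isClosedEmbedding hinj) g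
  exact ⟨h, h.continuous, fun θ => by rw [← hg]; exact DFunLike.congr_fun hh (Circle.exp θ)⟩

/-- If `k` and `m` are the winding numbers of the boundary curve around the interior point `d` and
around `a`, then `z ↦ (z - a) ^ k` and `z ↦ (z - d) ^ m` differ on the curve by a factor that has a
logarithm. As the former has no zeros in `D`, this forces `m = 0`. -/
theorem IsJordanDomain.hasContinuousLogOn_frontier {D : Set ℂ} (hD : IsJordanDomain D) {a : ℂ}
    (ha : a ∉ closure D) : HasContinuousLogOn (fun z => z - a) (frontier D) := by
  obtain ⟨hDo, ⟨⟨d, hd⟩, -⟩, hDb, c, hc, hinj, hrange⟩ := hD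
  have hloop (b : ℂ) (hb : b ∉ frontier D) := exists_log_add_period_eq
    (g := fun θ : ℝ => c (Circle.exp θ) - b) (T := 2 * Real.pi) (by fun_prop)
    (fun θ => sub_ne_zero.2 (ne_of_mem_of_not_mem (hrange ▸ mem_range_self _) hb))
    fun θ => by simp only [Circle.exp_add, Circle.exp_two_pi, mul_one]
  have hcurve {z : ℂ} (hz : z ∈ frontier D) : ∃ θ : ℝ, c (Circle.exp θ) = z := by
    rw [← hrange] at hz
    obtain ⟨w, rfl⟩ := hz
    exact (Circle.exp_surjective w).imp fun θ hθ => congrArg c hθ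
  obtain ⟨l, m, hl, hle, hlm⟩ := hloop a fun h => ha (frontier_subset_closure h)
  obtain ⟨l', k, hl', hle', hlk⟩ := hloop d fun h => h.2 (by rwa [hDo.interior_eq])
  have hm : m = 0 := by
    obtain ⟨h, hh, hhe⟩ := exists_continuous_comp_circle_eq hc hinj
      (H := fun θ => m * l' θ - k * l θ) (by fun_prop) (fun θ => by
        simp only [hlm θ, hlk θ]
        ring)
    have hne (z : ℂ) (hz : z ∈ closure D) : z - a ≠ 0 :=
      sub_ne_zero.2 (ne_of_mem_of_not_mem hz ha)
    refine eq_zero_of_eqOn_frontier_zpow hDo hDb hd (F := fun z => Complex.exp (h z) * (z - a) ^ k)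
      ((by fun_prop : Continuous fun z => Complex.exp (h z)).continuousOn.mul
        (ContinuousOn.zpow₀ (by fun_prop) k fun z hz => Or.inl (hne z hz)))
      (fun z hz => mul_ne_zero (Complex.exp_ne_zero _) (zpow_ne_zero _ (hne z hz))) fun z hz => ?_
    obtain ⟨θ, rfl⟩ := hcurve hz
    rw [hhe, ← hle θ, ← hle' θ, ← Complex.exp_int_mul, ← Complex.exp_int_mul, ← Complex.exp_add]
    ring_nf
  obtain ⟨L, hL, hLe⟩ := exists_continuous_comp_circle_eq hc hinj hl (fun θ => by simp [hlm θ, hm])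
  refine ⟨L, hL.continuousOn, fun z hz => ?_⟩
  obtain ⟨θ, rfl⟩ := hcurve hz
  rw [hLe, hle]

theorem isClosedEmbedding_of_tendsto_cobounded {E : Type*} [MetricSpace E] [ProperSpace E]
    {c : ℝ → E} {t₀ : ℝ} (hc : ContinuousOn c (Ici t₀)) (hinj : InjOn c (Ici t₀))
    (ht : Tendsto c atTop (Bornology.cobounded E)) : IsClosedEmbedding (fun t : Ici t₀ => c t) := by
  have hcont : Continuous (fun t : Ici t₀ => c t) := continuousOn_iff_continuous_domRestrict.1 hc
  refine .of_continuous_injective_isClosedMap hcont (injOn_iff_injective.1 hinj)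
    (isProperMap_iff_tendsto_cocompact.2 ⟨hcont, fun s hs => ?_⟩).isClosedMap
  rw [← Metric.cobounded_eq_cocompact] at hs
  obtain ⟨T, hT⟩ := mem_atTop_sets.1 (ht hs)
  refine mem_cocompact.2 ⟨Subtype.val ⁻¹' Icc t₀ T, ?_, fun t htm => hT _ ?_⟩
  · rw [Subtype.isCompact_iff, Subtype.image_preimage_coe]
    exact isCompact_Icc.inter_left isClosed_Ici
  · by_contra hlt
    exact htm ⟨t.2, (not_le.1 hlt).le⟩

theorem isClosed_image_Ici_of_tendsto_cobounded {E : Type*} [MetricSpace E] [ProperSpace E]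
    {c : ℝ → E} {t₀ : ℝ} (hc : ContinuousOn c (Ici t₀)) (hinj : InjOn c (Ici t₀))
    (ht : Tendsto c atTop (Bornology.cobounded E)) : IsClosed (c '' Ici t₀) := by
  rw [image_eq_range]
  exact (isClosedEmbedding_of_tendsto_cobounded hc hinj ht).isClosed_range

theorem hasContinuousLogOn_image_Ici {c : ℝ → ℂ} {t₀ : ℝ} (hc : ContinuousOn c (Ici t₀))
    (hinj : InjOn c (Ici t₀)) (ht : Tendsto c atTop (Bornology.cobounded ℂ)) {a : ℂ}
    (ha : a ∉ c '' Ici t₀) : HasContinuousLogOn (fun z => z - a) (c '' Ici t₀) := by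
  obtain ⟨M, hM, hMe⟩ := exists_continuous_log (g := fun t : ℝ => c (max t t₀) - a)
    ((hc.comp_continuous (by fun_prop) fun t => mem_Ici.2 (le_max_right _ _)).sub continuous_const)
    fun t => sub_ne_zero.2 (ne_of_mem_of_not_mem (mem_image_of_mem c (le_max_right t t₀)) ha)
  obtain ⟨N, hN⟩ := ContinuousMap.exists_extension
    (isClosedEmbedding_of_tendsto_cobounded hc hinj ht) ⟨fun t => M t, by fun_prop⟩
  refine ⟨N, N.continuous.continuousOn, ?_⟩
  rintro _ ⟨t, ht, rfl⟩
  have hNt : N (c t) = M t := DFunLike.congr_fun hN ⟨t, ht⟩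
  rw [hNt, hMe, max_eq_left ht]

theorem IsCutArc.isClosed {f : ℂ → ℂ} {D δ : Set ℂ} (h : IsCutArc f D δ) : IsClosed δ := by
  obtain ⟨c, hc, hinj, ht, -, -, rfl, -⟩ := h
  exact isClosed_image_Ici_of_tendsto_cobounded hc hinj ht

theorem IsJordanDomain.hasContinuousLogOn_frontier_union {f : ℂ → ℂ} {D δ : Set ℂ}
    (hD : IsJordanDomain D) (hδ : IsCutArc f D δ) {a : ℂ} (ha : a ∉ closure D ∪ δ) :
    HasContinuousLogOn (fun z => z - a) (frontier D ∪ δ) := by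
  have hδc := hδ.isClosed
  obtain ⟨c, hc, hinj, ht, -, hc1, rfl, -⟩ := hδ
  have hinter : frontier D ∩ c '' Ici 0 ⊆ {c 0} := by
    rintro z ⟨hz, t, ht, rfl⟩
    by_contra h
    exact hc1 t (lt_of_le_of_ne ht fun h0 => h (by simp [h0])) (frontier_subset_closure hz)
  exact .union_of_subsingleton_inter isClosed_frontier hδc (subsingleton_singleton.anti hinter)
    (hD.hasContinuousLogOn_frontier fun h => ha (Or.inl h))
    (hasContinuousLogOn_image_Ici hc hinj ht fun h => ha (Or.inr h))

/-! ### Lifting of paths through local homeomorphisms -/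

section PathLifting

open unitInterval

variable {E X : Type*} [TopologicalSpace E] {p : E → X}

/-- The path `b` can be lifted through `p` on the time interval `[0, T]`, starting at `e`. -/
def IsLiftableUpTo (p : E → X) (b : ℝ → X) (e : E) (T : ℝ) : Prop :=
  ∃ g : ℝ → E, ContinuousOn g (Icc 0 T) ∧ EqOn (p ∘ g) b (Icc 0 T) ∧ g 0 = e

theorem IsLiftableUpTo.mono {b : ℝ → X} {e : E} {S T : ℝ} (h : IsLiftableUpTo p b e T)
    (hST : S ≤ T) : IsLiftableUpTo p b e S := by
  obtain ⟨g, hg, hgb, hg0⟩ := h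
  exact ⟨g, hg.mono (Icc_subset_Icc_right hST), hgb.mono (Icc_subset_Icc_right hST), hg0⟩

variable [TopologicalSpace X]

/-- Every path in `X` can be lifted through `p`, with a prescribed starting point. -/
def HasPathLifting (p : E → X) : Prop :=
  ∀ (γ : C(I, X)) (e : E), γ 0 = p e → ∃ Γ : C(I, E), Γ 0 = e ∧ p ∘ Γ = γ

/-- A lift of a path on a half-open time interval `[0, T)` converges as the time tends to `T`. -/
def HasLimitsOfLifts (p : E → X) : Prop :=
  ∀ (b : ℝ → X) (G : ℝ → E) (T : ℝ), 0 < T → Continuous b → ContinuousOn G (Ico 0 T) →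
    EqOn (p ∘ G) b (Ico 0 T) → ∃ w, Tendsto G (𝓝[<] T) (𝓝 w)

theorem IsLiftableUpTo.exists_gt (hp : IsLocalHomeomorph p) {b : ℝ → X} (hb : Continuous b)
    {e : E} {T : ℝ} (hT : 0 ≤ T) (h : IsLiftableUpTo p b e T) :
    ∃ T' > T, IsLiftableUpTo p b e T' := by
  obtain ⟨g, hg, hgb, hg0⟩ := h
  have hgT : p (g T) = b T := hgb ⟨hT, le_rfl⟩
  obtain ⟨φ, hφ, rfl⟩ := hp (g T)
  have hnear : ∀ᶠ t in 𝓝[≥] T, b t ∈ φ.target := nhdsWithin_le_nhds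
    (hb.continuousAt (φ.open_target.mem_nhds (hgT ▸ φ.map_source hφ)))
  obtain ⟨T', hTT', htar⟩ := (mem_nhdsGE_iff_exists_Icc_subset (a := T)).1 hnear
  obtain ⟨k, hk, hkg, hkφ⟩ := exists_continuousOn_glue (isClosed_Icc (a := 0) (b := T))
    (isClosed_Icc (a := T) (b := T')) hg (φ.continuousOn_symm.comp hb.continuousOn htar) (by
      rintro t ⟨ht1, ht2⟩
      obtain rfl : t = T := le_antisymm ht1.2 ht2.1
      rw [Function.comp_apply, ← hgT, φ.left_inv hφ])
  rw [Icc_union_Icc_eq_Icc hT hTT'.le] at hk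
  refine ⟨T', hTT', k, hk, fun t ht => ?_, (hkg ⟨le_rfl, hT⟩).trans hg0⟩
  rcases le_total t T with h | h
  · rw [Function.comp_apply, hkg ⟨ht.1, h⟩]
    exact hgb ⟨ht.1, h⟩
  · rw [Function.comp_apply, hkφ ⟨h, ht.2⟩]
    exact φ.right_inv (htar ⟨h, ht.2⟩)

theorem exists_lift_Ico (hp : IsLocalHomeomorph p) (hsep : IsSeparatedMap p) {b : ℝ → X} {e : E}
    {T : ℝ} (hT : 0 < T) (h : ∀ t < T, IsLiftableUpTo p b e t) :
    ∃ G : ℝ → E, ContinuousOn G (Ico 0 T) ∧ EqOn (p ∘ G) b (Ico 0 T) ∧ G 0 = e := by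
  have : Nonempty E := ⟨e⟩
  choose! g hg hgb hg0 using h
  have hagree (s t : ℝ) (h0 : 0 ≤ s) (hst : s ≤ t) (ht : t < T) : g s s = g t s := by
    have hss : Icc 0 s ⊆ Icc 0 t := Icc_subset_Icc_right hst
    have hs := hst.trans_lt ht
    have : EqOn (g s) (g t) (Icc 0 s) := hsep.eqOn_of_comp_eqOn hp.isLocallyInjective
      isPreconnected_Icc (hg s hs) ((hg t ht).mono hss)
      ((hgb s hs).trans ((hgb t ht).mono hss).symm) ⟨le_rfl, h0⟩ ((hg0 s hs).trans (hg0 t ht).symm)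
    exact this ⟨h0, le_rfl⟩
  refine ⟨fun t => g t t, fun t ht => ?_, fun t ht => hgb t ht.2 ⟨ht.1, le_rfl⟩, hg0 0 hT⟩
  obtain ⟨u, htu, huT⟩ := exists_between ht.2
  have hnear : Icc 0 u ∈ 𝓝[Ico 0 T] t := by
    filter_upwards [self_mem_nhdsWithin, mem_nhdsWithin_of_mem_nhds (Iio_mem_nhds htu)]
      with x hx hx' using ⟨hx.1, le_of_lt hx'⟩
  refine ((hg u huT t ⟨ht.1, htu.le⟩).mono_of_mem_nhdsWithin hnear).congr_of_eventuallyEq ?_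
    (hagree t u ht.1 htu.le huT)
  filter_upwards [hnear] with x hx using hagree x u hx.1 hx.2 huT

theorem isLiftableUpTo_of_forall_lt (hp : IsLocalHomeomorph p) (hsep : IsSeparatedMap p)
    [T2Space X] (hlim : HasLimitsOfLifts p) {b : ℝ → X} (hb : Continuous b) {e : E} {T : ℝ}
    (hT : 0 < T) (h : ∀ t < T, IsLiftableUpTo p b e t) : IsLiftableUpTo p b e T := by
  obtain ⟨G, hG, hGb, hG0⟩ := exists_lift_Ico hp hsep hT h
  obtain ⟨w, hw⟩ := hlim b G T hT hb hG hGb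
  have hpw : p w = b T := tendsto_nhds_unique_of_eventuallyEq
    ((hp.continuous.tendsto w).comp hw) (hb.continuousAt.tendsto.mono_left nhdsWithin_le_nhds)
    (hGb.eventuallyEq_of_mem (Ico_mem_nhdsLT hT))
  refine ⟨Function.update G T w, ?_, fun t ht => ?_, by rwa [Function.update_of_ne hT.ne]⟩
  · rw [continuousOn_update_iff, Icc_sdiff_right]
    exact ⟨hG, fun _ => hw.mono_left (nhdsWithin_mono _ fun x hx => hx.2)⟩
  · rcases ht.2.eq_or_lt with rfl | hlt
    · rw [Function.comp_apply, Function.update_self, hpw]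
    · rw [Function.comp_apply, Function.update_of_ne hlt.ne]
      exact hGb ⟨ht.1, hlt⟩

theorem isLiftableUpTo_one (hp : IsLocalHomeomorph p) (hsep : IsSeparatedMap p) [T2Space X]
    (hlim : HasLimitsOfLifts p) {b : ℝ → X} (hb : Continuous b) {e : E} (he : p e = b 0) :
    IsLiftableUpTo p b e 1 := by
  by_contra h1
  have h0 : IsLiftableUpTo p b e 0 :=
    ⟨fun _ => e, continuousOn_const, fun t ht => by simp_all, rfl⟩
  let B : Set ℝ := {T | IsLiftableUpTo p b e T}
  have hbdd : BddAbove B := ⟨1, fun T hT => not_lt.1 fun hlt => h1 (hT.mono hlt.le)⟩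
  have hT0 : 0 ≤ sSup B := le_csSup hbdd h0
  have hsup : IsLiftableUpTo p b e (sSup B) := by
    rcases hT0.eq_or_lt with hT | hT
    · rwa [← hT]
    · refine isLiftableUpTo_of_forall_lt hp hsep hlim hb hT fun t ht => ?_
      obtain ⟨s, hs, hts⟩ := exists_lt_of_lt_csSup ⟨0, h0⟩ ht
      exact IsLiftableUpTo.mono hs hts.le
  obtain ⟨T', hTT', hT'⟩ := hsup.exists_gt hp hb hT0
  exact (le_csSup hbdd hT').not_gt hTT'

theorem HasLimitsOfLifts.hasPathLifting (hp : IsLocalHomeomorph p) (hsep : IsSeparatedMap p)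
    [T2Space X] (hlim : HasLimitsOfLifts p) : HasPathLifting p := by
  intro γ e he
  obtain ⟨g, hg, hgb, hg0⟩ := isLiftableUpTo_one hp hsep hlim
    (b := fun t => γ (projIcc 0 1 zero_le_one t)) (by fun_prop) (e := e) (by simp [he])
  refine ⟨⟨fun t => g t, hg.comp_continuous continuous_subtype_val fun t => t.2⟩, hg0,
    funext fun t => ?_⟩
  simpa using hgb t.2

theorem HasPathLifting.exists_continuousMap_lift (hp : IsLocalHomeomorph p)
    (hsep : IsSeparatedMap p) (hlift : HasPathLifting p) {A : Type*} [TopologicalSpace A]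
    [SimplyConnectedSpace A] [LocallyPathConnectedSpace A] (g : C(A, X)) {a₀ : A} {e₀ : E}
    (h : p e₀ = g a₀) : ∃ F : C(A, E), F a₀ = e₀ ∧ p ∘ F = g := by
  have huniq {Γ Γ' : C(I, E)} (h0 : Γ 0 = Γ' 0) (hpΓ : p ∘ Γ = p ∘ Γ') : Γ = Γ' :=
    DFunLike.coe_injective (hsep.eq_of_comp_eq hp.isLocallyInjective (map_continuous _)
      (map_continuous _) hpΓ 0 h0)
  refine (hp.existsUnique_continuousMap_lifts g a₀ e₀ h (fun γ hγ =>
    hlift (g.comp γ) e₀ (by simp [hγ, h])) ?_).exists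
  intro γ γ' Γ Γ' γ0 γ'0 Γ0 Γ'0 hΓ hΓ' h1
  let pγ : Path a₀ (γ 1) := ⟨γ, γ0, rfl⟩
  let pγ' : Path a₀ (γ 1) := ⟨γ', γ'0, h1.symm⟩
  obtain ⟨H⟩ := SimplyConnectedSpace.paths_homotopic pγ pγ'
  have hΛ (t : I) : ∃ Λ : C(I, E), Λ 0 = e₀ ∧ p ∘ Λ = g.comp ⟨fun s => H (t, s), by fun_prop⟩ :=
    hlift _ e₀ (by simp [h])
  choose Λ hΛ0 hΛ using hΛ
  have hmonodromy := hp.monodromy_theorem hsep (γ₀ := g.comp pγ.toContinuousMap)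
    (γ₁ := g.comp pγ'.toContinuousMap) (H.compContinuousMap g) Λ
    (fun t s => congrFun (hΛ t) s) (fun t => (hΛ0 t).trans (hΛ0 0).symm) 1
  have hΓΛ : Γ = Λ 0 := huniq (Γ0.trans (hΛ0 0).symm) (by rw [hΓ, hΛ]; ext s; simp [pγ])
  have hΓ'Λ : Γ' = Λ 1 := huniq (Γ'0.trans (hΛ0 1).symm) (by rw [hΓ', hΛ]; ext s; simp [pγ'])
  rw [hΓΛ, hΓ'Λ, hmonodromy]

end PathLifting

/-! ### Entire functions away from their singular values -/

theorem deriv_ne_zero_of_notMem_singularSet {f : ℂ → ℂ} {z : ℂ} (h : f z ∉ singularSet f) :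
    deriv f z ≠ 0 := fun h' => h (subset_closure (Or.inl ⟨z, h', rfl⟩))

/-- The part of `f` that lies over the complement of its singular set. -/
def unramifiedPart (f : ℂ → ℂ) : ↥(f ⁻¹' (singularSet f)ᶜ) → ↥(singularSet f)ᶜ :=
  (singularSet f)ᶜ.restrictPreimage f

theorem isLocalHomeomorph_unramifiedPart {f : ℂ → ℂ} (hf : Differentiable ℂ f) :
    IsLocalHomeomorph (unramifiedPart f) := by
  have hS : IsOpen (singularSet f)ᶜ := isClosed_closure.isOpen_compl
  have hfon : IsLocalHomeomorphOn f (f ⁻¹' (singularSet f)ᶜ) := by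
    intro z hz
    have hderiv := (hf.analyticAt z).hasStrictDerivAt.hasStrictFDerivAt_equiv
      (deriv_ne_zero_of_notMem_singularSet hz)
    exact ⟨hderiv.toOpenPartialHomeomorph f, hderiv.mem_toOpenPartialHomeomorph_source, rfl⟩
  have hcomp : IsLocalHomeomorph (Subtype.val ∘ unramifiedPart f) :=
    isLocalHomeomorph_iff_isLocalHomeomorphOn_univ.2 (hfon.comp
      (hS.preimage hf.continuous).isOpenEmbedding_subtypeVal.isLocalHomeomorph.isLocalHomeomorphOn
      (fun z _ => z.2))
  exact hcomp.of_comp hS.isOpenEmbedding_subtypeVal.isLocalHomeomorph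
    hf.continuous.restrictPreimage

theorem isSeparatedMap_unramifiedPart (f : ℂ → ℂ) : IsSeparatedMap (unramifiedPart f) :=
  T2Space.isSeparatedMap _

theorem eqOn_of_comp_eqOn_of_notMem_singularSet {f : ℂ → ℂ} (hf : Differentiable ℂ f)
    {X : Type*} [TopologicalSpace X] {T : Set X} (hT : IsPreconnected T) {g₁ g₂ : X → ℂ}
    (h₁ : ContinuousOn g₁ T) (h₂ : ContinuousOn g₂ T) (h : EqOn (f ∘ g₁) (f ∘ g₂) T)
    (hs : ∀ x ∈ T, f (g₁ x) ∉ singularSet f) {a : X} (ha : a ∈ T) (hga : g₁ a = g₂ a) :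
    EqOn g₁ g₂ T := by
  have := Subtype.preconnectedSpace hT
  have hs' (x : X) (hx : x ∈ T) : f (g₂ x) ∉ singularSet f := by
    have hfx : f (g₁ x) = f (g₂ x) := h hx
    exact hfx ▸ hs x hx
  have key : (fun x : T => (⟨g₁ x, hs x x.2⟩ : ↥(f ⁻¹' (singularSet f)ᶜ))) =
      fun x => ⟨g₂ x, hs' x x.2⟩ := (isSeparatedMap_unramifiedPart f).eq_of_comp_eq
    (isLocalHomeomorph_unramifiedPart hf).isLocallyInjective
    ((continuousOn_iff_continuous_domRestrict.1 h₁).subtype_mk _)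
    ((continuousOn_iff_continuous_domRestrict.1 h₂).subtype_mk _)
    (funext fun x => Subtype.ext (h x.2)) ⟨a, ha⟩ (Subtype.ext hga)
  exact fun x hx => congrArg Subtype.val (congrFun key ⟨x, hx⟩)

theorem mem_asymptoticValues_of_tendsto_nhdsLT {f : ℂ → ℂ} {G : ℝ → ℂ} {a : ℂ} {T : ℝ} (hT : 0 < T)
    (hG : ContinuousOn G (Ico 0 T)) (hGc : Tendsto G (𝓝[<] T) (Bornology.cobounded ℂ))
    (hfG : Tendsto (fun t => f (G t)) (𝓝[<] T) (𝓝 a)) : a ∈ asymptoticValues f := by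
  let σ : ℝ → ℝ := fun s => T * (1 - (1 + s)⁻¹)
  have hmaps : MapsTo σ (Ici 0) (Ico 0 T) := by
    intro s (hs : 0 ≤ s)
    have hpos : 0 < (1 + s)⁻¹ := by positivity
    have hle : (1 + s)⁻¹ ≤ 1 := inv_le_one_of_one_le₀ (by linarith)
    constructor <;> nlinarith
  have hcont : ContinuousOn σ (Ici 0) := by
    refine continuousOn_const.mul (continuousOn_const.sub (ContinuousOn.inv₀ (by fun_prop) ?_))
    intro s (hs : 0 ≤ s)
    positivity
  have hlim : Tendsto σ atTop (𝓝[<] T) := by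
    have hinv : Tendsto (fun s : ℝ => (1 + s)⁻¹) atTop (𝓝 0) :=
      tendsto_inv_atTop_zero.comp (tendsto_atTop_add_const_left _ _ tendsto_id)
    refine tendsto_nhdsWithin_iff.2 ⟨by simpa using (hinv.const_sub 1).const_mul T, ?_⟩
    filter_upwards [eventually_ge_atTop 0] with s hs using (hmaps hs).2
  exact ⟨G ∘ σ, hG.comp hcont hmaps, hGc.comp hlim, hfG.comp hlim⟩

/-- Near the end point the curve avoids a small sphere around `w`, on which `h` stays away from the
limit `h w`; it cannot leave the ball once it has entered it. -/
theorem tendsto_of_mapClusterPt_of_isolated {E Y : Type*} [MetricSpace E] [ProperSpace E]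
    [TopologicalSpace Y] [T2Space Y] {h : E → Y} (hh : Continuous h) {G : ℝ → E} {a T : ℝ}
    (haT : a < T) (hG : ContinuousOn G (Ico a T)) {w : E} (hw : MapClusterPt w (𝓝[<] T) G)
    (hhG : Tendsto (h ∘ G) (𝓝[<] T) (𝓝 (h w))) (hiso : ∀ᶠ z in 𝓝[≠] w, h z ≠ h w) :
    Tendsto G (𝓝[<] T) (𝓝 w) := by
  obtain ⟨r, hr, hball⟩ := Metric.mem_nhdsWithin_iff.1 hiso
  rw [Metric.tendsto_nhds]
  intro ε₀ hε₀
  obtain ⟨ε, hε, hεlt⟩ := exists_between (lt_min hr hε₀)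
  have hsphere : h w ∉ h '' Metric.sphere w ε := by
    rintro ⟨z, hz, hzw⟩
    refine hball ⟨?_, Metric.ne_of_mem_sphere hz hε.ne'⟩ hzw
    exact Metric.mem_ball.2 ((Metric.mem_sphere.1 hz).trans_lt (hεlt.trans_le (min_le_left _ _)))
  have havoid : ∀ᶠ t in 𝓝[<] T, G t ∉ Metric.sphere w ε := by
    filter_upwards [hhG (((isCompact_sphere w ε).image hh).isClosed.isOpen_compl.mem_nhds hsphere)]
      with t ht hGt using ht ⟨_, hGt, rfl⟩
  obtain ⟨t₁, ht₁, havoid⟩ := (mem_nhdsLT_iff_exists_mem_Ico_Ioo_subset haT).1 havoid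
  obtain ⟨t₂, ht₂, ht₂'⟩ := ((hw.frequently (Metric.ball_mem_nhds w hε)).and_eventually
    (Ioo_mem_nhdsLT ht₁.2)).exists
  filter_upwards [Ioo_mem_nhdsLT ht₂'.2] with t ht
  refine lt_of_not_ge fun hge => ?_
  have hGt : ContinuousOn G (Icc t₂ t) :=
    hG.mono fun s hs => ⟨ht₁.1.trans (ht₂'.1.le.trans hs.1), hs.2.trans_lt ht.2⟩
  have hdist : ContinuousOn (fun t => dist (G t) w) (Icc t₂ t) := by fun_prop
  obtain ⟨s, hs, hse⟩ := intermediate_value_Icc ht.1.le hdist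
    (⟨(Metric.mem_ball.1 ht₂).le, (hεlt.le.trans (min_le_right _ _)).trans hge⟩ : ε ∈ Icc _ _)
  exact havoid ⟨ht₂'.1.trans_le hs.1, hs.2.trans_lt ht.2⟩ hse

theorem exists_mapClusterPt_of_not_tendsto_cobounded {α E : Type*} [PseudoMetricSpace E]
    [ProperSpace E] {l : Filter α} {G : α → E} (hG : ¬ Tendsto G l (Bornology.cobounded E)) :
    ∃ w, MapClusterPt w l G := by
  rw [Metric.cobounded_eq_cocompact, (hasBasis_cocompact).tendsto_right_iff] at hG
  push Not at hG
  obtain ⟨K, hK, hfreq⟩ := hG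
  obtain ⟨w, -, hw⟩ := hK.exists_mapClusterPt_of_frequently (hfreq.mono fun _ => not_not.1)
  exact ⟨w, hw⟩

/-- A lift that did not converge would exhibit the end point of the path as an asymptotic value. -/
theorem hasLimitsOfLifts_unramifiedPart {f : ℂ → ℂ} (hf : Differentiable ℂ f) :
    HasLimitsOfLifts (unramifiedPart f) := by
  intro b G T hT hb hG hGb
  have hGc : ContinuousOn (fun t => (G t : ℂ)) (Ico 0 T) := by fun_prop
  have hfG : Tendsto (fun t => f (G t)) (𝓝[<] T) (𝓝 (b T : ℂ)) := by
    refine ((continuous_subtype_val.comp hb).continuousAt.tendsto.mono_left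
      nhdsWithin_le_nhds).congr' ?_
    filter_upwards [Ico_mem_nhdsLT hT] with t ht
    exact congrArg Subtype.val (hGb ht).symm
  obtain ⟨w, hw⟩ := exists_mapClusterPt_of_not_tendsto_cobounded fun hGtop => (b T).2
    (subset_closure (Or.inr (mem_asymptoticValues_of_tendsto_nhdsLT hT hGc hGtop hfG)))
  have hfw : f w = b T := eq_of_nhds_neBot
    ((hw.continuousAt_comp hf.continuous.continuousAt).clusterPt.mono hfG)
  have hfwS : f w ∉ singularSet f := hfw ▸ (b T).2
  exact ⟨⟨w, hfwS⟩, tendsto_subtype_rng.2 (tendsto_of_mapClusterPt_of_isolated hf.continuous hT hGc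
    hw (hfw ▸ hfG) ((hf w).hasDerivAt.eventually_ne (deriv_ne_zero_of_notMem_singularSet hfwS)))⟩

theorem exists_lift_on_isSimplyConnected {f : ℂ → ℂ} (hf : Differentiable ℂ f) {A : Set ℂ}
    (hA : IsOpen A) (hs : IsSimplyConnected A) {g : ℂ → ℂ} (hg : ContinuousOn g A)
    (hgS : ∀ a ∈ A, g a ∉ singularSet f) {a₀ z₀ : ℂ} (ha₀ : a₀ ∈ A) (h : f z₀ = g a₀) :
    ∃ F : ℂ → ℂ, ContinuousOn F A ∧ F a₀ = z₀ ∧ EqOn (f ∘ F) g A := by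
  have := hs.simplyConnectedSpace
  have := hA.locallyPathConnectedSpace
  have hp := isLocalHomeomorph_unramifiedPart hf
  have hsep := isSeparatedMap_unramifiedPart f
  obtain ⟨F, hF0, hF⟩ := ((hasLimitsOfLifts_unramifiedPart hf).hasPathLifting hp
    hsep).exists_continuousMap_lift hp hsep
    (⟨fun a => ⟨g a, hgS a a.2⟩, (continuousOn_iff_continuous_domRestrict.1 hg).subtype_mk _⟩ :
      C(A, ↥(singularSet f)ᶜ)) (a₀ := ⟨a₀, ha₀⟩)
    (e₀ := ⟨z₀, by rw [mem_preimage, h]; exact hgS a₀ ha₀⟩) (Subtype.ext h)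
  have hext (a : A) : Function.extend Subtype.val (fun a => (F a : ℂ)) 0 (a : ℂ) = F a :=
    Subtype.val_injective.extend_apply _ _ a
  refine ⟨Function.extend Subtype.val (fun a => (F a : ℂ)) 0, ?_,
    (hext ⟨a₀, ha₀⟩).trans (congrArg Subtype.val hF0), fun a ha => ?_⟩
  · rw [continuousOn_iff_continuous_domRestrict]
    exact (continuous_subtype_val.comp F.continuous).congr fun a => (hext a).symm
  · rw [Function.comp_apply, hext ⟨a, ha⟩]
    exact congrArg Subtype.val (congrFun hF ⟨a, ha⟩)

/-! ### Preimages of simply connected domains -/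

/-- The identity of the component downstairs lifts to an inverse of `f`. -/
theorem exists_homeomorph_component_preimage {f : ℂ → ℂ} (hf : Differentiable ℂ f) {V : Set ℂ}
    (hV : IsOpen V) (hVS : Disjoint V (singularSet f)) {z : ℂ} (hz : f z ∈ V)
    (hs : IsSimplyConnected (connectedComponentIn V (f z))) :
    ∃ e : connectedComponentIn (f ⁻¹' V) z ≃ₜ connectedComponentIn V (f z),
      ∀ x, (e x : ℂ) = f x := by
  set V₀ := connectedComponentIn V (f z)
  set τ := connectedComponentIn (f ⁻¹' V) z
  have hV₀S (v : ℂ) (hv : v ∈ V₀) : v ∉ singularSet f :=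
    disjoint_left.1 hVS (connectedComponentIn_subset _ _ hv)
  have hzτ : z ∈ τ := mem_connectedComponentIn hz
  have hzV₀ : f z ∈ V₀ := mem_connectedComponentIn hz
  obtain ⟨ψ, hψ, hψ0, hfψ⟩ := exists_lift_on_isSimplyConnected hf hV.connectedComponentIn hs
    (g := id) continuousOn_id hV₀S hzV₀ rfl
  have hmf : MapsTo f τ V₀ := mapsTo_iff_image_subset.2
    ((isPreconnected_connectedComponentIn.image f
      hf.continuous.continuousOn).subset_connectedComponentIn ⟨z, hzτ, rfl⟩
        (image_subset_iff.2 (connectedComponentIn_subset _ _)))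
  have hmψ : MapsTo ψ V₀ τ := by
    refine mapsTo_iff_image_subset.2 ((isPreconnected_connectedComponentIn.image ψ
      hψ).subset_connectedComponentIn ⟨f z, hzV₀, hψ0⟩ (image_subset_iff.2 fun w hw => ?_))
    have hfw : f (ψ w) = w := hfψ hw
    rw [mem_preimage, mem_preimage, hfw]
    exact connectedComponentIn_subset _ _ hw
  have hψf : EqOn (ψ ∘ f) id τ := eqOn_of_comp_eqOn_of_notMem_singularSet hf
    isPreconnected_connectedComponentIn (hψ.comp hf.continuous.continuousOn hmf) continuousOn_id
    (fun x hx => hfψ (hmf hx)) (fun x hx => by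
      have hfx : f (ψ (f x)) = f x := hfψ (hmf hx)
      rw [Function.comp_apply, hfx]
      exact hV₀S _ (hmf hx)) hzτ hψ0
  exact ⟨{  toFun := hmf.restrict
            invFun := hmψ.restrict
            left_inv := fun x => Subtype.ext (hψf x.2)
            right_inv := fun w => Subtype.ext (hfψ w.2)
            continuous_toFun := hf.continuous.continuousOn.mapsToRestrict hmf
            continuous_invFun := hψ.mapsToRestrict hmψ }, fun _ => rfl⟩

theorem injOn_component_preimage {f : ℂ → ℂ} (hf : Differentiable ℂ f) {V : Set ℂ}
    (hV : IsOpen V) (hVS : Disjoint V (singularSet f)) {z : ℂ} (hz : f z ∈ V)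
    (hs : IsSimplyConnected (connectedComponentIn V (f z))) :
    InjOn f (connectedComponentIn (f ⁻¹' V) z) := by
  obtain ⟨e, he⟩ := exists_homeomorph_component_preimage hf hV hVS hz hs
  intro x hx y hy hxy
  have hexy : e ⟨x, hx⟩ = e ⟨y, hy⟩ := Subtype.ext (by rw [he, he, hxy])
  exact congrArg Subtype.val (e.injective hexy)

theorem image_component_preimage {f : ℂ → ℂ} (hf : Differentiable ℂ f) {V : Set ℂ}
    (hV : IsOpen V) (hVS : Disjoint V (singularSet f)) {z : ℂ} (hz : f z ∈ V)
    (hs : IsSimplyConnected (connectedComponentIn V (f z))) :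
    f '' connectedComponentIn (f ⁻¹' V) z = connectedComponentIn V (f z) := by
  obtain ⟨e, he⟩ := exists_homeomorph_component_preimage hf hV hVS hz hs
  ext w
  constructor
  · rintro ⟨x, hx, rfl⟩
    exact he ⟨x, hx⟩ ▸ (e ⟨x, hx⟩).2
  · intro hw
    exact ⟨e.symm ⟨w, hw⟩, (e.symm ⟨w, hw⟩).2, by rw [← he, e.apply_symm_apply]⟩

theorem hasLogBranches_of_components {S : Set ℂ} (hS : IsOpen S)
    (h : ∀ z ∈ S, ∀ c ∉ S, HasContinuousLogOn (fun x => x - c) (connectedComponentIn S z)) :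
    HasLogBranches S := by
  intro K hK _ c hc
  have hcomp (T : Set ℂ) (hT : IsComponentOf T S) :
      ∃ L : ℂ → ℂ, ContinuousOn L T ∧ ∀ x ∈ T, Complex.exp (L x) = x - c := by
    obtain ⟨z, hz, rfl⟩ := hT
    exact h z hz c hc
  choose! Λ hΛ hΛe using hcomp
  refine ⟨fun x => Λ (connectedComponentIn S x) x, ContinuousOn.mono (fun x hx => ?_) hK,
    fun x hx => hΛe _ ⟨x, hK hx, rfl⟩ x (mem_connectedComponentIn (hK hx))⟩
  have hnhds : connectedComponentIn S x ∈ 𝓝 x :=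
    hS.connectedComponentIn.mem_nhds (mem_connectedComponentIn hx)
  refine (((hΛ _ ⟨x, hx, rfl⟩).continuousAt hnhds).congr ?_).continuousWithinAt
  filter_upwards [hnhds] with y hy
  rw [connectedComponentIn_eq hy]

theorem hasLogBranches_preimage {f : ℂ → ℂ} (hf : Differentiable ℂ f) {V : Set ℂ}
    (hV : IsOpen V) (hVS : Disjoint V (singularSet f))
    (hs : ∀ v ∈ V, IsSimplyConnected (connectedComponentIn V v)) : HasLogBranches (f ⁻¹' V) := by
  have ho := hV.preimage hf.continuous
  refine hasLogBranches_of_components ho fun z hz c hc => ?_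
  obtain ⟨e, -⟩ := exists_homeomorph_component_preimage hf hV hVS hz (hs _ hz)
  have := (hs _ hz).simplyConnectedSpace
  have hτ : IsSimplyConnected (connectedComponentIn (f ⁻¹' V) z) :=
    e.toHomotopyEquiv.simplyConnectedSpace
  exact hasContinuousLogOn_of_isSimplyConnected hτ ho.connectedComponentIn (by fun_prop) fun x hx =>
    sub_ne_zero.2 (ne_of_mem_of_not_mem (connectedComponentIn_subset _ _ hx) hc)

/-! ### Closed lattice walks -/

section ClosedChains

variable {α G : Type*} [Group G]

/-- The product of `e` over the consecutive pairs of the list `a :: l`. -/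
def chainProd (e : α → α → G) : α → List α → G
  | _, [] => 1
  | a, b :: l => e a b * chainProd e b l

theorem chainProd_append (e : α → α → G) (a b : α) (l₁ l₂ : List α) :
    chainProd e a (l₁ ++ b :: l₂) = chainProd e a (l₁ ++ [b]) * chainProd e b l₂ := by
  induction l₁ generalizing a with
  | nil => simp [chainProd]
  | cons c l ih => simp [chainProd, ih c, mul_assoc]

theorem isChain_closed_split {R : α → α → Prop} {a b : α} {l₁ l₂ : List α} :
    List.IsChain R (a :: (l₁ ++ b :: l₂) ++ [a]) ↔
      List.IsChain R (a :: l₁ ++ [b]) ∧ List.IsChain R (b :: l₂ ++ [a]) := by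
  simpa using List.isChain_split (R := R) (c := b) (l₁ := a :: l₁) (l₂ := l₂ ++ [a])

theorem chainProd_closed_split (e : α → α → G) (a b : α) (l₁ l₂ : List α) :
    chainProd e a (l₁ ++ b :: l₂ ++ [a]) =
      chainProd e a (l₁ ++ [b]) * chainProd e b (l₂ ++ [a]) := by
  simpa using chainProd_append e a b l₁ (l₂ ++ [a])

theorem exists_rotation_of_mem (e : α → α → G) {R : α → α → Prop} {a b : α} {l : List α}
    (hb : b ∈ a :: l) (hc : List.IsChain R (a :: l ++ [a])) :
    ∃ l', (b :: l').Perm (a :: l) ∧ List.IsChain R (b :: l' ++ [b]) ∧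
      (chainProd e b (l' ++ [b]) = 1 → chainProd e a (l ++ [a]) = 1) := by
  rcases List.mem_cons.1 hb with rfl | hb
  · exact ⟨l, .refl _, hc, id⟩
  obtain ⟨s, t, rfl⟩ := List.append_of_mem hb
  refine ⟨t ++ a :: s, List.perm_append_comm (l₁ := b :: t) (l₂ := a :: s),
    isChain_closed_split.2 (isChain_closed_split.1 hc).symm, ?_⟩
  rw [chainProd_closed_split, chainProd_closed_split]
  exact mul_eq_one_comm.1

theorem chainProd_eq_one_of_not_nodup {e : α → α → G} {R : α → α → Prop} {a : α} {l : List α}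
    (hl : ¬ (a :: l).Nodup) (hc : List.IsChain R (a :: l ++ [a]))
    (ih : ∀ b l', l'.length < l.length → b :: l' ⊆ a :: l → List.IsChain R (b :: l' ++ [b]) →
      chainProd e b (l' ++ [b]) = 1) :
    chainProd e a (l ++ [a]) = 1 := by
  classical
  obtain ⟨b, hb⟩ := List.exists_duplicate_iff_not_nodup.2 hl
  obtain ⟨l', hperm, hc', hprod⟩ := exists_rotation_of_mem e hb.mem hc
  have hbl' : b ∈ l' := by
    have hcount := List.duplicate_iff_two_le_count.1 hb
    rw [← hperm.count_eq, List.count_cons_self] at hcount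
    exact List.count_pos_iff.1 (by omega)
  obtain ⟨s, t, rfl⟩ := List.append_of_mem hbl'
  obtain ⟨hs, ht⟩ := isChain_closed_split.1 hc'
  have hlen := hperm.length_eq
  simp only [List.length_cons, List.length_append] at hlen
  refine hprod ?_
  rw [chainProd_closed_split,
    ih b s (by omega) (fun v hv => hperm.subset (by aesop)) hs,
    ih b t (by omega) (fun v hv => hperm.subset (by aesop)) ht, one_mul]

end ClosedChains

/-- The lattice point with the given coordinates. -/
def latticePt (p : ℤ × ℤ) : ℂ := ⟨p.1, p.2⟩

/-- Two lattice points are neighbours, and the segment between them lies in `U`. -/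
def LatticeAdj (U : Set ℂ) (p q : ℤ × ℤ) : Prop :=
  (q.1 - p.1).natAbs + (q.2 - p.2).natAbs = 1 ∧ segment ℝ (latticePt p) (latticePt q) ⊆ U

theorem LatticeAdj.symm {U : Set ℂ} {p q : ℤ × ℤ} (h : LatticeAdj U p q) : LatticeAdj U q p :=
  ⟨by have := h.1; omega, segment_symm ℝ (latticePt p) _ ▸ h.2⟩

/-- The unit square below and to the right of the lattice point `b`. -/
def latticeSquare (b : ℤ × ℤ) : Set ℂ :=
  Icc (b.1 : ℝ) (b.1 + 1) ×ℂ Icc ((b.2 : ℝ) - 1) b.2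

theorem convex_latticeSquare (b : ℤ × ℤ) : Convex ℝ (latticeSquare b) :=
  ((convex_Icc (b.1 : ℝ) (b.1 + 1)).linear_preimage Complex.reLm).inter
    ((convex_Icc ((b.2 : ℝ) - 1) b.2).linear_preimage Complex.imLm)

theorem latticePt_mem_latticeSquare {b p : ℤ × ℤ} :
    latticePt p ∈ latticeSquare b ↔
      (b.1 ≤ p.1 ∧ p.1 ≤ b.1 + 1) ∧ b.2 - 1 ≤ p.2 ∧ p.2 ≤ b.2 := by
  simp only [latticeSquare, latticePt, Complex.mem_reProdIm, mem_Icc]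
  norm_cast

theorem latticeAdj_of_mem_convex {U C : Set ℂ} (hC : Convex ℝ C) (hCU : C ⊆ U) {p q : ℤ × ℤ}
    (hp : latticePt p ∈ C) (hq : latticePt q ∈ C)
    (hpq : (q.1 - p.1).natAbs + (q.2 - p.2).natAbs = 1) : LatticeAdj U p q :=
  ⟨hpq, (hC.segment_subset hp hq).trans hCU⟩

theorem re_mem_uIcc_of_mem_segment {a b z : ℂ} (hz : z ∈ segment ℝ a b) : z.re ∈ uIcc a.re b.re :=
  ((convex_uIcc a.re b.re).linear_preimage Complex.reLm).segment_subset left_mem_uIcc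
    right_mem_uIcc hz

theorem im_mem_uIcc_of_mem_segment {a b z : ℂ} (hz : z ∈ segment ℝ a b) : z.im ∈ uIcc a.im b.im :=
  ((convex_uIcc a.im b.im).linear_preimage Complex.imLm).segment_subset left_mem_uIcc
    right_mem_uIcc hz

theorem mk_mem_segment_horizontal {x₁ x₂ y x : ℝ} (hx : x ∈ Icc x₁ x₂) :
    (⟨x, y⟩ : ℂ) ∈ segment ℝ ⟨x₁, y⟩ ⟨x₂, y⟩ := by
  obtain ⟨s, t, hs, ht, hst, rfl⟩ := Icc_subset_segment (𝕜 := ℝ) hx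
  exact ⟨s, t, hs, ht, hst, Complex.ext (by simp) (by simp [← add_mul, hst])⟩

theorem mk_mem_segment_vertical {x y₁ y₂ y : ℝ} (hy : y ∈ Icc y₁ y₂) :
    (⟨x, y⟩ : ℂ) ∈ segment ℝ ⟨x, y₂⟩ ⟨x, y₁⟩ := by
  rw [segment_symm]
  obtain ⟨s, t, hs, ht, hst, rfl⟩ := Icc_subset_segment (𝕜 := ℝ) hy
  exact ⟨s, t, hs, ht, hst, Complex.ext (by simp [← add_mul, hst]) (by simp)⟩

theorem isCompact_segment {E : Type*} [AddCommGroup E] [Module ℝ E] [TopologicalSpace E]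
    [IsTopologicalAddGroup E] [ContinuousSMul ℝ E] (x y : E) : IsCompact (segment ℝ x y) := by
  rw [segment_eq_image_lineMap]
  exact isCompact_Icc.image AffineMap.lineMap_continuous

/-- The union of the segments between consecutive points of `a :: l`. -/
def latticeTrace : ℤ × ℤ → List (ℤ × ℤ) → Set ℂ
  | a, [] => {latticePt a}
  | a, b :: l => segment ℝ (latticePt a) (latticePt b) ∪ latticeTrace b l

theorem latticePt_mem_latticeTrace_head (a : ℤ × ℤ) (l : List (ℤ × ℤ)) :
    latticePt a ∈ latticeTrace a l := by
  cases l with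
  | nil => rfl
  | cons b l => exact Or.inl (left_mem_segment _ _ _)

theorem latticePt_mem_latticeTrace {a b : ℤ × ℤ} {l : List (ℤ × ℤ)} (h : b ∈ a :: l) :
    latticePt b ∈ latticeTrace a l := by
  induction l generalizing a with
  | nil => exact List.mem_singleton.1 h ▸ rfl
  | cons c l ih =>
    rcases List.mem_cons.1 h with rfl | h
    · exact latticePt_mem_latticeTrace_head _ _
    · exact Or.inr (ih h)

theorem isCompact_latticeTrace (a : ℤ × ℤ) (l : List (ℤ × ℤ)) : IsCompact (latticeTrace a l) := by
  induction l generalizing a with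
  | nil => exact isCompact_singleton
  | cons b l ih => exact (isCompact_segment _ _).union (ih b)

theorem isPreconnected_latticeTrace (a : ℤ × ℤ) (l : List (ℤ × ℤ)) :
    IsPreconnected (latticeTrace a l) := by
  induction l generalizing a with
  | nil => exact isPreconnected_singleton
  | cons b l ih =>
    exact IsPreconnected.union _ (right_mem_segment _ _ _) (latticePt_mem_latticeTrace_head b l)
      (convex_segment _ _).isPreconnected (ih b)

theorem exists_segment_of_mem_latticeTrace {U : Set ℂ} {a : ℤ × ℤ} {l : List (ℤ × ℤ)} (hl : l ≠ [])
    (hc : List.IsChain (LatticeAdj U) (a :: l)) {z : ℂ} (hz : z ∈ latticeTrace a l) :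
    ∃ p ∈ a :: l, ∃ q ∈ a :: l, LatticeAdj U p q ∧ z ∈ segment ℝ (latticePt p) (latticePt q) := by
  induction l generalizing a with
  | nil => exact absurd rfl hl
  | cons b l ih =>
    rw [List.isChain_cons_cons] at hc
    rcases hz with hz | hz
    · exact ⟨a, by simp, b, by simp, hc.1, hz⟩
    · rcases eq_or_ne l [] with rfl | hl'
      · exact ⟨a, by simp, b, by simp, hc.1, mem_singleton_iff.1 hz ▸ right_mem_segment _ _ _⟩
      · obtain ⟨p, hp, q, hq, h⟩ := ih hl' hc.2 hz
        exact ⟨p, List.mem_cons_of_mem _ hp, q, List.mem_cons_of_mem _ hq, h⟩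

theorem LatticeAdj.im_eq_of_re_mem_Ioo {U : Set ℂ} {p q : ℤ × ℤ} (h : LatticeAdj U p q) {z : ℂ}
    (hz : z ∈ segment ℝ (latticePt p) (latticePt q)) {i : ℤ} (hi : z.re ∈ Ioo (i : ℝ) (i + 1)) :
    q.2 = p.2 ∧ z.im = p.2 ∧ (p.1 = i ∨ q.1 = i) := by
  have hre : z.re ∈ uIcc (p.1 : ℝ) q.1 := re_mem_uIcc_of_mem_segment hz
  have him : z.im ∈ uIcc (p.2 : ℝ) q.2 := im_mem_uIcc_of_mem_segment hz
  have hpq : p.1 < i + 1 ∧ i < q.1 ∨ q.1 < i + 1 ∧ i < p.1 := by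
    rcases mem_uIcc.1 hre with ⟨h₁, h₂⟩ | ⟨h₁, h₂⟩
    · exact Or.inl ⟨by exact_mod_cast h₁.trans_lt hi.2, by exact_mod_cast hi.1.trans_le h₂⟩
    · exact Or.inr ⟨by exact_mod_cast h₁.trans_lt hi.2, by exact_mod_cast hi.1.trans_le h₂⟩
  have hadj := h.1
  have hq : q.2 = p.2 := by omega
  rw [hq, uIcc_self] at him
  exact ⟨hq, him, by omega⟩

/-! ### Squares at the corners of a closed walk -/

theorem neg_mem_slitPlane_of_forall_ne {w : ℂ} (h : ∀ t : ℝ, 0 ≤ t → w ≠ t) :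
    -w ∈ Complex.slitPlane := by
  rw [Complex.mem_slitPlane_iff]
  by_contra! hw
  exact h w.re (by simpa using hw.1) (Complex.ext rfl (by simpa using hw.2))

/-- Along `S` the argument of `g` changes by the difference of the principal arguments of `g` at `a`
and `b`; along `T` it changes by the same amount minus a full turn. -/
theorem not_hasContinuousLogOn_union_of_mem_slitPlane {X : Type*} [TopologicalSpace X] {g : X → ℂ}
    {S T : Set X} (hg : Continuous g) (hS : IsPreconnected S) (hT : IsPreconnected T)
    (hgS : ∀ x ∈ S, g x ∈ Complex.slitPlane) (hgT : ∀ x ∈ T, -g x ∈ Complex.slitPlane) {a b : X}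
    (haS : a ∈ S) (haT : a ∈ T) (hbS : b ∈ S) (hbT : b ∈ T) (ha : 0 < (g a).im)
    (hb : (g b).im < 0) : ¬ HasContinuousLogOn g (S ∪ T) := by
  rintro ⟨L, hL, hLg⟩
  have hchangeS := log_sub_log_eq_of_isPreconnected hS (L := L) (M := fun x => Complex.log (g x))
    (hL.mono subset_union_left) (hg.continuousOn.clog hgS) (fun x hx => by
      rw [hLg x (Or.inl hx), Complex.exp_log (Complex.slitPlane_ne_zero (hgS x hx))]) haS hbS
  have hchangeT := log_sub_log_eq_of_isPreconnected hT (L := L)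
    (M := fun x => Complex.log (-g x) + Real.pi * Complex.I)
    (hL.mono subset_union_right) ((hg.neg.continuousOn.clog hgT).add continuousOn_const)
    (fun x hx => by
      rw [hLg x (Or.inr hx), Complex.exp_add, Complex.exp_pi_mul_I,
        Complex.exp_log (Complex.slitPlane_ne_zero (hgT x hx))]
      ring) haT hbT
  have him := congrArg Complex.im (hchangeS.symm.trans hchangeT)
  simp only [Complex.sub_im, Complex.add_im, Complex.log_im] at him
  rw [Complex.arg_neg_eq_arg_sub_pi_of_im_pos ha, Complex.arg_neg_eq_arg_add_pi_of_im_neg hb] at him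
  linarith [Real.pi_pos]

theorem div_mem_slitPlane_of_im_pos {u v : ℂ} (hu : 0 < u.im) (hv : 0 < v.im) :
    u / v ∈ Complex.slitPlane := by
  have hv0 : v ≠ 0 := fun h => hv.ne' (by simp [h])
  rw [← neg_neg (u / v)]
  refine neg_mem_slitPlane_of_forall_ne fun t ht h => ?_
  have him := congrArg Complex.im ((div_eq_iff hv0).1 (neg_eq_iff_eq_neg.1 h))
  simp only [← Complex.ofReal_neg, Complex.im_ofReal_mul] at him
  nlinarith

theorem HasLogBranches.reProdIm_subset {U T : Set ℂ} (hU : HasLogBranches U) {x y : ℝ}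
    (hTU : T ⊆ U) (hTc : IsCompact T) (hT : IsPreconnected T) (hl : (⟨x, y⟩ : ℂ) ∈ T)
    (hr : (⟨x + 1, y⟩ : ℂ) ∈ T) (htop : segment ℝ (⟨x, y⟩ : ℂ) ⟨x + 1, y⟩ ⊆ U)
    (hleft : segment ℝ (⟨x, y⟩ : ℂ) ⟨x, y - 1⟩ ⊆ U) (him : ∀ z ∈ T, z.im ≤ y)
    (hstrip : ∀ z ∈ T, z.re ∈ Ioo x (x + 1) → z.im ≤ y - 1) :
    Icc x (x + 1) ×ℂ Icc (y - 1) y ⊆ U := by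
  rintro q ⟨hqre, hqim⟩
  by_contra hqU
  have hqy : q.im < y := hqim.2.lt_of_ne fun h => hqU (htop (h ▸ mk_mem_segment_horizontal hqre))
  have hqx : x < q.re := hqre.1.lt_of_ne fun h => hqU (hleft (h ▸ mk_mem_segment_vertical hqim))
  set M : ℂ := ⟨x + 1 / 2, y⟩ with hM
  have hMq : M - q ≠ 0 := fun h => hqy.ne' <| by
    simpa [hM, sub_eq_zero] using congrArg Complex.im h
  have hgT (z : ℂ) (hz : z ∈ T) : -((z - q) / (M - q)) ∈ Complex.slitPlane := by
    refine neg_mem_slitPlane_of_forall_ne fun t ht h => ?_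
    rw [div_eq_iff hMq] at h
    have hre : z.re - q.re = t * (x + 1 / 2 - q.re) := by simpa [hM] using congrArg Complex.re h
    have hie : z.im - q.im = t * (y - q.im) := by simpa [hM] using congrArg Complex.im h
    rcases ht.eq_or_lt with rfl | ht0
    · exact hqU (hTU ((Complex.ext (by linarith) (by linarith) : z = q) ▸ hz))
    · have hzy := him z hz
      have hzstrip := hstrip z hz ⟨by nlinarith, by nlinarith [hqre.2]⟩
      nlinarith [hqim.1]
  have hgS (z : ℂ) (hz : z ∈ segment ℝ (⟨x, y⟩ : ℂ) ⟨x + 1, y⟩) :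
      (z - q) / (M - q) ∈ Complex.slitPlane := by
    have hzy : z.im = y := by simpa using im_mem_uIcc_of_mem_segment hz
    exact div_mem_slitPlane_of_im_pos (by simpa [hzy]) (by simpa [hM])
  have hnorm : 0 < Complex.normSq (M - q) := Complex.normSq_pos.2 hMq
  refine not_hasContinuousLogOn_union_of_mem_slitPlane (g := fun z => (z - q) / (M - q))
    (by fun_prop) (convex_segment (⟨x, y⟩ : ℂ) ⟨x + 1, y⟩).isPreconnected hT hgS hgT
    (left_mem_segment _ _ _) hl (right_mem_segment _ _ _) hr ?_ ?_ ?_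
  · rw [Complex.div_im, ← sub_div]
    refine div_pos ?_ hnorm
    simp [hM]
    nlinarith
  · rw [Complex.div_im, ← sub_div]
    refine div_neg_of_neg_of_pos ?_ hnorm
    simp [hM]
    nlinarith
  · exact (hU _ (union_subset htop hTU) ((isCompact_segment _ _).union hTc) q hqU).mul
      (hasContinuousLogOn_const (inv_ne_zero hMq) _)

theorem HasLogBranches.latticeSquare_subset {U : Set ℂ} (hU : HasLogBranches U) {b c : ℤ × ℤ}
    {l : List (ℤ × ℤ)} (hl : l ≠ []) (hc : List.IsChain (LatticeAdj U) (c :: l)) (hb : b ∉ c :: l)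
    (htop : ∀ v ∈ c :: l, v.2 ≤ b.2) (hr : (b.1 + 1, b.2) ∈ c :: l) (hd : (b.1, b.2 - 1) ∈ c :: l)
    (hbr : LatticeAdj U b (b.1 + 1, b.2)) (hbd : LatticeAdj U b (b.1, b.2 - 1)) :
    latticeSquare b ⊆ U := by
  have hright : latticePt (b.1 + 1, b.2) = ⟨b.1 + 1, b.2⟩ := by simp [latticePt]
  have hdown : latticePt (b.1, b.2 - 1) = ⟨b.1, b.2 - 1⟩ := by simp [latticePt]
  refine hU.reProdIm_subset (T := latticeTrace c l ∪
    segment ℝ (latticePt b) (latticePt (b.1, b.2 - 1))) ?_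
    ((isCompact_latticeTrace _ _).union (isCompact_segment _ _))
    (IsPreconnected.union _ (latticePt_mem_latticeTrace hd) (right_mem_segment _ _ _)
      (isPreconnected_latticeTrace _ _) (convex_segment _ _).isPreconnected)
    (Or.inr (left_mem_segment _ _ _)) (Or.inl (hright ▸ latticePt_mem_latticeTrace hr))
    (hright ▸ hbr.2) (hdown ▸ hbd.2) ?_ ?_
  · refine union_subset (fun z hz => ?_) hbd.2
    obtain ⟨p, -, q, -, hpq, hz⟩ := exists_segment_of_mem_latticeTrace hl hc hz
    exact hpq.2 hz
  · rintro z (hz | hz)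
    · obtain ⟨p, hp, q, hq, -, hz⟩ := exists_segment_of_mem_latticeTrace hl hc hz
      exact (im_mem_uIcc_of_mem_segment hz).2.trans
        (max_le (Int.cast_le.2 (htop p hp)) (Int.cast_le.2 (htop q hq)))
    · exact (im_mem_uIcc_of_mem_segment hz).2.trans (max_le le_rfl (by simp [hdown]))
  · rintro z (hz | hz) hre
    · obtain ⟨p, hp, q, hq, hpq, hz⟩ := exists_segment_of_mem_latticeTrace hl hc hz
      obtain ⟨hqp, hzp, hor⟩ := hpq.im_eq_of_re_mem_Ioo hz hre
      have hlt : p.2 < b.2 := (htop p hp).lt_of_ne fun h => hb <| hor.elim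
        (fun h₁ => (Prod.ext h₁ h : p = b) ▸ hp)
        (fun h₁ => (Prod.ext h₁ (hqp.trans h) : q = b) ▸ hq)
      rw [hzp]
      exact_mod_cast Int.le_sub_one_of_lt hlt
    · have hzb : z.re = b.1 := by simpa [latticePt] using re_mem_uIcc_of_mem_segment hz
      exact absurd (hzb ▸ hre.1) (lt_irrefl _)

section ClosedCorner

variable {α G : Type*} [Group G]

theorem isChain_closed_cons_concat {R : α → α → Prop} {b c d : α} {l : List α} :
    List.IsChain R (b :: (c :: (l ++ [d])) ++ [b]) ↔
      R b c ∧ List.IsChain R (c :: (l ++ [d])) ∧ R d b := by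
  have h := List.isChain_split (R := R) (c := d) (l₁ := c :: l) (l₂ := [b])
  simp only [List.cons_append, List.isChain_pair] at h
  simp [List.isChain_cons_cons, h]

theorem chainProd_closed_cons_concat (e : α → α → G) (b c d : α) (l : List α) :
    chainProd e b (c :: (l ++ [d]) ++ [b]) = e b c * (chainProd e c (l ++ [d]) * e d b) := by
  have h := chainProd_append e c d l [b]
  simp only [chainProd, mul_one] at h
  simp [chainProd, ← h]

end ClosedCorner

theorem exists_topLeft (a : ℤ × ℤ) (l : List (ℤ × ℤ)) :
    ∃ b ∈ a :: l, ∀ v ∈ a :: l, v.2 < b.2 ∨ v.2 = b.2 ∧ b.1 ≤ v.1 := by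
  obtain ⟨b, hb, hmax⟩ := (a :: l).toFinset.exists_max_image (fun v => toLex (v.2, -v.1))
    ⟨a, by simp⟩
  refine ⟨b, by simpa using hb, fun v hv => ?_⟩
  simpa [Prod.Lex.toLex_le_toLex] using hmax v (by simpa using hv)

/-- `e` is multiplicative on triples contained in a common convex subset of `U`. -/
def IsConvexCocycle {G : Type*} [Group G] (U : Set ℂ) (e : ℂ → ℂ → G) : Prop :=
  ∀ C ⊆ U, Convex ℝ C → ∀ x ∈ C, ∀ y ∈ C, ∀ z ∈ C, e x y * e y z = e x z

/-- The restriction of `e` to pairs of lattice points. -/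
def latticeCocycle {G : Type*} (e : ℂ → ℂ → G) (p q : ℤ × ℤ) : G := e (latticePt p) (latticePt q)

section LatticeWalk

variable {G : Type*} [Group G] {U : Set ℂ} {e : ℂ → ℂ → G}

theorem IsConvexCocycle.self_eq_one (he : IsConvexCocycle U e) {z : ℂ} (hz : z ∈ U) : e z z = 1 :=
  mul_eq_right.1 (he {z} (singleton_subset_iff.2 hz) (convex_singleton z) z rfl z rfl z rfl)

theorem IsConvexCocycle.mul_swap_eq_one (he : IsConvexCocycle U e) {x y : ℂ}
    (h : segment ℝ x y ⊆ U) : e x y * e y x = 1 := by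
  rw [he _ h (convex_segment x y) x (left_mem_segment _ _ _) y (right_mem_segment _ _ _) x
    (left_mem_segment _ _ _), he.self_eq_one (h (left_mem_segment _ _ _))]

theorem chainProd_closed_eq_one_iff_of_convex (he : IsConvexCocycle U e) {C : Set ℂ} (hCU : C ⊆ U)
    (hC : Convex ℝ C) {b c d : ℤ × ℤ} (hb : latticePt b ∈ C) (hc : latticePt c ∈ C)
    (hd : latticePt d ∈ C) (l : List (ℤ × ℤ)) :
    chainProd (latticeCocycle e) b (c :: (l ++ [d]) ++ [b]) = 1 ↔
      chainProd (latticeCocycle e) c (l ++ [d]) * latticeCocycle e d c = 1 := by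
  rw [chainProd_closed_cons_concat, mul_eq_one_comm, mul_assoc]
  unfold latticeCocycle
  rw [he C hCU hC _ hd _ hb _ hc]

theorem LatticeAdj.topLeft_neighbours {b c d : ℤ × ℤ} (hbc : LatticeAdj U b c)
    (hdb : LatticeAdj U d b) (hcd : c ≠ d) (hc : c.2 < b.2 ∨ c.2 = b.2 ∧ b.1 ≤ c.1)
    (hd : d.2 < b.2 ∨ d.2 = b.2 ∧ b.1 ≤ d.1) :
    (c = (b.1 + 1, b.2) ∧ d = (b.1, b.2 - 1)) ∨ (d = (b.1 + 1, b.2) ∧ c = (b.1, b.2 - 1)) := by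
  have hc' := hbc.1
  have hd' := hdb.1
  rw [Ne, Prod.ext_iff] at hcd
  simp only [Prod.ext_iff]
  omega

/-- The corner `b` is pushed across the adjacent lattice square, which lowers the walk. -/
theorem chainProd_eq_one_of_topLeft (hU : HasLogBranches U) (he : IsConvexCocycle U e) {b : ℤ × ℤ}
    {l : List (ℤ × ℤ)} (hnd : (b :: l).Nodup) (htl : ∀ v ∈ l, v.2 < b.2 ∨ v.2 = b.2 ∧ b.1 ≤ v.1)
    (hc : List.IsChain (LatticeAdj U) (b :: l ++ [b]))
    (ih : ∀ b', b' = (b.1 + 1, b.2 - 1) → (b.1, b.2 - 1) ∈ l →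
      List.IsChain (LatticeAdj U) (b' :: l ++ [b']) →
      chainProd (latticeCocycle e) b' (l ++ [b']) = 1) :
    chainProd (latticeCocycle e) b (l ++ [b]) = 1 := by
  rcases l with _ | ⟨c, l⟩
  · have hbb : LatticeAdj U b b := by simpa using hc
    simpa using hbb.1
  rcases List.eq_nil_or_concat' l with rfl | ⟨l, d, rfl⟩
  · have hbc : LatticeAdj U b c ∧ LatticeAdj U c b := by simpa using hc
    simpa [chainProd, latticeCocycle] using he.mul_swap_eq_one hbc.1.2
  obtain ⟨hbc, hcl, hdb⟩ := isChain_closed_cons_concat.1 hc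
  have hloc := hbc.topLeft_neighbours hdb (by rintro rfl; simp at hnd) (htl c (by simp))
    (htl d (by simp))
  have hsq : latticeSquare b ⊆ U := by
    have htop (v) (hv : v ∈ c :: (l ++ [d])) : v.2 ≤ b.2 := by have := htl v hv; omega
    rcases hloc with ⟨rfl, rfl⟩ | ⟨rfl, rfl⟩
    · exact hU.latticeSquare_subset (by simp) hcl hnd.notMem htop (by simp) (by simp) hbc hdb.symm
    · exact hU.latticeSquare_subset (by simp) hcl hnd.notMem htop (by simp) (by simp) hdb.symm hbc
  obtain ⟨hb', hcC, hdC, hcadj, hdadj, hdown⟩ :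
      latticePt (b.1 + 1, b.2 - 1) ∈ latticeSquare b ∧ latticePt c ∈ latticeSquare b ∧
      latticePt d ∈ latticeSquare b ∧
      (c.1 - (b.1 + 1)).natAbs + (c.2 - (b.2 - 1)).natAbs = 1 ∧
      (b.1 + 1 - d.1).natAbs + (b.2 - 1 - d.2).natAbs = 1 ∧
      (b.1, b.2 - 1) ∈ c :: (l ++ [d]) := by
    simp only [latticePt_mem_latticeSquare]
    rcases hloc with ⟨rfl, rfl⟩ | ⟨rfl, rfl⟩ <;> simp
  have hconv := convex_latticeSquare b
  have hpushed := ih _ rfl hdown (isChain_closed_cons_concat.2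
    ⟨latticeAdj_of_mem_convex hconv hsq hb' hcC hcadj, hcl,
      latticeAdj_of_mem_convex hconv hsq hdC hb' hdadj⟩)
  rw [chainProd_closed_eq_one_iff_of_convex he hsq hconv _ hcC hdC] at hpushed ⊢
  · exact hpushed
  · simp [latticePt_mem_latticeSquare]
  · exact hb'

theorem chainProd_eq_one_of_le_snd (hU : HasLogBranches U) (he : IsConvexCocycle U e) (m : ℤ)
    (a : ℤ × ℤ) (l : List (ℤ × ℤ)) (hm : ∀ v ∈ a :: l, m ≤ v.2)
    (hc : List.IsChain (LatticeAdj U) (a :: l ++ [a])) :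
    chainProd (latticeCocycle e) a (l ++ [a]) = 1 := by
  by_cases hnd : (a :: l).Nodup
  · obtain ⟨b, hb, htl⟩ := exists_topLeft a l
    obtain ⟨l', hperm, hc', hprod⟩ := exists_rotation_of_mem (latticeCocycle e) hb hc
    have hsub (v) (hv : v ∈ l') : v ∈ a :: l := hperm.subset (List.mem_cons_of_mem _ hv)
    refine hprod (chainProd_eq_one_of_topLeft hU he (hperm.nodup_iff.2 hnd)
      (fun v hv => htl v (hsub v hv)) hc' fun b' hb' hdown hc'' => ?_)
    have hmb' : m ≤ b.2 - 1 := hm _ (hsub _ hdown)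
    exact chainProd_eq_one_of_le_snd hU he m b' l'
      (List.forall_mem_cons.2 ⟨by rwa [hb'], fun v hv => hm v (hsub v hv)⟩) hc''
  · exact chainProd_eq_one_of_not_nodup hnd hc fun b l' _ hsub hc' =>
      chainProd_eq_one_of_le_snd hU he m b l' (fun v hv => hm v (hsub hv)) hc'
termination_by (l.length, ((a :: l).map fun v => (v.2 - m).toNat).sum)
decreasing_by
  · rw [show l'.length = l.length by simpa using hperm.length_eq]
    refine Prod.Lex.right _ ?_
    rw [← (hperm.map fun v => (v.2 - m).toNat).sum_eq, hb']
    simp only [List.map_cons, List.sum_cons]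
    omega
  · exact Prod.Lex.left _ _ ‹l'.length < l.length›

theorem chainProd_eq_one_of_isChain (hU : HasLogBranches U) (he : IsConvexCocycle U e)
    {a : ℤ × ℤ} {l : List (ℤ × ℤ)} (hc : List.IsChain (LatticeAdj U) (a :: l ++ [a])) :
    chainProd (latticeCocycle e) a (l ++ [a]) = 1 := by
  obtain ⟨b, -, hb⟩ := (a :: l).toFinset.exists_min_image Prod.snd ⟨a, by simp⟩
  exact chainProd_eq_one_of_le_snd hU he b.2 a l (fun v hv => hb v (by simpa using hv)) hc

end LatticeWalk

section LatticeWalk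

variable {G : Type*} [Group G] {U : Set ℂ} {e : ℂ → ℂ → G} {p q r : ℤ × ℤ} {g : G}

/-- `LatticeWalk U e p q g`: there is a lattice walk in `U` from `p` to `q` along which the values
of `e` multiply to `g`. -/
inductive LatticeWalk (U : Set ℂ) (e : ℂ → ℂ → G) (p : ℤ × ℤ) : ℤ × ℤ → G → Prop
  | refl : LatticeWalk U e p p 1
  | step {q r : ℤ × ℤ} {g : G} : LatticeWalk U e p q g → LatticeAdj U q r →
      LatticeWalk U e p r (g * latticeCocycle e q r)

theorem LatticeWalk.exists_list (h : LatticeWalk U e p q g) : (p = q ∧ g = 1) ∨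
    ∃ l, List.IsChain (LatticeAdj U) (p :: l ++ [q]) ∧
      chainProd (latticeCocycle e) p (l ++ [q]) = g := by
  induction h with
  | refl => exact Or.inl ⟨rfl, rfl⟩
  | @step q r g _ hqr ih =>
    right
    rcases ih with ⟨rfl, rfl⟩ | ⟨l, hl, rfl⟩
    · exact ⟨[], by simpa using hqr, by simp [chainProd]⟩
    · refine ⟨l ++ [q], ?_, ?_⟩
      · simpa using (List.isChain_split (l₁ := p :: l) (l₂ := [r])).2 ⟨hl, by simpa using hqr⟩
      · simpa [chainProd] using chainProd_append (latticeCocycle e) p q l [r]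

theorem LatticeWalk.eq_one (hU : HasLogBranches U) (he : IsConvexCocycle U e)
    (h : LatticeWalk U e p p g) : g = 1 := by
  rcases h.exists_list with ⟨-, h⟩ | ⟨l, hl, rfl⟩
  · exact h
  · exact chainProd_eq_one_of_isChain hU he hl

theorem LatticeWalk.step_of_mem_convex (he : IsConvexCocycle U e) {C : Set ℂ} (hC : Convex ℝ C)
    (hCU : C ⊆ U) (h : LatticeWalk U e p q g) (hq : latticePt q ∈ C) (hr : latticePt r ∈ C)
    (hqr : (r.1 - q.1).natAbs + (r.2 - q.2).natAbs ≤ 1) :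
    LatticeWalk U e p r (g * latticeCocycle e q r) := by
  rcases Nat.le_one_iff_eq_zero_or_eq_one.1 hqr with h0 | h1
  · obtain rfl : q = r := Prod.ext (by omega) (by omega)
    rwa [latticeCocycle, he.self_eq_one (hCU hq), mul_one]
  · exact h.step (latticeAdj_of_mem_convex hC hCU hq hr h1)

theorem LatticeWalk.diagonal_step_of_mem_convex (he : IsConvexCocycle U e) {C : Set ℂ}
    (hC : Convex ℝ C) (hCU : C ⊆ U) (h : LatticeWalk U e p q g) (hq : latticePt q ∈ C)
    (hr : latticePt r ∈ C) (hqr : latticePt (r.1, q.2) ∈ C) (h₁ : (r.1 - q.1).natAbs ≤ 1)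
    (h₂ : (r.2 - q.2).natAbs ≤ 1) : LatticeWalk U e p r (g * latticeCocycle e q r) := by
  have hsplit : latticeCocycle e q r =
      latticeCocycle e q (r.1, q.2) * latticeCocycle e (r.1, q.2) r :=
    (he C hCU hC _ hq _ hqr _ hr).symm
  rw [hsplit, ← mul_assoc]
  exact (h.step_of_mem_convex he hC hCU hq hqr (by simpa using h₁)).step_of_mem_convex he hC hCU
    hqr hr (by simpa using h₂)

/-- The lower left corner of the unit lattice square containing `z`. -/
noncomputable def latticeFloor (z : ℂ) : ℤ × ℤ := (⌊z.re⌋, ⌊z.im⌋)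

theorem natAbs_floor_sub_floor_le_one {x y : ℝ} (h : |y - x| ≤ 1) : (⌊y⌋ - ⌊x⌋).natAbs ≤ 1 := by
  obtain ⟨h₁, h₂⟩ := abs_le.1 h
  have hyx : ⌊y⌋ ≤ ⌊x⌋ + 1 := Int.floor_add_one x ▸ Int.floor_mono (by linarith)
  have hxy : ⌊x⌋ ≤ ⌊y⌋ + 1 := Int.floor_add_one y ▸ Int.floor_mono (by linarith)
  omega

theorem norm_latticePt_floor_sub_le {u v w : ℂ} (hu : ‖u - w‖ ≤ 1) (hv : ‖v - w‖ ≤ 1) :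
    ‖latticePt (⌊u.re⌋, ⌊v.im⌋) - w‖ ≤ 4 := by
  have hfloor {x y : ℝ} (h : |x - y| ≤ 1) : |(⌊x⌋ : ℝ) - y| ≤ 2 := by
    rw [abs_le] at h ⊢
    constructor <;> linarith [Int.floor_le x, Int.lt_floor_add_one x]
  have hre := hfloor ((Complex.abs_re_le_norm (u - w)).trans hu)
  have him := hfloor ((Complex.abs_im_le_norm (v - w)).trans hv)
  refine (Complex.norm_le_abs_re_add_abs_im _).trans ?_
  simp only [latticePt, Complex.sub_re, Complex.sub_im]
  linarith

theorem exists_latticeWalk_of_unit_steps (he : IsConvexCocycle U e) {w : ℕ → ℂ}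
    (hball : ∀ i, Metric.ball (w i) 5 ⊆ U) (hstep : ∀ i, ‖w (i + 1) - w i‖ ≤ 1) {P : ℕ → G}
    (hP0 : P 0 = 1) (hP : ∀ i, P (i + 1) = P i * e (w i) (w (i + 1))) (n : ℕ) :
    ∃ g, LatticeWalk U e (latticeFloor (w 0)) (latticeFloor (w n)) g ∧
      P n * e (w n) (latticePt (latticeFloor (w n))) =
        e (w 0) (latticePt (latticeFloor (w 0))) * g := by
  induction n with
  | zero => exact ⟨1, .refl, by rw [hP0, one_mul, mul_one]⟩
  | succ n ih =>
    obtain ⟨g, hg, hgP⟩ := ih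
    have hself : ‖w n - w n‖ ≤ 1 := by simp
    have hmem {u v : ℂ} (hu : ‖u - w n‖ ≤ 1) (hv : ‖v - w n‖ ≤ 1) :
        latticePt (⌊u.re⌋, ⌊v.im⌋) ∈ Metric.ball (w n) 5 := by
      rw [mem_ball_iff_norm]
      linarith [norm_latticePt_floor_sub_le hu hv]
    have hfloor : latticePt (latticeFloor (w n)) ∈ Metric.ball (w n) 5 := hmem hself hself
    have hfloor' : latticePt (latticeFloor (w (n + 1))) ∈ Metric.ball (w n) 5 :=
      hmem (hstep n) (hstep n)
    have hw : w n ∈ Metric.ball (w n) 5 := Metric.mem_ball_self (by norm_num)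
    have hw' : w (n + 1) ∈ Metric.ball (w n) 5 := mem_ball_iff_norm.2 (by linarith [hstep n])
    have hcocycle := he _ (hball n) (convex_ball _ _)
    refine ⟨_, hg.diagonal_step_of_mem_convex he (convex_ball (w n) 5) (hball n) hfloor hfloor'
      (hmem (hstep n) hself)
      (natAbs_floor_sub_floor_le_one ((Complex.abs_re_le_norm _).trans (hstep n)))
      (natAbs_floor_sub_floor_le_one ((Complex.abs_im_le_norm _).trans (hstep n))), ?_⟩
    calc P (n + 1) * e (w (n + 1)) (latticePt (latticeFloor (w (n + 1))))
        = P n * e (w n) (latticePt (latticeFloor (w (n + 1)))) := by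
          rw [hP, mul_assoc, hcocycle _ hw _ hw' _ hfloor']
      _ = P n * (e (w n) (latticePt (latticeFloor (w n))) *
            latticeCocycle e (latticeFloor (w n)) (latticeFloor (w (n + 1)))) := by
          rw [latticeCocycle, hcocycle _ hw _ hfloor _ hfloor']
      _ = _ := by rw [← mul_assoc, hgP, mul_assoc]

theorem prod_cocycle_eq_one_of_unit_steps (hU : HasLogBranches U) (he : IsConvexCocycle U e)
    {w : ℕ → ℂ} (hball : ∀ i, Metric.ball (w i) 5 ⊆ U) (hstep : ∀ i, ‖w (i + 1) - w i‖ ≤ 1)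
    {P : ℕ → G} (hP0 : P 0 = 1) (hP : ∀ i, P (i + 1) = P i * e (w i) (w (i + 1))) {n : ℕ}
    (hn : w n = w 0) : P n = 1 := by
  obtain ⟨g, hg, hgP⟩ := exists_latticeWalk_of_unit_steps he hball hstep hP0 hP n
  rw [hn] at hg hgP
  rwa [hg.eq_one hU he, mul_one, mul_eq_right] at hgP

theorem HasLogBranches.preimage_mul {V : Set ℂ} (hV : HasLogBranches V) {c : ℂ} (hc : c ≠ 0) :
    HasLogBranches ((c * ·) ⁻¹' V) := by
  intro K hKV hK a ha
  obtain ⟨L, hL, hLexp⟩ := hV ((c * ·) '' K) (image_subset_iff.2 hKV) (hK.image (by fun_prop)) _ ha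
  refine ⟨fun z => L (c * z) - Complex.log c,
    (hL.comp (by fun_prop) (mapsTo_image _ _)).sub continuousOn_const, fun z hz => ?_⟩
  rw [Complex.exp_sub, hLexp _ (mem_image_of_mem _ hz), Complex.exp_log hc]
  change (c * z - c * a) / c = z - a
  rw [← mul_sub, mul_div_cancel_left₀ _ hc]

theorem IsConvexCocycle.preimage_mul (he : IsConvexCocycle U e) (c : ℂ) :
    IsConvexCocycle ((c * ·) ⁻¹' U) fun z w => e (c * z) (c * w) := fun _ hCU hC _ hx _ hy _ hz =>
  he _ (image_subset_iff.2 hCU) (hC.is_linear_image (LinearMap.mulLeft ℝ c).isLinear)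
    _ (mem_image_of_mem _ hx) _ (mem_image_of_mem _ hy) _ (mem_image_of_mem _ hz)

theorem prod_cocycle_eq_one (hU : HasLogBranches U) (he : IsConvexCocycle U e) {ε : ℝ} (hε : 0 < ε)
    {w : ℕ → ℂ} (hball : ∀ i, Metric.ball (w i) (5 * ε) ⊆ U)
    (hstep : ∀ i, ‖w (i + 1) - w i‖ ≤ ε) {P : ℕ → G} (hP0 : P 0 = 1)
    (hP : ∀ i, P (i + 1) = P i * e (w i) (w (i + 1))) {n : ℕ} (hn : w n = w 0) : P n = 1 := by
  have hε0 : (ε : ℂ) ≠ 0 := Complex.ofReal_ne_zero.2 hε.ne'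
  have hscale (i : ℕ) : (ε : ℂ) * (w i / ε) = w i := mul_div_cancel₀ _ hε0
  refine prod_cocycle_eq_one_of_unit_steps (hU.preimage_mul hε0) (he.preimage_mul ε)
    (w := fun i => w i / ε) (fun i z hz => hball i ?_) (fun i => ?_) hP0 (fun i => ?_) (by rw [hn])
  · rw [mem_ball_iff_norm] at hz ⊢
    calc ‖ε * z - w i‖ = ε * ‖z - w i / ε‖ := by
          rw [← hscale i, ← mul_sub, norm_mul, hscale, Complex.norm_of_nonneg hε.le]
      _ < 5 * ε := by rw [mul_comm]; gcongr
  · rw [← sub_div, norm_div, Complex.norm_of_nonneg hε.le, div_le_one hε]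
    exact hstep i
  · rw [hscale, hscale, hP]

end LatticeWalk

/-! ### Simple connectivity from logarithm branches -/

section BasedLoops

variable {X : Type*} [TopologicalSpace X] {x₀ x y z : X}

theorem quotient_symm_trans_cancel (p : Path.Homotopic.Quotient x y)
    (q : Path.Homotopic.Quotient y z) : p.symm.trans (p.trans q) = q := by
  rw [← Path.Homotopic.Quotient.trans_assoc, Path.Homotopic.Quotient.symm_trans,
    Path.Homotopic.Quotient.refl_trans]

variable [PathConnectedSpace X]

/-- The class of the loop at `x₀` that runs along a fixed path to `x`, then along `p`, and back from
`y` along a fixed path. The opposite group makes it multiplicative for concatenation from left to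
right. -/
noncomputable def basedLoopClass (x₀ : X) (p : Path x y) : (FundamentalGroup X x₀)ᵐᵒᵖ :=
  .op (((Path.Homotopic.Quotient.mk (PathConnectedSpace.somePath x₀ x)).trans (.mk p)).trans
    (Path.Homotopic.Quotient.mk (PathConnectedSpace.somePath x₀ y)).symm)

theorem basedLoopClass_trans (p : Path x y) (q : Path y z) :
    basedLoopClass x₀ (p.trans q) = basedLoopClass x₀ p * basedLoopClass x₀ q := by
  refine congrArg MulOpposite.op ?_
  change _ = Path.Homotopic.Quotient.trans _ _
  simp only [Path.Homotopic.Quotient.mk_trans, Path.Homotopic.Quotient.trans_assoc,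
    MulOpposite.unop_op, basedLoopClass, quotient_symm_trans_cancel]

theorem basedLoopClass_congr {p q : Path x y} (h : p.Homotopic q) :
    basedLoopClass x₀ p = basedLoopClass x₀ q := by
  rw [basedLoopClass, basedLoopClass, Path.Homotopic.Quotient.eq.2 h]

theorem basedLoopClass_cast {x' y' : X} (p : Path x y) (hx : x' = x) (hy : y' = y) :
    basedLoopClass x₀ (p.cast hx hy) = basedLoopClass x₀ p := by
  subst hx hy
  rfl

theorem basedLoopClass_refl : basedLoopClass x₀ (Path.refl x) = 1 := by
  have h := basedLoopClass_trans (x₀ := x₀) (Path.refl x) (Path.refl x)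
  rwa [Path.refl_trans_refl, left_eq_mul] at h

theorem homotopic_refl_of_basedLoopClass_eq_one {p : Path x x} (h : basedLoopClass x₀ p = 1) :
    p.Homotopic (Path.refl x) := by
  set s := Path.Homotopic.Quotient.mk (PathConnectedSpace.somePath x₀ x)
  have hconj : (s.trans (.mk p)).trans s.symm = Path.Homotopic.Quotient.refl x₀ :=
    MulOpposite.op_injective h
  rw [← Path.Homotopic.Quotient.eq]
  calc Path.Homotopic.Quotient.mk p
      = s.symm.trans (((s.trans (.mk p)).trans s.symm).trans s) := by
        simp [quotient_symm_trans_cancel]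
    _ = .mk (Path.refl x) := by rw [hconj]; simp

end BasedLoops

section SegmentPath

variable {V C : Set ℂ}

theorem path_homotopic_of_convex (hC : Convex ℝ C) (hCV : C ⊆ V) {a b : V} (p q : Path a b)
    (hp : ∀ t, (p t : ℂ) ∈ C) (hq : ∀ t, (q t : ℂ) ∈ C) : p.Homotopic q := by
  refine ⟨⟨⟨⟨fun st => ⟨AffineMap.lineMap (p st.2 : ℂ) (q st.2 : ℂ) (st.1 : ℝ),
    hCV (hC.lineMap_mem (hp _) (hq _) st.1.2)⟩, ?_⟩, fun t => by simp, fun t => by simp⟩, ?_⟩⟩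
  · refine Continuous.subtype_mk ?_ _
    simp only [AffineMap.lineMap_apply]
    fun_prop
  · rintro t x (rfl | rfl) <;> simp

/-- The straight path from `x` to `y`, as a path in a set `V` containing the segment. -/
noncomputable def segmentPath {x y : ℂ} (h : segment ℝ x y ⊆ V) :
    Path (⟨x, h (left_mem_segment ℝ x y)⟩ : V) ⟨y, h (right_mem_segment ℝ x y)⟩ where
  toFun t := ⟨AffineMap.lineMap x y (t : ℝ),
    h (segment_eq_image_lineMap ℝ x y ▸ mem_image_of_mem _ t.2)⟩
  continuous_toFun := by
    refine Continuous.subtype_mk ?_ _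
    simp only [AffineMap.lineMap_apply]
    fun_prop
  source' := by simp
  target' := by simp

theorem segmentPath_mem {x y : ℂ} (h : segment ℝ x y ⊆ V) (hC : Convex ℝ C) (hx : x ∈ C)
    (hy : y ∈ C) (t : unitInterval) : (segmentPath h t : ℂ) ∈ C :=
  hC.lineMap_mem hx hy t.2

variable [PathConnectedSpace V] {x₀ : V}

open Classical in
/-- The loop class of the straight path between two points, with the value `1` when the segment
leaves `V`. -/
noncomputable def segmentCocycle (V : Set ℂ) [PathConnectedSpace V] (x₀ : V) (a b : ℂ) :
    (FundamentalGroup V x₀)ᵐᵒᵖ :=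
  if h : segment ℝ a b ⊆ V then basedLoopClass x₀ (segmentPath h) else 1

theorem basedLoopClass_eq_segmentCocycle (hC : Convex ℝ C) (hCV : C ⊆ V) {a b : V} (p : Path a b)
    (hp : ∀ t, (p t : ℂ) ∈ C) : basedLoopClass x₀ p = segmentCocycle V x₀ a b := by
  have ha : (a : ℂ) ∈ C := by simpa using hp 0
  have hb : (b : ℂ) ∈ C := by simpa using hp 1
  have hab : segment ℝ (a : ℂ) b ⊆ V := (hC.segment_subset ha hb).trans hCV
  rw [segmentCocycle, dif_pos hab]
  exact basedLoopClass_congr (path_homotopic_of_convex hC hCV _ _ hp (segmentPath_mem hab hC ha hb))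

theorem isConvexCocycle_segmentCocycle (x₀ : V) : IsConvexCocycle V (segmentCocycle V x₀) := by
  intro C hCV hC a ha b hb c hc
  have hab : segment ℝ a b ⊆ V := (hC.segment_subset ha hb).trans hCV
  have hbc : segment ℝ b c ⊆ V := (hC.segment_subset hb hc).trans hCV
  have htrans : ∀ t, ((segmentPath hab).trans (segmentPath hbc) t : ℂ) ∈ C := by
    intro t
    have ht := Path.trans_range (segmentPath hab) (segmentPath hbc) ▸ mem_range_self t
    rcases ht with ⟨s, hs⟩ | ⟨s, hs⟩
    · exact hs ▸ segmentPath_mem hab hC ha hb s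
    · exact hs ▸ segmentPath_mem hbc hC hb hc s
  calc segmentCocycle V x₀ a b * segmentCocycle V x₀ b c
      = basedLoopClass x₀ (segmentPath hab) * basedLoopClass x₀ (segmentPath hbc) := by
        rw [segmentCocycle, dif_pos hab, segmentCocycle, dif_pos hbc]
    _ = segmentCocycle V x₀ a c := by
        rw [← basedLoopClass_trans, basedLoopClass_eq_segmentCocycle hC hCV _ htrans]

theorem segmentCocycle_of_notMem {a b : ℂ} (ha : a ∉ V) : segmentCocycle V x₀ a b = 1 :=
  dif_neg fun h => ha (h (left_mem_segment ℝ a b))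

end SegmentPath

theorem IsConvexCocycle.of_connectedComponentIn {G : Type*} [Group G] {V : Set ℂ} {z : ℂ}
    {e : ℂ → ℂ → G} (he : IsConvexCocycle (connectedComponentIn V z) e)
    (hout : ∀ a b, a ∉ connectedComponentIn V z → e a b = 1) : IsConvexCocycle V e := by
  intro C hCV hC
  by_cases hmeet : ∃ a ∈ C, a ∈ connectedComponentIn V z
  · obtain ⟨a, haC, haV⟩ := hmeet
    refine he C ?_ hC
    rw [connectedComponentIn_eq haV]
    exact hC.isPreconnected.subset_connectedComponentIn haC hCV
  · push Not at hmeet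
    intro a ha b hb c _
    rw [hout a b (hmeet a ha), hout b c (hmeet b hb), hout a c (hmeet a ha), mul_one]

theorem exists_subdivision_mem_ball {V : Set ℂ} {x y : V} (β : Path x y) {ε : ℝ} (hε : 0 < ε) :
    ∃ t : ℕ → unitInterval, t 0 = 0 ∧ (∃ n, t n = 1) ∧
      ∀ i, ∃ s, ∀ u ∈ uIcc (t i) (t (i + 1)), (β u : ℂ) ∈ Metric.ball (β s : ℂ) ε := by
  have hβ : Continuous fun t => (β t : ℂ) := by fun_prop
  obtain ⟨t, ht0, hmono, ⟨n, hn⟩, ht⟩ := exists_monotone_Icc_subset_open_cover_unitInterval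
    (c := fun s => (fun t => (β t : ℂ)) ⁻¹' Metric.ball (β s : ℂ) ε)
    (fun s => Metric.isOpen_ball.preimage hβ)
    (fun s _ => mem_iUnion.2 ⟨s, Metric.mem_ball_self hε⟩)
  refine ⟨t, ht0, ⟨n, hn n le_rfl⟩, fun i => ?_⟩
  rw [uIcc_of_le (hmono i.le_succ)]
  exact ht i

theorem HasLogBranches.isSimplyConnected_connectedComponentIn {V : Set ℂ} (hVo : IsOpen V)
    (hV : HasLogBranches V) {z : ℂ} (hz : z ∈ V) :
    IsSimplyConnected (connectedComponentIn V z) := by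
  set V₀ := connectedComponentIn V z
  have hV₀o : IsOpen V₀ := hVo.connectedComponentIn
  have : PathConnectedSpace V₀ := isPathConnected_iff_pathConnectedSpace.1
    (hV₀o.isConnected_iff_isPathConnected.1 (isConnected_connectedComponentIn_iff.2 hz))
  rw [IsSimplyConnected, simply_connected_iff_loops_nullhomotopic]
  refine ⟨inferInstance, fun x β => homotopic_refl_of_basedLoopClass_eq_one (x₀ := x) ?_⟩
  have he : IsConvexCocycle V (segmentCocycle V₀ x) :=
    (isConvexCocycle_segmentCocycle x).of_connectedComponentIn fun _ _ => segmentCocycle_of_notMem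
  have hcont : Continuous fun t => (β t : ℂ) := by fun_prop
  obtain ⟨ε, hε, hεV⟩ := (isCompact_range hcont).exists_thickening_subset_open hV₀o
    (range_subset_iff.2 fun t => (β t).2)
  have hball (t) : Metric.ball (β t : ℂ) ε ⊆ V₀ :=
    (Metric.ball_subset_thickening (mem_range_self t) ε).trans hεV
  obtain ⟨t, ht0, ⟨n, hn⟩, ht⟩ := exists_subdivision_mem_ball β (ε := ε / 10) (by positivity)
  have hstep (i) : basedLoopClass x (β.subpath (t i) (t (i + 1))) =
      segmentCocycle V₀ x (β (t i)) (β (t (i + 1))) := by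
    obtain ⟨s, hs⟩ := ht i
    refine basedLoopClass_eq_segmentCocycle (convex_ball (β s : ℂ) (ε / 10))
      ((Metric.ball_subset_ball (by linarith)).trans (hball s)) _ fun r => ?_
    obtain ⟨u, hu, hur⟩ := Path.range_subpath β (t i) (t (i + 1)) ▸ mem_range_self r
    exact hur ▸ hs u hu
  have hprod : basedLoopClass x (β.subpath (t 0) (t n)) = 1 := by
    refine prod_cocycle_eq_one hV he (ε := ε / 5) (by positivity) (w := fun i => (β (t i) : ℂ))
      (fun i => ?_) (fun i => ?_) (P := fun i => basedLoopClass x (β.subpath (t 0) (t i))) ?_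
      (fun i => ?_) ?_
    · rw [mul_div_cancel₀ ε (by norm_num : (5 : ℝ) ≠ 0)]
      exact (hball _).trans (connectedComponentIn_subset _ _)
    · obtain ⟨s, hs⟩ := ht i
      rw [← dist_eq_norm]
      linarith [dist_triangle_right (β (t (i + 1)) : ℂ) (β (t i)) (β s),
        Metric.mem_ball.1 (hs _ right_mem_uIcc), Metric.mem_ball.1 (hs _ left_mem_uIcc)]
    · rw [Path.subpath_self, basedLoopClass_refl]
    · rw [← hstep, ← basedLoopClass_trans]
      exact basedLoopClass_congr ⟨(Path.Homotopy.subpathTransSubpath β _ _ _).symm⟩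
    · rw [hn, ht0, β.source, β.target]
  rwa [ht0, hn, Path.subpath_zero_one, basedLoopClass_cast] at hprod

/-! ### Tracts over a neighbourhood of infinity -/

theorem tendsto_cobounded_of_comp {α : Type*} {l : Filter α} {f : ℂ → ℂ} (hf : Continuous f)
    {c : α → ℂ} (h : Tendsto (fun t => f (c t)) l (Bornology.cobounded ℂ)) :
    Tendsto c l (Bornology.cobounded ℂ) := by
  rw [Metric.cobounded_eq_cocompact] at h ⊢
  exact (tendsto_comap_iff.2 h).mono_right (comap_cocompact_le hf)

theorem exists_polynomial_of_isBigO_pow {f : ℂ → ℂ} (hf : Differentiable ℂ f) {k : ℕ}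
    (h : f =O[Bornology.cobounded ℂ] fun z => z ^ k) : ∃ p : Polynomial ℂ, ∀ z, f z = p.eval z := by
  obtain ⟨C, hC⟩ := h.bound
  obtain ⟨M, -, hM⟩ := (Metric.hasBasis_cobounded_compl_closedBall (0 : ℂ)).eventually_iff.1 hC
  have hcoeff (m : ℕ) (hm : k < m) : iteratedDeriv m f 0 = 0 := by
    have hcauchy (r : ℝ) (hr : max M 0 < r) :
        ‖iteratedDeriv m f 0‖ ≤ m.factorial * (C * r ^ k) / r ^ m := by
      refine Complex.norm_iteratedDeriv_le_of_forall_mem_sphere_norm_le m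
        ((le_max_right M 0).trans_lt hr) hf.diffContOnCl fun z hz => ?_
      rw [mem_sphere_zero_iff_norm] at hz
      simpa [hz] using hM (x := z) (by simpa [hz] using (le_max_left M 0).trans_lt hr)
    have hlim : Tendsto (fun r : ℝ => m.factorial * (C * r ^ k) / r ^ m) atTop (𝓝 0) := by
      have := (tendsto_pow_div_pow_atTop_zero (𝕜 := ℝ) hm).const_mul (m.factorial * C)
      rw [mul_zero] at this
      refine this.congr fun r => by ring
    exact norm_le_zero_iff.1 (ge_of_tendsto hlim ((eventually_gt_atTop _).mono hcauchy))
  refine ⟨∑ m ∈ Finset.range (k + 1), Polynomial.C ((m.factorial : ℂ)⁻¹ * iteratedDeriv m f 0) *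
    Polynomial.X ^ m, fun z => ?_⟩
  rw [← Complex.taylorSeries_eq_of_entire' 0 z hf, tsum_eq_sum (s := Finset.range (k + 1))]
  · simp [Polynomial.eval_finsetSum]
  · intro m hm
    rw [hcoeff m (by simpa using hm), mul_zero, zero_mul]

theorem IsTranscendentalEntire.isOpenMap {f : ℂ → ℂ} (hf : IsTranscendentalEntire f) :
    IsOpenMap f := by
  rcases AnalyticOnNhd.is_constant_or_isOpenMap (g := f) (fun z _ => hf.1.analyticAt z) with
    ⟨w, hw⟩ | h
  · exact absurd ⟨Polynomial.C w, fun z => by simp [hw]⟩ hf.2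
  · exact h

theorem hasDerivAt_of_comp_eq {f g G : ℂ → ℂ} {f' g' w : ℂ} (hf : HasStrictDerivAt f f' (G w))
    (hf' : f' ≠ 0) (hG : ContinuousAt G w) (hg : HasDerivAt g g' w)
    (h : ∀ᶠ x in 𝓝 w, f (G x) = g x) : HasDerivAt G (f'⁻¹ * g') w := by
  have hinv := (hf.to_localInverse hf').hasDerivAt
  rw [h.self_of_nhds] at hinv
  refine (hinv.comp w hg).congr_of_eventuallyEq ?_
  filter_upwards [hG.eventually (hf.hasStrictFDerivAt_equiv hf').eventually_left_inverse, h]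
    with x hx hx'
  rw [← hx, hx']
  rfl

/-- The half-plane to the right of the vertical line through `a`. -/
def rightHalfPlane (a : ℝ) : Set ℂ := {w | a < w.re}

theorem convex_rightHalfPlane (a : ℝ) : Convex ℝ (rightHalfPlane a) := convex_halfSpace_re_gt a

theorem isOpen_rightHalfPlane (a : ℝ) : IsOpen (rightHalfPlane a) :=
  isOpen_lt continuous_const Complex.continuous_re

theorem add_intCast_mul_two_pi_I_mem_rightHalfPlane {a : ℝ} {w : ℂ} (hw : w ∈ rightHalfPlane a)
    (k : ℤ) : w + k * (2 * Real.pi * Complex.I) ∈ rightHalfPlane a := by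
  simpa [rightHalfPlane] using hw

theorem exp_lt_norm_exp {a : ℝ} {w : ℂ} (hw : w ∈ rightHalfPlane a) :
    Real.exp a < ‖Complex.exp w‖ := by
  rw [Complex.norm_exp]
  exact Real.exp_lt_exp.2 hw

theorem eventually_mem_rightHalfPlane (a : ℝ) :
    ∀ᶠ w in comap Complex.re atTop, w ∈ rightHalfPlane a :=
  tendsto_comap.eventually (eventually_gt_atTop a)

theorem analyticAt_cuspFunction_zero {u : ℂ → ℂ} {h : ℝ} (hh : 0 < h)
    (hper : Function.Periodic u h) (hu : ∀ᶠ z in comap Complex.im atTop, DifferentiableAt ℂ u z)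
    (hlim : Tendsto u (comap Complex.im atTop) (𝓝 0)) :
    AnalyticAt ℂ (Function.Periodic.cuspFunction h u) 0 := by
  rw [Complex.analyticAt_iff_eventually_differentiableAt, ← nhdsNE_sup_pure, eventually_sup]
  exact ⟨Function.Periodic.eventually_differentiableAt_cuspFunction_nhds_ne_zero hh hper hu,
    Function.Periodic.differentiableAt_cuspFunction_zero hh hper hu
      (Filter.ZeroAtFilter.boundedAtFilter hlim)⟩

/-- The function `g` is `v` in the coordinate `q = exp (-w / k)`. -/
theorem exists_analyticAt_of_periodic {v : ℂ → ℂ} {a : ℝ} {k : ℕ} (hk : 0 < k)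
    (hv : DifferentiableOn ℂ v (rightHalfPlane a))
    (hper : ∀ w ∈ rightHalfPlane a, v (w + k * (2 * Real.pi * Complex.I)) = v w)
    (hlim : Tendsto v (comap Complex.re atTop) (𝓝 0)) :
    ∃ g : ℂ → ℂ, AnalyticAt ℂ g 0 ∧ g 0 = 0 ∧ ∀ᶠ q in 𝓝[≠] 0, ∃ w ∈ rightHalfPlane a,
      ‖Complex.exp w‖ = ‖q‖⁻¹ ^ k ∧ g q = v w := by
  set h : ℝ := 2 * Real.pi * k with h_def
  have hh : 0 < h := by positivity
  set u : ℂ → ℂ := fun z => (rightHalfPlane a).indicator v (-Complex.I * z)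
  have hre (z : ℂ) : (-Complex.I * z).re = z.im := by simp
  have hrot : Tendsto (fun z => -Complex.I * z) (comap Complex.im atTop)
      (comap Complex.re atTop) := by
    simpa only [tendsto_comap_iff, Function.comp_def, hre] using tendsto_comap
  have hind : (rightHalfPlane a).indicator v =ᶠ[comap Complex.re atTop] v :=
    (eventually_mem_rightHalfPlane a).mono fun w hw => indicator_of_mem hw v
  have hu_per : Function.Periodic u (h : ℂ) := by
    intro z
    have hz : -Complex.I * z = -Complex.I * (z + h) + k * (2 * Real.pi * Complex.I) := by
      rw [h_def]; push_cast; ring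
    by_cases hmem : -Complex.I * (z + h) ∈ rightHalfPlane a
    · have hmem' := add_intCast_mul_two_pi_I_mem_rightHalfPlane hmem k
      rw [Int.cast_natCast, ← hz] at hmem'
      simp only [u, indicator_of_mem hmem, indicator_of_mem hmem', ← hper _ hmem, ← hz]
    · have hmem' : -Complex.I * z ∉ rightHalfPlane a := by
        simpa [rightHalfPlane] using hmem
      simp only [u, indicator_of_notMem hmem, indicator_of_notMem hmem']
  have hu_lim : Tendsto u (comap Complex.im atTop) (𝓝 0) := (hlim.congr' hind.symm).comp hrot
  have hu_diff : ∀ᶠ z in comap Complex.im atTop, DifferentiableAt ℂ u z := by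
    filter_upwards [hrot.eventually (eventually_mem_rightHalfPlane a)] with z hz
    have hnhds := (isOpen_rightHalfPlane a).mem_nhds hz
    exact ((hv.differentiableAt hnhds).congr_of_eventuallyEq
      (eventually_of_mem hnhds fun w hw => indicator_of_mem hw v)).comp z
        (f := fun z => -Complex.I * z) (by fun_prop)
  refine ⟨Function.Periodic.cuspFunction h u, analyticAt_cuspFunction_zero hh hu_per hu_diff hu_lim,
    Function.Periodic.cuspFunction_zero_of_zero_at_inf hh hu_lim, ?_⟩
  filter_upwards [(hrot.comp (Function.Periodic.invQParam_tendsto hh)).eventually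
    (eventually_mem_rightHalfPlane a), self_mem_nhdsWithin] with q hq hq0
  have hexp : -h / (2 * Real.pi) * Real.log ‖q‖ = k * -Real.log ‖q‖ := by
    rw [h_def]; field_simp
  refine ⟨_, hq, ?_, ?_⟩
  · rw [Function.comp_apply, Complex.norm_exp, hre, Function.Periodic.im_invQParam, hexp,
      Real.exp_nat_mul, Real.exp_neg, Real.exp_log (norm_pos_iff.2 hq0)]
  · rw [Function.Periodic.cuspFunction_eq_of_nonzero h u hq0]
    exact indicator_of_mem hq v

theorem isBigO_pow_of_analyticAt_inv {f g : ℂ → ℂ} {k : ℕ} (hg : AnalyticAt ℂ g 0) (hg₀ : g 0 = 0)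
    (h : ∀ᶠ q in 𝓝[≠] 0, g q ≠ 0 ∧ ‖f (g q)⁻¹‖ = ‖q‖⁻¹ ^ k) :
    f =O[Bornology.cobounded ℂ] fun z => z ^ k := by
  obtain ⟨C, hC⟩ := hg.differentiableAt.isBigO_sub.bound
  simp only [hg₀, sub_zero] at hC
  have hnonconst : ¬ ∀ᶠ q in 𝓝 (0 : ℂ), g q = g 0 := fun hconst => by
    obtain ⟨q, hq, hq'⟩ := (h.and (hconst.filter_mono nhdsWithin_le_nhds)).exists
    exact hq.1 (hq'.trans hg₀)
  have hopen : 𝓝 0 ≤ map g (𝓝 0) := by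
    simpa only [hg₀] using hg.eventually_constant_or_nhds_le_map_nhds.resolve_left hnonconst
  have hsmall := hopen (image_mem_map ((eventually_nhdsWithin_iff.1 h).and hC))
  refine Asymptotics.IsBigO.of_bound (C ^ k) ?_
  filter_upwards [tendsto_inv₀_cobounded hsmall, Bornology.eventually_ne_cobounded 0]
    with z hz hz₀
  obtain ⟨q, ⟨hq, hqC⟩, hqz⟩ := hz
  have hq₀ : q ≠ 0 := by
    rintro rfl
    exact hz₀ (inv_eq_zero.1 (hqz.symm.trans hg₀))
  have hfz := (hq hq₀).2
  rw [hqz, inv_inv] at hfz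
  rw [hqz, norm_inv, inv_le_iff_one_le_mul₀ (norm_pos_iff.2 hz₀)] at hqC
  rw [hfz, norm_pow, ← mul_pow]
  refine pow_le_pow_left₀ (by positivity) ?_ k
  rw [inv_le_iff_one_le_mul₀ (norm_pos_iff.2 hq₀)]
  linarith [mul_right_comm C ‖q‖ ‖z‖]

/-- `Φ` is a continuous lift of the exponential through `f` over the half-plane `a < re w`: it
parametrizes a tract of `f` over the exterior of the disc of radius `exp a`. -/
structure IsTractParam (f : ℂ → ℂ) (a : ℝ) (Φ : ℂ → ℂ) : Prop where
  continuousOn : ContinuousOn Φ (rightHalfPlane a)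
  comp_eq : ∀ w ∈ rightHalfPlane a, f (Φ w) = Complex.exp w

section Tracts

variable {f : ℂ → ℂ} {a : ℝ} {Φ Ψ : ℂ → ℂ}

theorem exp_notMem_singularSet (hS : singularSet f ⊆ Metric.closedBall 0 (Real.exp a)) {w : ℂ}
    (hw : w ∈ rightHalfPlane a) : Complex.exp w ∉ singularSet f := fun h =>
  (exp_lt_norm_exp hw).not_ge (mem_closedBall_zero_iff.1 (hS h))

theorem exists_isTractParam (hf : Differentiable ℂ f)
    (hS : singularSet f ⊆ Metric.closedBall 0 (Real.exp a)) {w₀ z₀ : ℂ}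
    (hw₀ : w₀ ∈ rightHalfPlane a) (h : f z₀ = Complex.exp w₀) :
    ∃ Φ, IsTractParam f a Φ ∧ Φ w₀ = z₀ := by
  have := (convex_rightHalfPlane a).contractibleSpace ⟨w₀, hw₀⟩
  obtain ⟨Φ, hΦ, hΦ₀, hΦe⟩ := exists_lift_on_isSimplyConnected hf (isOpen_rightHalfPlane a)
    (SimplyConnectedSpace.ofContractible _) (g := Complex.exp) (by fun_prop)
    (fun w hw => exp_notMem_singularSet hS hw) hw₀ h
  exact ⟨Φ, ⟨hΦ, hΦe⟩, hΦ₀⟩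

theorem exists_isTractParam_of_exp_lt_norm (hf : Differentiable ℂ f)
    (hS : singularSet f ⊆ Metric.closedBall 0 (Real.exp a)) {z : ℂ} (hz : Real.exp a < ‖f z‖) :
    Complex.log (f z) ∈ rightHalfPlane a ∧ ∃ Φ, IsTractParam f a Φ ∧ Φ (Complex.log (f z)) = z := by
  have hfz : 0 < ‖f z‖ := (Real.exp_pos a).trans hz
  have hlog : Complex.log (f z) ∈ rightHalfPlane a := by
    rw [rightHalfPlane, mem_ofPred_eq, Complex.log_re]
    exact (Real.lt_log_iff_exp_lt hfz).2 hz
  exact ⟨hlog, exists_isTractParam hf hS hlog (Complex.exp_log (norm_pos_iff.1 hfz)).symm⟩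

namespace IsTractParam

theorem exp_lt_norm_comp (hΦ : IsTractParam f a Φ) {w : ℂ} (hw : w ∈ rightHalfPlane a) :
    Real.exp a < ‖f (Φ w)‖ :=
  hΦ.comp_eq w hw ▸ exp_lt_norm_exp hw

theorem comp_notMem_singularSet (hΦ : IsTractParam f a Φ)
    (hS : singularSet f ⊆ Metric.closedBall 0 (Real.exp a)) {w : ℂ} (hw : w ∈ rightHalfPlane a) :
    f (Φ w) ∉ singularSet f :=
  hΦ.comp_eq w hw ▸ exp_notMem_singularSet hS hw

theorem eqOn_of_eq (hΦ : IsTractParam f a Φ) (hΨ : IsTractParam f a Ψ) (hf : Differentiable ℂ f)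
    (hS : singularSet f ⊆ Metric.closedBall 0 (Real.exp a)) {w₀ : ℂ} (hw₀ : w₀ ∈ rightHalfPlane a)
    (h : Φ w₀ = Ψ w₀) : EqOn Φ Ψ (rightHalfPlane a) :=
  eqOn_of_comp_eqOn_of_notMem_singularSet hf (convex_rightHalfPlane a).isPreconnected
    hΦ.continuousOn hΨ.continuousOn (fun w hw => (hΦ.comp_eq w hw).trans (hΨ.comp_eq w hw).symm)
    (fun _ hw => hΦ.comp_notMem_singularSet hS hw) hw₀ h

theorem translate (hΦ : IsTractParam f a Φ) (k : ℤ) :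
    IsTractParam f a fun w => Φ (w + k * (2 * Real.pi * Complex.I)) where
  continuousOn := hΦ.continuousOn.comp (by fun_prop) fun _ hw =>
    add_intCast_mul_two_pi_I_mem_rightHalfPlane hw k
  comp_eq w hw := by
    rw [hΦ.comp_eq _ (add_intCast_mul_two_pi_I_mem_rightHalfPlane hw k),
      Complex.exp_periodic.int_mul]

theorem exists_eq_add_of_eq (hΦ : IsTractParam f a Φ) (hΨ : IsTractParam f a Ψ) {w₁ w₂ : ℂ}
    (hw₁ : w₁ ∈ rightHalfPlane a) (hw₂ : w₂ ∈ rightHalfPlane a) (h : Φ w₁ = Ψ w₂) :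
    ∃ n : ℤ, w₁ = w₂ + n * (2 * Real.pi * Complex.I) := by
  rw [← Complex.exp_eq_exp_iff_exists_int, ← hΦ.comp_eq _ hw₁, ← hΨ.comp_eq _ hw₂, h]

theorem deriv_ne_zero (hΦ : IsTractParam f a Φ)
    (hS : singularSet f ⊆ Metric.closedBall 0 (Real.exp a)) {w : ℂ} (hw : w ∈ rightHalfPlane a) :
    deriv f (Φ w) ≠ 0 :=
  deriv_ne_zero_of_notMem_singularSet (hΦ.comp_notMem_singularSet hS hw)

theorem hasDerivAt (hΦ : IsTractParam f a Φ) (hf : Differentiable ℂ f)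
    (hS : singularSet f ⊆ Metric.closedBall 0 (Real.exp a)) {w : ℂ} (hw : w ∈ rightHalfPlane a) :
    HasDerivAt Φ ((deriv f (Φ w))⁻¹ * f (Φ w)) w := by
  have hnhds := (isOpen_rightHalfPlane a).mem_nhds hw
  rw [hΦ.comp_eq w hw]
  exact hasDerivAt_of_comp_eq (hf.analyticAt _).hasStrictDerivAt (hΦ.deriv_ne_zero hS hw)
    (hΦ.continuousOn.continuousAt hnhds) (Complex.hasDerivAt_exp w)
    (eventually_of_mem hnhds hΦ.comp_eq)

theorem differentiableOn (hΦ : IsTractParam f a Φ) (hf : Differentiable ℂ f)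
    (hS : singularSet f ⊆ Metric.closedBall 0 (Real.exp a)) :
    DifferentiableOn ℂ Φ (rightHalfPlane a) := fun _ hw =>
  (hΦ.hasDerivAt hf hS hw).differentiableAt.differentiableWithinAt

theorem isOpen_image (hΦ : IsTractParam f a Φ) (hf : Differentiable ℂ f)
    (hS : singularSet f ⊆ Metric.closedBall 0 (Real.exp a)) {s : Set ℂ}
    (hs : s ⊆ rightHalfPlane a) (hso : IsOpen s) : IsOpen (Φ '' s) := by
  refine isOpen_iff_mem_nhds.2 (forall_mem_image.2 fun w hw => ?_)
  have hderiv := hΦ.hasDerivAt hf hS (hs hw)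
  have hstrict := ((hΦ.differentiableOn hf hS).analyticAt
    ((isOpen_rightHalfPlane a).mem_nhds (hs hw))).hasStrictDerivAt
  rw [hderiv.deriv] at hstrict
  have hne : (deriv f (Φ w))⁻¹ * f (Φ w) ≠ 0 :=
    mul_ne_zero (inv_ne_zero (hΦ.deriv_ne_zero hS (hs hw)))
      (norm_pos_iff.1 ((Real.exp_pos a).trans (hΦ.exp_lt_norm_comp (hs hw))))
  rw [← hstrict.map_nhds_eq hne]
  exact image_mem_map (hso.mem_nhds hw)

theorem tendsto_cobounded (hΦ : IsTractParam f a Φ) (hf : Differentiable ℂ f) :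
    Tendsto Φ (comap Complex.re atTop) (Bornology.cobounded ℂ) := by
  refine tendsto_cobounded_of_comp hf.continuous (Complex.tendsto_exp_comap_re_atTop.congr' ?_)
  filter_upwards [eventually_mem_rightHalfPlane a] with w hw
  exact (hΦ.comp_eq w hw).symm

/-- If `Φ` had period `2πik`, then `f` would be `z ↦ z ^ k` near a pole in suitable coordinates. -/
theorem not_periodic (hΦ : IsTractParam f a Φ) (hf : IsTranscendentalEntire f)
    (hS : singularSet f ⊆ Metric.closedBall 0 (Real.exp a)) {k : ℕ} (hk : 0 < k) :
    ¬ ∀ w ∈ rightHalfPlane a, Φ (w + k * (2 * Real.pi * Complex.I)) = Φ w := by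
  intro hper
  have hinfty := hΦ.tendsto_cobounded hf.1
  obtain ⟨b, hab, hb⟩ := ((atTop_basis_Ioi' a).comap Complex.re).eventually_iff.1
    (hinfty.eventually (Bornology.eventually_ne_cobounded 0))
  have hsub : rightHalfPlane b ⊆ rightHalfPlane a := fun _ hw => lt_trans hab hw
  obtain ⟨g, hg, hg₀, hgv⟩ := exists_analyticAt_of_periodic (v := fun w => (Φ w)⁻¹) hk
    (((hΦ.differentiableOn hf.1 hS).mono hsub).inv fun w hw => hb hw)
    (fun w hw => congrArg _ (hper w (hsub hw))) (tendsto_inv₀_cobounded.comp hinfty)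
  refine hf.2 (exists_polynomial_of_isBigO_pow hf.1
    (isBigO_pow_of_analyticAt_inv hg hg₀ (k := k) ?_))
  filter_upwards [hgv] with q ⟨w, hw, hwq, hqw⟩
  rw [hqw, inv_inv, hΦ.comp_eq w (hsub hw), hwq]
  exact ⟨inv_ne_zero (hb hw), rfl⟩

theorem injOn (hΦ : IsTractParam f a Φ) (hf : IsTranscendentalEntire f)
    (hS : singularSet f ⊆ Metric.closedBall 0 (Real.exp a)) : InjOn Φ (rightHalfPlane a) := by
  have hpos (k : ℤ) (hk : 0 < k) (w : ℂ) (hw : w ∈ rightHalfPlane a) :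
      Φ (w + k * (2 * Real.pi * Complex.I)) ≠ Φ w := by
    intro h
    lift k to ℕ using hk.le
    exact hΦ.not_periodic hf hS (k := k) (by exact_mod_cast hk) fun x hx => by
      exact_mod_cast (hΦ.translate k).eqOn_of_eq hΦ hf.1 hS hw h hx
  intro w₁ hw₁ w₂ hw₂ h
  obtain ⟨n, hn⟩ := hΦ.exists_eq_add_of_eq hΦ hw₁ hw₂ h
  rcases lt_trichotomy n 0 with hn₀ | rfl | hn₀
  · refine absurd ?_ (hpos (-n) (by lia) w₁ hw₁)
    rw [h, hn]
    congr 1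
    push_cast
    ring
  · simpa using hn
  · exact absurd (hn ▸ h) (hpos n hn₀ w₂ hw₂)

theorem hasContinuousLogOn_image (hΦ : IsTractParam f a Φ) (hf : IsTranscendentalEntire f)
    (hS : singularSet f ⊆ Metric.closedBall 0 (Real.exp a)) {c : ℂ}
    (hc : c ∉ Φ '' rightHalfPlane a) :
    HasContinuousLogOn (fun z => z - c) (Φ '' rightHalfPlane a) := by
  obtain ⟨L, hL, hLe⟩ := hasContinuousLogOn_of_convex (convex_rightHalfPlane a)
    (isOpen_rightHalfPlane a) (hΦ.continuousOn.sub continuousOn_const)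
    fun w hw h => hc ⟨w, hw, sub_eq_zero.1 h⟩
  have hinv : LeftInvOn (Function.invFunOn Φ (rightHalfPlane a)) Φ (rightHalfPlane a) :=
    (hΦ.injOn hf hS).leftInvOn_invFunOn
  have hopen : IsOpenMap ((rightHalfPlane a).domRestrict Φ) := by
    rintro _ ⟨t, ht, rfl⟩
    rw [image_domRestrict]
    exact hΦ.isOpen_image hf.1 hS inter_subset_right (ht.inter (isOpen_rightHalfPlane a))
  refine ⟨L ∘ Function.invFunOn Φ (rightHalfPlane a), hL.comp
    (IsOpenMap.continuousOn_image_of_leftInvOn hopen hinv) ?_, ?_⟩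
  · rintro _ ⟨w, hw, rfl⟩
    rwa [hinv hw]
  · rintro _ ⟨w, hw, rfl⟩
    rw [Function.comp_apply, hinv hw]
    exact hLe w hw

theorem image_subset_of_not_disjoint (hΦ : IsTractParam f a Φ) (hΨ : IsTractParam f a Ψ)
    (hf : Differentiable ℂ f) (hS : singularSet f ⊆ Metric.closedBall 0 (Real.exp a))
    (h : ¬ Disjoint (Ψ '' rightHalfPlane a) (Φ '' rightHalfPlane a)) :
    Ψ '' rightHalfPlane a ⊆ Φ '' rightHalfPlane a := by
  obtain ⟨_, ⟨w₁, hw₁, rfl⟩, w₂, hw₂, hw⟩ := not_disjoint_iff.1 h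
  obtain ⟨n, hn⟩ := hΦ.exists_eq_add_of_eq hΨ hw₂ hw₁ hw
  rw [image_subset_iff]
  intro w hw'
  refine ⟨_, add_intCast_mul_two_pi_I_mem_rightHalfPlane hw' n, ?_⟩
  exact (hΦ.translate n).eqOn_of_eq hΨ hf hS hw₁ (hn ▸ hw) hw'

theorem connectedComponentIn_subset_image (hΦ : IsTractParam f a Φ) (hf : Differentiable ℂ f)
    (hS : singularSet f ⊆ Metric.closedBall 0 (Real.exp a)) {z : ℂ}
    (hz : z ∈ Φ '' rightHalfPlane a) :
    connectedComponentIn {z | Real.exp a < ‖f z‖} z ⊆ Φ '' rightHalfPlane a := by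
  have hopen {Ψ : ℂ → ℂ} (hΨ : IsTractParam f a Ψ) : IsOpen (Ψ '' rightHalfPlane a) :=
    hΨ.isOpen_image hf hS Subset.rfl (isOpen_rightHalfPlane a)
  set O := ⋃ (Ψ : ℂ → ℂ) (_ : IsTractParam f a Ψ)
    (_ : Disjoint (Ψ '' rightHalfPlane a) (Φ '' rightHalfPlane a)), Ψ '' rightHalfPlane a
  have hO : IsOpen O :=
    isOpen_iUnion fun _ => isOpen_iUnion fun hΨ => isOpen_iUnion fun _ => hopen hΨ
  have hdisj : Disjoint (Φ '' rightHalfPlane a) O := by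
    simp only [O, disjoint_iUnion_right]
    exact fun _ _ h => h.symm
  have hcover : {z | Real.exp a < ‖f z‖} ⊆ Φ '' rightHalfPlane a ∪ O := by
    intro x hx
    obtain ⟨hlog, Ψ, hΨ, hΨx⟩ := exists_isTractParam_of_exp_lt_norm hf hS hx
    have hxΨ : x ∈ Ψ '' rightHalfPlane a := ⟨_, hlog, hΨx⟩
    by_cases hd : Disjoint (Ψ '' rightHalfPlane a) (Φ '' rightHalfPlane a)
    · exact Or.inr (mem_iUnion₂_of_mem hΨ (mem_iUnion_of_mem hd hxΨ))
    · exact Or.inl (hΦ.image_subset_of_not_disjoint hΨ hf hS hd hxΨ)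
  have hzf : Real.exp a < ‖f z‖ := by
    obtain ⟨w, hw, rfl⟩ := hz
    exact hΦ.exp_lt_norm_comp hw
  exact isPreconnected_connectedComponentIn.subset_left_of_subset_union (hopen hΦ) hO hdisj
    ((connectedComponentIn_subset _ _).trans hcover) ⟨z, mem_connectedComponentIn hzf, hz⟩

end IsTractParam

theorem hasLogBranches_lt_norm (hf : IsTranscendentalEntire f)
    (hS : singularSet f ⊆ Metric.closedBall 0 (Real.exp a)) :
    HasLogBranches {z | Real.exp a < ‖f z‖} := by
  refine hasLogBranches_of_components (isOpen_lt continuous_const hf.1.continuous.norm)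
    fun z hz c hc => ?_
  obtain ⟨hlog, Φ, hΦ, hΦz⟩ := exists_isTractParam_of_exp_lt_norm hf.1 hS hz
  refine (hΦ.hasContinuousLogOn_image hf hS ?_).mono
    (hΦ.connectedComponentIn_subset_image hf.1 hS ⟨_, hlog, hΦz⟩)
  rintro ⟨w, hw, rfl⟩
  exact hc (hΦ.exp_lt_norm_comp hw)

end Tracts

/-! ### Expansion -/

theorem norm_image_sub_sub_deriv_mul_le {φ : ℂ → ℂ} {p : ℂ} {s : ℝ} (hs : 0 < s)
    (hφ : DifferentiableOn ℂ φ (Metric.ball p s))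
    (hbound : ∀ z ∈ Metric.ball p s, ‖deriv φ z‖ ≤ 2 * ‖deriv φ p‖) {z : ℂ}
    (hz : z ∈ Metric.closedBall p (s / 8)) :
    ‖φ z - φ p - deriv φ p * (z - p)‖ ≤ ‖deriv φ p‖ / 2 * ‖z - p‖ := by
  have hp : p ∈ Metric.closedBall p (s / 8) := Metric.mem_closedBall_self (by positivity)
  have hsub : Metric.closedBall p (s / 8) ⊆ Metric.ball p s :=
    Metric.closedBall_subset_ball (by linarith)
  have hderiv : DifferentiableOn ℂ (deriv φ) (Metric.ball p s) := hφ.deriv Metric.isOpen_ball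
  have hsecond : ∀ x ∈ Metric.closedBall p (s / 8),
      ‖deriv (deriv φ) x‖ ≤ 2 * ‖deriv φ p‖ / (s / 2) := fun x hx => by
    have hball : Metric.closedBall x (s / 2) ⊆ Metric.ball p s := fun y hy => by
      rw [Metric.mem_closedBall] at hx hy
      rw [Metric.mem_ball]
      linarith [dist_triangle y x p]
    exact Complex.norm_deriv_le_of_forall_mem_sphere_norm_le (by positivity)
      ((hderiv.mono hball).diffContOnCl_ball Subset.rfl)
      fun y hy => hbound y (hball (Metric.sphere_subset_closedBall hy))
  have hfirst : ∀ x ∈ Metric.closedBall p (s / 8), ‖deriv φ x - deriv φ p‖ ≤ ‖deriv φ p‖ / 2 :=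
    fun x hx => by
    have hle := (convex_closedBall p (s / 8)).norm_image_sub_le_of_norm_deriv_le
      (fun y hy => hderiv.differentiableAt (Metric.isOpen_ball.mem_nhds (hsub hy))) hsecond hp hx
    rw [Metric.mem_closedBall, dist_eq_norm] at hx
    calc ‖deriv φ x - deriv φ p‖ ≤ 2 * ‖deriv φ p‖ / (s / 2) * ‖x - p‖ := hle
      _ ≤ 2 * ‖deriv φ p‖ / (s / 2) * (s / 8) := by gcongr
      _ = ‖deriv φ p‖ / 2 := by field_simp; ring
  have hdiff : ∀ x ∈ Metric.closedBall p (s / 8), HasDerivWithinAt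
      (fun x => φ x - deriv φ p * x) (deriv φ x - deriv φ p) (Metric.closedBall p (s / 8)) x :=
    fun x hx => by
    have hφx := (hφ.differentiableAt (Metric.isOpen_ball.mem_nhds (hsub hx))).hasDerivAt
    exact (hφx.sub (hasDerivAt_const_mul (deriv φ p))).hasDerivWithinAt
  refine (le_of_eq (congrArg _ ?_)).trans ((convex_closedBall p
    (s / 8)).norm_image_sub_le_of_norm_hasDerivWithin_le hdiff hfirst hp hz)
  ring

theorem ball_subset_image_ball_of_norm_deriv_le {φ : ℂ → ℂ} {p : ℂ} {s : ℝ}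
    (hφ : DifferentiableOn ℂ φ (Metric.ball p s))
    (hbound : ∀ z ∈ Metric.ball p s, ‖deriv φ z‖ ≤ 2 * ‖deriv φ p‖) :
    Metric.ball (φ p) (s * ‖deriv φ p‖ / 32) ⊆ φ '' Metric.ball p s := by
  rcases (Metric.ball (φ p) (s * ‖deriv φ p‖ / 32)).eq_empty_or_nonempty with hempty | hne
  · exact hempty ▸ empty_subset _
  have hpos : 0 < s * ‖deriv φ p‖ := by linarith [Metric.nonempty_ball.1 hne]
  have hs : 0 < s := pos_of_mul_pos_left hpos (norm_nonneg _)
  have hsub : Metric.closedBall p (s / 8) ⊆ Metric.ball p s :=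
    Metric.closedBall_subset_ball (by linarith)
  have hderiv := (hφ.differentiableAt
    (Metric.isOpen_ball.mem_nhds (Metric.mem_ball_self hs))).hasDerivAt
  have hdisj := (hderiv.eventually_ne (c := φ p)
    (norm_pos_iff.1 (pos_of_mul_pos_right hpos hs.le))).frequently.filter_mono nhdsWithin_le_nhds
  have hcov := DiffContOnCl.ball_subset_image_closedBall (ε := s * ‖deriv φ p‖ / 16)
    ((hφ.mono hsub).diffContOnCl_ball Subset.rfl) (by positivity) (fun z hz => ?_) hdisj
  · rw [div_div] at hcov
    norm_num at hcov
    exact hcov.trans (image_mono hsub)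
  · have hz' : ‖z - p‖ = s / 8 := mem_sphere_iff_norm.1 hz
    have hlin := norm_image_sub_sub_deriv_mul_le hs hφ hbound (Metric.sphere_subset_closedBall hz)
    have htri := norm_sub_norm_le (deriv φ p * (z - p)) (φ z - φ p)
    rw [norm_sub_rev (deriv φ p * (z - p)), norm_mul, hz'] at htri
    rw [hz'] at hlin
    linarith

/-- A weak form of Bloch's theorem. -/
theorem exists_ball_subset_image_ball {φ : ℂ → ℂ} {a : ℂ} {r : ℝ} (hr : 0 < r)
    (hφ : DifferentiableOn ℂ φ (Metric.ball a r)) :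
    ∃ b, Metric.ball b (r * ‖deriv φ a‖ / 128) ⊆ φ '' Metric.ball a r := by
  have hsub : Metric.closedBall a (r / 2) ⊆ Metric.ball a r :=
    Metric.closedBall_subset_ball (by linarith)
  -- Bloch's choice of `p`: it makes `φ'` at most double on the disc of radius `s`.
  obtain ⟨p, hp, hmax⟩ := (isCompact_closedBall a (r / 2)).exists_isMaxOn
    ⟨a, Metric.mem_closedBall_self (by positivity)⟩
    (f := fun z => (r / 2 - dist z a) * ‖deriv φ z‖)
    (ContinuousOn.mul (by fun_prop) ((hφ.deriv Metric.isOpen_ball).continuousOn.mono hsub).norm)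
  replace hmax : ∀ z ∈ Metric.closedBall a (r / 2),
    (r / 2 - dist z a) * ‖deriv φ z‖ ≤ (r / 2 - dist p a) * ‖deriv φ p‖ := hmax
  obtain ⟨s, hs⟩ : ∃ s, r / 2 - dist p a = 2 * s := ⟨(r / 2 - dist p a) / 2, by ring⟩
  have hs₀ : 0 ≤ s := by linarith [Metric.mem_closedBall.1 hp]
  have hball : Metric.ball p s ⊆ Metric.closedBall a (r / 2) :=
    Metric.ball_subset_closedBall.trans (Metric.closedBall_subset_closedBall' (by linarith))
  have hbound : ∀ z ∈ Metric.ball p s, ‖deriv φ z‖ ≤ 2 * ‖deriv φ p‖ := fun z hz => by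
    have hle : s * ‖deriv φ z‖ ≤ s * (2 * ‖deriv φ p‖) := by
      rw [← mul_assoc, mul_comm s 2, ← hs]
      refine le_trans ?_ (hmax z (hball hz))
      gcongr
      linarith [dist_triangle z p a, Metric.mem_ball.1 hz]
    exact le_of_mul_le_mul_left hle (dist_nonneg.trans_lt hz)
  refine ⟨φ p, (Metric.ball_subset_ball ?_).trans
    ((ball_subset_image_ball_of_norm_deriv_le (hφ.mono (hball.trans hsub)) hbound).trans
      (image_mono (hball.trans hsub)))⟩
  have hpa := hmax a (Metric.mem_closedBall_self (by positivity))
  rw [dist_self, sub_zero, hs] at hpa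
  linarith

theorem hasDerivAt_of_exp_eq {g L : ℂ → ℂ} {g' w : ℂ} (hL : ContinuousAt L w)
    (hg : HasDerivAt g g' w) (h : ∀ᶠ x in 𝓝 w, Complex.exp (L x) = g x) :
    HasDerivAt L ((g w)⁻¹ * g') w := by
  rw [← h.self_of_nhds]
  exact hasDerivAt_of_comp_eq (Complex.hasStrictDerivAt_exp _) (Complex.exp_ne_zero _) hL hg h

section LogImage

variable {g : ℂ → ℂ} {a : ℂ} {r : ℝ}

theorem exists_closedBall_pi_subset_image_log (hr : 0 < r)
    (hg : DifferentiableOn ℂ g (Metric.ball a r)) (h₀ : ∀ z ∈ Metric.ball a r, g z ≠ 0)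
    (h : 512 * ‖g a‖ < r * ‖deriv g a‖) : ∃ L : ℂ → ℂ,
      (∀ z ∈ Metric.ball a r, Complex.exp (L z) = g z) ∧
        ∃ b, Metric.closedBall b Real.pi ⊆ L '' Metric.ball a r := by
  obtain ⟨L, hL, hLe⟩ := hasContinuousLogOn_of_convex (convex_ball a r) Metric.isOpen_ball
    hg.continuousOn h₀
  have hderiv : ∀ z ∈ Metric.ball a r, HasDerivAt L ((g z)⁻¹ * deriv g z) z := fun z hz => by
    have hnhds := Metric.isOpen_ball.mem_nhds hz
    exact hasDerivAt_of_exp_eq (hL.continuousAt hnhds) (hg.differentiableAt hnhds).hasDerivAt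
      (eventually_of_mem hnhds hLe)
  have ha := Metric.mem_ball_self (x := a) hr
  obtain ⟨b, hb⟩ := exists_ball_subset_image_ball hr
    fun z hz => (hderiv z hz).differentiableAt.differentiableWithinAt
  refine ⟨L, hLe, b, (Metric.closedBall_subset_ball (Real.pi_lt_four.trans ?_)).trans hb⟩
  have hga := norm_pos_iff.2 (h₀ a ha)
  rw [(hderiv a ha).deriv, norm_mul, norm_inv, lt_div_iff₀ (by norm_num), mul_left_comm,
    inv_mul_eq_div, lt_div_iff₀ hga]
  linarith

theorem mul_norm_deriv_le_of_injOn (hr : 0 < r) (hg : DifferentiableOn ℂ g (Metric.ball a r))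
    (h₀ : ∀ z ∈ Metric.ball a r, g z ≠ 0) (hinj : InjOn g (Metric.ball a r)) :
    r * ‖deriv g a‖ ≤ 512 * ‖g a‖ := by
  by_contra! hlt
  obtain ⟨L, hLe, b, hb⟩ := exists_closedBall_pi_subset_image_log hr hg h₀ hlt
  obtain ⟨z₁, hz₁, h₁⟩ := hb (show b - Real.pi * Complex.I ∈ _ by
    simp [abs_of_pos Real.pi_pos])
  obtain ⟨z₂, hz₂, h₂⟩ := hb (show b + Real.pi * Complex.I ∈ _ by
    simp [abs_of_pos Real.pi_pos])
  have hL : L z₂ = L z₁ + 2 * Real.pi * Complex.I := by rw [h₁, h₂]; ring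
  have heq : g z₂ = g z₁ := by rw [← hLe z₁ hz₁, ← hLe z₂ hz₂, hL, Complex.exp_periodic]
  rw [hinj hz₂ hz₁ heq, left_eq_add] at hL
  exact Complex.two_pi_I_ne_zero hL

theorem exists_sphere_subset_image_ball (hr : 0 < r) (hg : DifferentiableOn ℂ g (Metric.ball a r))
    (h₀ : ∀ z ∈ Metric.ball a r, g z ≠ 0) (h : 512 * ‖g a‖ < r * ‖deriv g a‖) :
    ∃ ρ > 0, Metric.sphere 0 ρ ⊆ g '' Metric.ball a r := by
  obtain ⟨L, hLe, b, hb⟩ := exists_closedBall_pi_subset_image_log hr hg h₀ h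
  refine ⟨‖Complex.exp b‖, norm_pos_iff.2 (Complex.exp_ne_zero b), fun z hz => ?_⟩
  have hnorm : ‖z / Complex.exp b‖ = 1 := by
    rw [norm_div, mem_sphere_zero_iff_norm.1 hz,
      div_self (norm_ne_zero_iff.2 (Complex.exp_ne_zero b))]
  obtain ⟨y, hy, hyz⟩ := hb (show b + (z / Complex.exp b).arg * Complex.I ∈ _ by
    simpa [Complex.dist_eq] using Complex.abs_arg_le_pi (z / Complex.exp b))
  refine ⟨y, hy, ?_⟩
  have hpolar := Complex.norm_mul_exp_arg_mul_I (z / Complex.exp b)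
  rw [hnorm, Complex.ofReal_one, one_mul] at hpolar
  rw [← hLe y hy, hyz, Complex.exp_add, hpolar, mul_div_cancel₀ _ (Complex.exp_ne_zero b)]

end LogImage

theorem log_norm_sub_mul_norm_le {f : ℂ → ℂ} (hf : IsTranscendentalEntire f) {a : ℝ}
    (hS : singularSet f ⊆ Metric.closedBall 0 (Real.exp a)) (h₀ : ‖f 0‖ ≤ Real.exp a) {z : ℂ}
    (hz : Real.exp a < ‖f z‖) : (Real.log ‖f z‖ - a) * ‖f z‖ ≤ 512 * (‖z‖ * ‖deriv f z‖) := by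
  obtain ⟨hw, Φ, hΦ, hΦz⟩ := exists_isTractParam_of_exp_lt_norm hf.1 hS hz
  set w := Complex.log (f z)
  have hre : w.re = Real.log ‖f z‖ := Complex.log_re _
  have hball : Metric.ball w (w.re - a) ⊆ rightHalfPlane a := fun x hx => by
    have hlt := (Complex.abs_re_le_norm (x - w)).trans_lt (mem_ball_iff_norm.1 hx)
    rw [Complex.sub_re, abs_lt] at hlt
    rw [rightHalfPlane, mem_ofPred_eq]
    linarith
  have hΦ₀ : ∀ x ∈ Metric.ball w (w.re - a), Φ x ≠ 0 := fun x hx h => by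
    have hlt := hΦ.exp_lt_norm_comp (hball hx)
    rw [h] at hlt
    exact hlt.not_ge h₀
  have hle := mul_norm_deriv_le_of_injOn (sub_pos.2 hw) ((hΦ.differentiableOn hf.1 hS).mono hball)
    hΦ₀ ((hΦ.injOn hf hS).mono hball)
  have hf' : 0 < ‖deriv f z‖ := norm_pos_iff.2 (hΦz ▸ hΦ.deriv_ne_zero hS hw)
  rw [(hΦ.hasDerivAt hf.1 hS hw).deriv, hΦz, hre, norm_mul, norm_inv] at hle
  calc (Real.log ‖f z‖ - a) * ‖f z‖
      = (Real.log ‖f z‖ - a) * (‖deriv f z‖⁻¹ * ‖f z‖) * ‖deriv f z‖ := by field_simp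
    _ ≤ 512 * ‖z‖ * ‖deriv f z‖ := by gcongr
    _ = 512 * (‖z‖ * ‖deriv f z‖) := by ring

/-! ### Uniformly escaping sets -/

/-- The iterates of `f` tend to infinity uniformly on `Z`. -/
def EscapesUniformly (f : ℂ → ℂ) (Z : Set ℂ) : Prop :=
  ∀ R : ℝ, ∀ᶠ n in atTop, ∀ z ∈ Z, R < ‖f^[n] z‖

theorem EscapesUniformly.image {f : ℂ → ℂ} {Z : Set ℂ} (h : EscapesUniformly f Z) (j : ℕ) :
    EscapesUniformly f (f^[j] '' Z) := fun R => by
  filter_upwards [(tendsto_add_atTop_nat j).eventually (h R)] with n hn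
  rintro _ ⟨z, hz, rfl⟩
  rw [← Function.iterate_add_apply]
  exact hn z hz

theorem EscapesUniformly.biUnion {f : ℂ → ℂ} {ι : Type*} {s : Set ι} (hs : s.Finite)
    {Z : ι → Set ℂ} (h : ∀ i ∈ s, EscapesUniformly f (Z i)) :
    EscapesUniformly f (⋃ i ∈ s, Z i) := fun R => by
  filter_upwards [hs.eventually_all.2 fun i hi => h i hi R] with n hn z hz
  obtain ⟨i, hi, hz⟩ := mem_iUnion₂.1 hz
  exact hn i hi z hz

theorem ClassB.exists_singularSet_subset_closedBall {f : ℂ → ℂ} (hf : ClassB f) :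
    ∃ a, singularSet f ⊆ Metric.closedBall 0 (Real.exp a) ∧ ‖f 0‖ ≤ Real.exp a := by
  obtain ⟨R, hR⟩ := hf.2.subset_closedBall 0
  have ha : ∀ᶠ a in atTop, max R ‖f 0‖ ≤ Real.exp a :=
    Real.tendsto_exp_atTop.eventually_ge_atTop _
  obtain ⟨a, ha⟩ := ha.exists
  exact ⟨a, hR.trans (Metric.closedBall_subset_closedBall ((le_max_left _ _).trans ha)),
    (le_max_right _ _).trans ha⟩

theorem IsTranscendentalEntire.isOpenMap_iterate {f : ℂ → ℂ} (hf : IsTranscendentalEntire f)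
    (n : ℕ) : IsOpenMap f^[n] := by
  induction n with
  | zero => exact IsOpenMap.id
  | succ n ih => exact Function.iterate_succ' f n ▸ hf.isOpenMap.comp ih

theorem two_pow_mul_norm_iterate_le {f : ℂ → ℂ} (hf : Differentiable ℂ f) {z : ℂ}
    (h : ∀ n, 2 * ‖f^[n + 1] z‖ ≤ ‖f^[n] z‖ * ‖deriv f (f^[n] z)‖) (n : ℕ) :
    2 ^ n * ‖f^[n] z‖ ≤ ‖z‖ * ‖deriv f^[n] z‖ := by
  induction n with
  | zero => simp
  | succ n ih =>
    have hchain : deriv f^[n + 1] z = deriv f (f^[n] z) * deriv f^[n] z := by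
      rw [Function.iterate_succ']
      exact deriv_comp z (hf _) (hf.iterate n z)
    calc 2 ^ (n + 1) * ‖f^[n + 1] z‖ = 2 ^ n * (2 * ‖f^[n + 1] z‖) := by ring
      _ ≤ 2 ^ n * (‖f^[n] z‖ * ‖deriv f (f^[n] z)‖) :=
        mul_le_mul_of_nonneg_left (h n) (by positivity)
      _ = (2 ^ n * ‖f^[n] z‖) * ‖deriv f (f^[n] z)‖ := by ring
      _ ≤ (‖z‖ * ‖deriv f^[n] z‖) * ‖deriv f (f^[n] z)‖ := by gcongr
      _ = ‖z‖ * ‖deriv f^[n + 1] z‖ := by rw [hchain, norm_mul]; ring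

theorem not_sphere_subset_lt_norm {f : ℂ → ℂ} (hf : IsTranscendentalEntire f) {a : ℝ}
    (hS : singularSet f ⊆ Metric.closedBall 0 (Real.exp a)) (h₀ : ‖f 0‖ ≤ Real.exp a) {ρ : ℝ}
    (hρ : 0 < ρ) : ¬ Metric.sphere 0 ρ ⊆ {z | Real.exp a < ‖f z‖} := fun hsub => by
  have hlog := hasLogBranches_lt_norm hf hS _ hsub (isCompact_sphere _ _) 0 h₀.not_gt
  exact one_ne_zero (eq_zero_of_hasContinuousLogOn_zpow_sphere hρ (a := 0) (m := 1)
    (by simpa only [zpow_one] using hlog))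

/-- Expansion makes the image of a small disc contain a circle around `0` in `{|f| > exp a}`. -/
theorem ClassB.exists_iterate_norm_le {f : ℂ → ℂ} (hf : ClassB f) :
    ∃ R, ∀ Y : Set ℂ, IsOpen Y → Y.Nonempty → ∃ y ∈ Y, ∃ n, ‖f^[n] y‖ ≤ R := by
  obtain ⟨a, hS, h₀⟩ := hf.exists_singularSet_subset_closedBall
  refine ⟨Real.exp (a + 1024), fun Y hY ⟨z, hz⟩ => ?_⟩
  by_contra! hesc
  have hlt {y : ℂ} (hy : y ∈ Y) (n : ℕ) : Real.exp a < ‖f^[n] y‖ :=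
    (Real.exp_lt_exp.2 (by linarith)).trans (hesc y hy n)
  have hexpand (n : ℕ) : 2 * ‖f^[n + 1] z‖ ≤ ‖f^[n] z‖ * ‖deriv f (f^[n] z)‖ := by
    have hle := log_norm_sub_mul_norm_le hf.1 hS h₀ (z := f^[n] z)
      (by simpa only [Function.iterate_succ_apply'] using hlt hz (n + 1))
    have hlog := (Real.lt_log_iff_exp_lt ((Real.exp_pos a).trans (hlt hz (n + 1)))).2
      (hesc z hz (n + 1))
    rw [← Function.iterate_succ_apply' f] at hle
    nlinarith [norm_nonneg (f^[n + 1] z)]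
  obtain ⟨r, hr, hball⟩ := Metric.isOpen_iff.1 hY z hz
  have hz₀ : 0 < ‖z‖ := (Real.exp_pos a).trans (hlt hz 0)
  obtain ⟨n, hn⟩ := pow_unbounded_of_one_lt (512 * ‖z‖ / r) (one_lt_two (α := ℝ))
  have hfz : 0 < ‖f^[n] z‖ := (Real.exp_pos a).trans (hlt hz n)
  have hbig : 512 * ‖f^[n] z‖ < r * ‖deriv f^[n] z‖ := by
    rw [div_lt_iff₀ hr] at hn
    have hgrow := two_pow_mul_norm_iterate_le hf.1.1 hexpand n
    refine lt_of_mul_lt_mul_left ?_ hz₀.le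
    calc ‖z‖ * (512 * ‖f^[n] z‖) = 512 * ‖z‖ * ‖f^[n] z‖ := by ring
      _ < 2 ^ n * r * ‖f^[n] z‖ := by gcongr
      _ = r * (2 ^ n * ‖f^[n] z‖) := by ring
      _ ≤ r * (‖z‖ * ‖deriv f^[n] z‖) := by gcongr
      _ = ‖z‖ * (r * ‖deriv f^[n] z‖) := by ring
  obtain ⟨ρ, hρ, hsphere⟩ := exists_sphere_subset_image_ball hr
    (hf.1.1.iterate n).differentiableOn
    (fun y hy => norm_pos_iff.1 ((Real.exp_pos a).trans (hlt (hball hy) n))) hbig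
  refine not_sphere_subset_lt_norm hf.1 hS h₀ hρ (hsphere.trans ?_)
  rintro _ ⟨y, hy, rfl⟩
  rw [mem_ofPred_eq, ← Function.iterate_succ_apply' f]
  exact hlt (hball hy) (n + 1)

theorem ClassB.not_escapesUniformly {f : ℂ → ℂ} (hf : ClassB f) {Y : Set ℂ} (hY : IsOpen Y)
    (hne : Y.Nonempty) : ¬ EscapesUniformly f Y := fun hesc => by
  obtain ⟨R, hR⟩ := hf.exists_iterate_norm_le
  obtain ⟨N, hN⟩ := eventually_atTop.1 (hesc R)
  obtain ⟨_, ⟨y, hy, rfl⟩, n, hn⟩ :=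
    hR (f^[N] '' Y) (hf.1.isOpenMap_iterate N _ hY) (hne.image _)
  rw [← Function.iterate_add_apply] at hn
  exact (hN (n + N) (Nat.le_add_left N n) y hy).not_ge hn

theorem frontier_connectedComponentIn_subset_compl {O : Set ℂ} (hO : IsOpen O) (x : ℂ) :
    frontier (connectedComponentIn O x) ⊆ Oᶜ := by
  intro y hy hyO
  rw [hO.connectedComponentIn.frontier_eq] at hy
  obtain ⟨u, hu, hu'⟩ := mem_closure_iff.1 hy.1 _ hO.connectedComponentIn
    (mem_connectedComponentIn hyO)
  refine hy.2 ?_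
  rw [connectedComponentIn_eq hu', ← connectedComponentIn_eq hu]
  exact mem_connectedComponentIn hyO

theorem frontier_image_subset_of_isBounded {g : ℂ → ℂ} (hg : Continuous g) (ho : IsOpenMap g)
    {Y : Set ℂ} (hY : IsOpen Y) (hb : Bornology.IsBounded Y) :
    frontier (g '' Y) ⊆ g '' frontier Y := by
  intro p hp
  rw [(ho Y hY).frontier_eq] at hp
  obtain ⟨q, hq, rfl⟩ := closure_minimal (image_mono subset_closure)
    (hb.isCompact_closure.image hg).isClosed hp.1
  refine ⟨q, ?_, rfl⟩
  rw [hY.frontier_eq]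
  exact ⟨hq, fun h => hp.2 (mem_image_of_mem _ h)⟩

/-- A bounded component would escape uniformly with its boundary, by a maximum principle. -/
theorem ClassB.not_isBounded_connectedComponentIn_compl {f : ℂ → ℂ} (hf : ClassB f) {Z : Set ℂ}
    (hZ : IsClosed Z) (hesc : EscapesUniformly f Z) {c : ℂ} (hc : c ∉ Z) :
    ¬ Bornology.IsBounded (connectedComponentIn Zᶜ c) := fun hb => by
  have hYo : IsOpen (connectedComponentIn Zᶜ c) := hZ.isOpen_compl.connectedComponentIn
  obtain ⟨a, hS, -⟩ := hf.exists_singularSet_subset_closedBall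
  refine hf.not_escapesUniformly hYo ⟨c, mem_connectedComponentIn hc⟩ fun R => ?_
  obtain ⟨b, hab, hRb⟩ := ((eventually_ge_atTop a).and
    (Real.tendsto_exp_atTop.eventually_ge_atTop R)).exists
  have hSb : singularSet f ⊆ Metric.closedBall 0 (Real.exp b) :=
    hS.trans (Metric.closedBall_subset_closedBall (Real.exp_le_exp.2 hab))
  rw [← map_add_atTop_eq_nat 1, eventually_map]
  filter_upwards [(tendsto_add_atTop_nat 1).eventually (hesc (Real.exp b))] with m hm y hy
  have hcont : Continuous f^[m] := hf.1.1.continuous.iterate m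
  have hsub := (hasLogBranches_lt_norm hf.1 hSb).subset_of_frontier_subset
    (hf.1.isOpenMap_iterate m _ hYo)
    ((hb.isCompact_closure.image hcont).isBounded.subset (image_mono subset_closure)) <| by
      refine (frontier_image_subset_of_isBounded hcont (hf.1.isOpenMap_iterate m) hYo hb).trans ?_
      rintro _ ⟨q, hq, rfl⟩
      rw [mem_ofPred_eq, ← Function.iterate_succ_apply' f]
      exact hm q (not_not.1 (frontier_connectedComponentIn_subset_compl hZ.isOpen_compl c hq))
  have hy' := hsub (mem_image_of_mem _ hy)
  rw [mem_ofPred_eq, ← Function.iterate_succ_apply' f] at hy'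
  exact hRb.trans_lt hy'

theorem ClassB.hasLogBranches_of_escapesUniformly {f : ℂ → ℂ} (hf : ClassB f) {Z : Set ℂ}
    (hZ : IsClosed Z) (hesc : EscapesUniformly f Z) : HasLogBranches Z :=
  hasLogBranches_of_unbounded fun c hc => ⟨connectedComponentIn Zᶜ c,
    connectedComponentIn_subset _ _, isPreconnected_connectedComponentIn,
    mem_connectedComponentIn hc, hf.not_isBounded_connectedComponentIn_compl hZ hesc hc⟩

/-! ### Topology of ray tails -/

theorem not_isBounded_image_Ici {E : Type*} [PseudoMetricSpace E] {c : ℝ → E} {t₀ : ℝ}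
    (h : Tendsto c atTop (Bornology.cobounded E)) : ¬ Bornology.IsBounded (c '' Ici t₀) := by
  intro hb
  have hout : ∀ᶠ t in atTop, c t ∈ (c '' Ici t₀)ᶜ := h (Bornology.isBounded_def.1 hb)
  obtain ⟨t, ht, ht₀⟩ := (hout.and (eventually_ge_atTop t₀)).exists
  exact ht (mem_image_of_mem c ht₀)

namespace IsRayTailFrom

variable {f : ℂ → ℂ} {z : ℂ} {T : Set ℂ}

theorem isClosed_image (h : IsRayTailFrom f z T) (hf : Continuous f) (j : ℕ) :
    IsClosed (f^[j] '' T) := by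
  obtain ⟨t₀, c, ⟨-, hc, hinj, -, hn, -⟩, -, rfl⟩ := h
  obtain ⟨hjinj, hjt⟩ : InjOn (fun t => f^[j] (c t)) (Ici t₀) ∧
      Tendsto (fun t => f^[j] (c t)) atTop (Bornology.cobounded ℂ) := by
    rcases Nat.eq_zero_or_pos j with rfl | hj
    · exact ⟨hinj, tendsto_cobounded_of_comp hf (hn 1 le_rfl).2⟩
    · exact hn j hj
  rw [image_image]
  exact isClosed_image_Ici_of_tendsto_cobounded ((hf.iterate j).comp_continuousOn hc) hjinj hjt

theorem isClosed (h : IsRayTailFrom f z T) (hf : Continuous f) : IsClosed T := by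
  simpa using h.isClosed_image hf 0

theorem escapesUniformly (h : IsRayTailFrom f z T) : EscapesUniformly f T := by
  obtain ⟨t₀, c, ⟨-, -, -, -, -, hu⟩, -, rfl⟩ := h
  exact fun R => eventually_atTop.2 ((hu R).imp fun N hN n hn => forall_mem_image.2 (hN n hn))

theorem mem (h : IsRayTailFrom f z T) : z ∈ T := by
  obtain ⟨t₀, c, -, rfl, rfl⟩ := h
  exact mem_image_of_mem c self_mem_Ici

theorem isPreconnected (h : IsRayTailFrom f z T) : IsPreconnected T := by
  obtain ⟨t₀, c, ⟨-, hc, -⟩, -, rfl⟩ := h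
  exact isPreconnected_Ici.image c hc

theorem not_isBounded (h : IsRayTailFrom f z T) (hf : Continuous f) :
    ¬ Bornology.IsBounded T := by
  obtain ⟨t₀, c, ⟨-, -, -, -, hn, -⟩, -, rfl⟩ := h
  exact not_isBounded_image_Ici (tendsto_cobounded_of_comp hf (hn 1 le_rfl).2)

end IsRayTailFrom

/-! ### Topology of the base domain -/

theorem IsCutArc.isOpen_baseDomain {f : ℂ → ℂ} {D δ : Set ℂ} (hδ : IsCutArc f D δ) :
    IsOpen (baseDomain D δ) :=
  (isClosed_closure.union hδ.isClosed).isOpen_compl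

theorem IsCutArc.hasLogBranches_baseDomain {f : ℂ → ℂ} {D δ : Set ℂ} (hδ : IsCutArc f D δ)
    (hD : IsPreconnected D) : HasLogBranches (baseDomain D δ) := by
  obtain ⟨c, hc, -, ht, hc0, -, rfl, -⟩ := hδ
  refine hasLogBranches_of_unbounded fun a ha => ⟨closure D ∪ c '' Ici 0, ?_, ?_, not_not.1 ha, ?_⟩
  · rw [baseDomain, compl_compl]
  · exact hD.closure.union (c 0) hc0 (mem_image_of_mem c self_mem_Ici)
      (isPreconnected_Ici.image c hc)
  · exact fun hb => not_isBounded_image_Ici ht (hb.subset subset_union_right)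

theorem frontier_component_baseDomain_diff_subset {D δ Z : Set ℂ} (hD : IsOpen D)
    (hV : IsOpen (baseDomain D δ \ Z)) (a : ℂ) :
    frontier (connectedComponentIn (baseDomain D δ \ Z) a) ⊆ frontier D ∪ δ ∪ Z := by
  intro y hy
  by_cases hyZ : y ∈ Z
  · exact Or.inr hyZ
  have hdisj : Disjoint D (connectedComponentIn (baseDomain D δ \ Z) a) :=
    disjoint_left.2 fun u hu hu' =>
      (connectedComponentIn_subset _ _ hu').1 (.inl (subset_closure hu))
  have hyD : y ∉ D := fun h =>
    disjoint_left.1 (hdisj.closure_right hD) h (frontier_subset_closure hy)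
  have hyW : y ∈ closure D ∪ δ := not_not.1 fun h =>
    frontier_connectedComponentIn_subset_compl hV a hy ⟨h, hyZ⟩
  exact .inl (hyW.imp_left fun h => hD.frontier_eq ▸ ⟨h, hyD⟩)

theorem not_isBounded_component_baseDomain_diff {f : ℂ → ℂ} (hf : ClassB f) {D δ Z : Set ℂ}
    (hD : IsJordanDomain D) (hδ : IsCutArc f D δ) (hZ : IsClosed Z) (hesc : EscapesUniformly f Z)
    (hZW : Z ⊆ baseDomain D δ) {a : ℂ} (ha : a ∈ baseDomain D δ \ Z) :
    ¬ Bornology.IsBounded (connectedComponentIn (baseDomain D δ \ Z) a) := fun hb => by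
  have hVo : IsOpen (baseDomain D δ \ Z) := hδ.isOpen_baseDomain.sdiff hZ
  set O := connectedComponentIn (baseDomain D δ \ Z) a
  have hfr : frontier O ⊆ (frontier D ∪ δ) ∪ (Z ∩ frontier O) := fun y hy =>
    (frontier_component_baseDomain_diff_subset hD.1 hVo a hy).imp_right fun h => ⟨h, hy⟩
  have hdisj : Disjoint (frontier D ∪ δ) (Z ∩ frontier O) := disjoint_left.2 fun y hy hyZ =>
    hZW hyZ.1 (hy.imp_left fun h => frontier_subset_closure h)
  have hlogD := hD.hasContinuousLogOn_frontier_union hδ ha.1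
  have hlogZ := hf.hasLogBranches_of_escapesUniformly hZ hesc (Z ∩ frontier O)
    inter_subset_left ((isCompact_frontier_of_isBounded hb).inter_left hZ) a ha.2
  have hlog := HasContinuousLogOn.union_of_subsingleton_inter
    (isClosed_frontier.union hδ.isClosed) (hZ.inter isClosed_frontier)
    (hdisj.inter_eq ▸ subsingleton_empty) hlogD hlogZ
  exact not_hasContinuousLogOn_frontier hVo.connectedComponentIn hb (mem_connectedComponentIn ha)
    (hlog.mono hfr)

/-! ### The stages of the construction -/

/-- The set `W_{n-1} \ X_n`, of which `W_n` is the preimage. -/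
def prunedStage (f : ℂ → ℂ) (γ : ℂ → Set ℂ) (W : Set ℂ) (n : ℕ) : Set ℂ :=
  handStage f γ W n \ removedTails f γ W n

/-- The union of the images `f^j(X_j)`, `j ≤ n`, of the tails removed up to stage `n`, which all
lie in the base domain. -/
def removedImages (f : ℂ → ℂ) (γ : ℂ → Set ℂ) (W : Set ℂ) (n : ℕ) : Set ℂ :=
  ⋃ j ∈ Iic n, f^[j] '' removedTails f γ W j

section Stages

variable {f : ℂ → ℂ} {γ : ℂ → Set ℂ} {D δ : Set ℂ}

theorem handStage_subset_preimage (f : ℂ → ℂ) (γ : ℂ → Set ℂ) (W : Set ℂ) (n : ℕ) :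
    handStage f γ W n ⊆ f^[n] ⁻¹' W := by
  induction n with
  | zero => exact Subset.rfl
  | succ n ih => exact fun z hz => ih hz.1

theorem preimage_diff_removedImages_subset (f : ℂ → ℂ) (γ : ℂ → Set ℂ) (W : Set ℂ) (n : ℕ) :
    f^[n] ⁻¹' (W \ removedImages f γ W n) ⊆ prunedStage f γ W n := by
  have hlast (n : ℕ) {x : ℂ} (hx : f^[n] x ∉ removedImages f γ W n) : x ∉ removedTails f γ W n :=
    fun h => hx (mem_biUnion (mem_Iic.2 le_rfl) (mem_image_of_mem _ h))
  induction n with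
  | zero => exact fun x hx => ⟨hx.1, hlast 0 hx.2⟩
  | succ n ih =>
    have hmono : removedImages f γ W n ⊆ removedImages f γ W (n + 1) :=
      biUnion_subset_biUnion_left (Iic_subset_Iic.2 n.le_succ)
    exact fun x hx => ⟨ih (a := f x) ⟨hx.1, fun h => hx.2 (hmono h)⟩, hlast (n + 1) hx.2⟩

theorem isClosed_tailsOver (hf : Continuous f) (hS : (escapingSingularSet f).Finite)
    (hγ : ∀ z ∈ escapingSingularSet f, IsRayTailFrom f z (γ z)) (V : Set ℂ) :
    IsClosed (tailsOver f γ V) :=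
  (hS.subset inter_subset_right).isClosed_biUnion fun z hz => (hγ z hz.2).isClosed hf

theorem escapesUniformly_tailsOver (hS : (escapingSingularSet f).Finite)
    (hγ : ∀ z ∈ escapingSingularSet f, IsRayTailFrom f z (γ z)) (V : Set ℂ) :
    EscapesUniformly f (tailsOver f γ V) :=
  .biUnion (hS.subset inter_subset_right) fun z hz => (hγ z hz.2).escapesUniformly

theorem hasLogBranches_compl_tailsOver (hf : Continuous f)
    (hγ : ∀ z ∈ escapingSingularSet f, IsRayTailFrom f z (γ z)) (V : Set ℂ) :
    HasLogBranches (tailsOver f γ V)ᶜ := by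
  refine hasLogBranches_of_unbounded fun c hc => ?_
  obtain ⟨z, hz, hcz⟩ := mem_iUnion₂.1 (not_not.1 hc)
  refine ⟨γ z, ?_, (hγ z hz.2).isPreconnected, hcz, (hγ z hz.2).not_isBounded hf⟩
  rw [compl_compl]
  exact subset_biUnion_of_mem (u := γ) hz

theorem removedImages_eq (f : ℂ → ℂ) (γ : ℂ → Set ℂ) (W : Set ℂ) (n : ℕ) :
    removedImages f γ W n =
      ⋃ j ∈ Iic n, ⋃ z ∈ handStage f γ W j ∩ escapingSingularSet f, f^[j] '' γ z := by
  simp only [removedImages, removedTails, tailsOver, image_iUnion₂]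

theorem isClosed_removedImages (hf : Continuous f) (hS : (escapingSingularSet f).Finite)
    (hγ : ∀ z ∈ escapingSingularSet f, IsRayTailFrom f z (γ z)) (W : Set ℂ) (n : ℕ) :
    IsClosed (removedImages f γ W n) := by
  rw [removedImages_eq]
  exact (finite_Iic n).isClosed_biUnion fun j _ => (hS.subset inter_subset_right).isClosed_biUnion
    fun z hz => (hγ z hz.2).isClosed_image hf j

theorem escapesUniformly_removedImages (hS : (escapingSingularSet f).Finite)
    (hγ : ∀ z ∈ escapingSingularSet f, IsRayTailFrom f z (γ z)) (W : Set ℂ) (n : ℕ) :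
    EscapesUniformly f (removedImages f γ W n) :=
  .biUnion (finite_Iic n) fun j _ => (escapesUniformly_tailsOver hS hγ _).image j

theorem IsCompatibleChoice.removedImages_subset (hD : IsCompatibleChoice f γ D δ) (n : ℕ) :
    removedImages f γ (baseDomain D δ) n ⊆ baseDomain D δ := by
  obtain ⟨-, hSD, -, htail⟩ := hD
  rw [removedImages_eq]
  refine iUnion₂_subset fun j _ => iUnion₂_subset fun z hz => ?_
  rcases Nat.eq_zero_or_pos j with rfl | hj
  · exact absurd (.inl (subset_closure (hSD (.inl hz.2.1)))) hz.1
  · exact image_subset_iff.2 ((htail j hj z hz.2 (handStage_subset_preimage f γ _ j hz.1)).trans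
      (connectedComponentIn_subset _ _))

theorem iterate_mem_escapingSet_iff {n : ℕ} {v : ℂ} :
    f^[n] v ∈ escapingSet f ↔ v ∈ escapingSet f := by
  simp only [escapingSet, mem_ofPred_eq, ← Function.iterate_add_apply]
  exact tendsto_add_atTop_iff_nat (f := fun m => f^[m] v) n

theorem IsCompatibleChoice.disjoint_prunedStage_singularSet (hD : IsCompatibleChoice f γ D δ)
    (hγ : ∀ z ∈ escapingSingularSet f, IsRayTailFrom f z (γ z)) (n : ℕ) :
    Disjoint (prunedStage f γ (baseDomain D δ) n) (singularSet f) := by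
  refine disjoint_left.2 fun v hv hvS => ?_
  by_cases hvI : v ∈ escapingSet f
  · exact hv.2 (mem_biUnion (x := v) ⟨hv.1, hvS, hvI⟩ (hγ v ⟨hvS, hvI⟩).mem)
  · have hP : f^[n] v ∈ postsingularSet f \ escapingSet f :=
      ⟨subset_closure (mem_iUnion.2 ⟨n, v, hvS, rfl⟩), mt iterate_mem_escapingSet_iff.1 hvI⟩
    exact handStage_subset_preimage f γ _ n hv.1 (.inl (subset_closure (hD.2.1 (.inr hP))))

theorem isOpen_handStage (hf : Continuous f) (hS : (escapingSingularSet f).Finite)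
    (hγ : ∀ z ∈ escapingSingularSet f, IsRayTailFrom f z (γ z)) {W : Set ℂ} (hW : IsOpen W)
    (n : ℕ) : IsOpen (handStage f γ W n) := by
  induction n with
  | zero => exact hW
  | succ n ih => exact (ih.sdiff (isClosed_tailsOver hf hS hγ _)).preimage hf

theorem isOpen_prunedStage (hf : Continuous f) (hS : (escapingSingularSet f).Finite)
    (hγ : ∀ z ∈ escapingSingularSet f, IsRayTailFrom f z (γ z)) {W : Set ℂ} (hW : IsOpen W)
    (n : ℕ) : IsOpen (prunedStage f γ W n) :=
  (isOpen_handStage hf hS hγ hW n).sdiff (isClosed_tailsOver hf hS hγ _)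

theorem hasLogBranches_handStage (hf : Differentiable ℂ f) (hS : (escapingSingularSet f).Finite)
    (hγ : ∀ z ∈ escapingSingularSet f, IsRayTailFrom f z (γ z)) (hD : IsCompatibleChoice f γ D δ)
    (n : ℕ) : HasLogBranches (handStage f γ (baseDomain D δ) n) := by
  induction n with
  | zero => exact hD.2.2.1.hasLogBranches_baseDomain hD.1.2.1.isPreconnected
  | succ n ih =>
    have hVo := isOpen_prunedStage hf.continuous hS hγ hD.2.2.1.isOpen_baseDomain n
    exact hasLogBranches_preimage hf hVo (hD.disjoint_prunedStage_singularSet hγ n) fun v hv =>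
      (ih.inter (hasLogBranches_compl_tailsOver hf.continuous hγ _)
        ).isSimplyConnected_connectedComponentIn hVo hv

theorem isSimplyConnected_component_prunedStage (hf : Differentiable ℂ f)
    (hS : (escapingSingularSet f).Finite)
    (hγ : ∀ z ∈ escapingSingularSet f, IsRayTailFrom f z (γ z)) (hD : IsCompatibleChoice f γ D δ)
    {n : ℕ} {v : ℂ} (hv : v ∈ prunedStage f γ (baseDomain D δ) n) :
    IsSimplyConnected (connectedComponentIn (prunedStage f γ (baseDomain D δ) n) v) :=
  ((hasLogBranches_handStage hf hS hγ hD n).inter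
    (hasLogBranches_compl_tailsOver hf.continuous hγ _)).isSimplyConnected_connectedComponentIn
    (isOpen_prunedStage hf.continuous hS hγ hD.2.2.1.isOpen_baseDomain n) hv

theorem connectedComponentIn_subset_image_of_isBounded {g : ℂ → ℂ} (hg : Continuous g)
    (ho : IsOpenMap g) {V O : Set ℂ} (hV : IsOpen V) (hVO : g ⁻¹' O ⊆ V) {v x : ℂ}
    (hb : Bornology.IsBounded (connectedComponentIn V v)) (hx : x ∈ connectedComponentIn V v)
    (hgx : g x ∈ O) : connectedComponentIn O (g x) ⊆ g '' connectedComponentIn V v := by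
  have hCo : IsOpen (connectedComponentIn V v) := hV.connectedComponentIn
  have hfr : frontier (g '' connectedComponentIn V v) ⊆ Oᶜ := by
    refine (frontier_image_subset_of_isBounded hg ho hCo hb).trans ?_
    rintro _ ⟨y, hy, rfl⟩ hyO
    exact frontier_connectedComponentIn_subset_compl hV v hy (hVO hyO)
  refine isPreconnected_connectedComponentIn.subset_of_closure_inter_subset (ho _ hCo)
    ⟨_, mem_connectedComponentIn hgx, mem_image_of_mem g hx⟩ fun y hy => ?_
  by_contra hyC
  exact hfr ((ho _ hCo).frontier_eq ▸ ⟨hy.1, hyC⟩) (connectedComponentIn_subset _ _ hy.2)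

theorem not_isBounded_component_prunedStage (hf : ClassB f)
    (hS : (escapingSingularSet f).Finite)
    (hγ : ∀ z ∈ escapingSingularSet f, IsRayTailFrom f z (γ z)) (hD : IsCompatibleChoice f γ D δ)
    {n : ℕ} {v : ℂ} (hv : v ∈ prunedStage f γ (baseDomain D δ) n) :
    ¬ Bornology.IsBounded (connectedComponentIn (prunedStage f γ (baseDomain D δ) n) v) := by
  intro hb
  set C := connectedComponentIn (prunedStage f γ (baseDomain D δ) n) v
  set Z := removedImages f γ (baseDomain D δ) n
  have hfc : Continuous f := hf.1.1.continuous
  have hVo := isOpen_prunedStage hfc hS hγ hD.2.2.1.isOpen_baseDomain n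
  have hZ : IsClosed Z := isClosed_removedImages hfc hS hγ _ n
  have hesc : EscapesUniformly f Z := escapesUniformly_removedImages hS hγ _ n
  obtain ⟨_, ⟨x, hx, rfl⟩, hxZ⟩ := not_subset.1 fun hsub : f^[n] '' C ⊆ Z =>
    hf.not_escapesUniformly (hf.1.isOpenMap_iterate n _ hVo.connectedComponentIn)
      ⟨_, mem_image_of_mem _ (mem_connectedComponentIn hv)⟩
      fun R => (hesc R).mono fun m hm z hz => hm z (hsub hz)
  have hxW : f^[n] x ∈ baseDomain D δ :=
    handStage_subset_preimage f γ _ n (connectedComponentIn_subset _ _ hx).1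
  refine not_isBounded_component_baseDomain_diff hf hD.1 hD.2.2.1 hZ hesc
    (hD.removedImages_subset n) ⟨hxW, hxZ⟩ ?_
  exact ((hb.isCompact_closure.image (hfc.iterate n)).isBounded.subset
    (image_mono subset_closure)).subset (connectedComponentIn_subset_image_of_isBounded
      (hfc.iterate n) (hf.1.isOpenMap_iterate n) hVo
      (preimage_diff_removedImages_subset f γ _ n) hb hx ⟨hxW, hxZ⟩)

end Stages

/-! ### Mapping properties of the fundamental hands -/

theorem IsComponentOf.disjoint {U U' V : Set ℂ} (hU : IsComponentOf U V)
    (hU' : IsComponentOf U' V) (hne : U ≠ U') : Disjoint U U' := by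
  obtain ⟨z, -, rfl⟩ := hU
  obtain ⟨w, -, rfl⟩ := hU'
  refine disjoint_left.2 fun u hu hu' => hne ?_
  rw [connectedComponentIn_eq hu, connectedComponentIn_eq hu']

theorem connectedComponentIn_diff_eq {α : Type*} [TopologicalSpace α] {S X : Set α} {z : α}
    (hz : z ∈ S \ X) :
    connectedComponentIn (S \ X) z = connectedComponentIn (connectedComponentIn S z \ X) z := by
  refine Subset.antisymm ?_ (connectedComponentIn_mono z
    (sdiff_subset_sdiff_left (connectedComponentIn_subset _ _)))
  exact isPreconnected_connectedComponentIn.subset_connectedComponentIn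
    (mem_connectedComponentIn hz) fun y hy =>
      ⟨connectedComponentIn_mono z sdiff_subset hy, (connectedComponentIn_subset _ _ hy).2⟩

namespace IsFundamentalHand

variable {f : ℂ → ℂ} {γ : ℂ → Set ℂ} {D δ τ : Set ℂ} {n : ℕ}

theorem injOn (hτ : IsFundamentalHand f γ (baseDomain D δ) n τ) (hf : Differentiable ℂ f)
    (hS : (escapingSingularSet f).Finite)
    (hγ : ∀ z ∈ escapingSingularSet f, IsRayTailFrom f z (γ z))
    (hD : IsCompatibleChoice f γ D δ) : InjOn f τ := by
  obtain ⟨z, hz, rfl⟩ := hτ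
  exact injOn_component_preimage hf
    (isOpen_prunedStage hf.continuous hS hγ hD.2.2.1.isOpen_baseDomain n)
    (hD.disjoint_prunedStage_singularSet hγ n) hz
    (isSimplyConnected_component_prunedStage hf hS hγ hD hz)

theorem isComponentOf_image (hτ : IsFundamentalHand f γ (baseDomain D δ) n τ)
    (hf : Differentiable ℂ f) (hS : (escapingSingularSet f).Finite)
    (hγ : ∀ z ∈ escapingSingularSet f, IsRayTailFrom f z (γ z))
    (hD : IsCompatibleChoice f γ D δ) :
    IsComponentOf (f '' τ) (prunedStage f γ (baseDomain D δ) n) := by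
  obtain ⟨z, hz, rfl⟩ := hτ
  exact ⟨f z, hz, image_component_preimage hf
    (isOpen_prunedStage hf.continuous hS hγ hD.2.2.1.isOpen_baseDomain n)
    (hD.disjoint_prunedStage_singularSet hγ n) hz
    (isSimplyConnected_component_prunedStage hf hS hγ hD hz)⟩

theorem not_isBounded (hτ : IsFundamentalHand f γ (baseDomain D δ) n τ) (hf : ClassB f)
    (hS : (escapingSingularSet f).Finite)
    (hγ : ∀ z ∈ escapingSingularSet f, IsRayTailFrom f z (γ z))
    (hD : IsCompatibleChoice f γ D δ) : ¬ Bornology.IsBounded τ := fun hb => by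
  obtain ⟨v, hv, himage⟩ := hτ.isComponentOf_image hf.1.1 hS hγ hD
  refine not_isBounded_component_prunedStage hf hS hγ hD hv (himage ▸ ?_)
  exact (hb.isCompact_closure.image hf.1.1.continuous).isBounded.subset (image_mono subset_closure)

theorem isSimplyConnected (hτ : IsFundamentalHand f γ (baseDomain D δ) n τ)
    (hf : Differentiable ℂ f) (hS : (escapingSingularSet f).Finite)
    (hγ : ∀ z ∈ escapingSingularSet f, IsRayTailFrom f z (γ z))
    (hD : IsCompatibleChoice f γ D δ) : IsSimplyConnected τ := by
  obtain ⟨z, hz, rfl⟩ := hτ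
  exact (hasLogBranches_handStage hf hS hγ hD (n + 1)).isSimplyConnected_connectedComponentIn
    (isOpen_handStage hf.continuous hS hγ hD.2.2.1.isOpen_baseDomain (n + 1)) hz

theorem exists_image (hτ : IsFundamentalHand f γ (baseDomain D δ) (n + 1) τ)
    (hf : Differentiable ℂ f) (hS : (escapingSingularSet f).Finite)
    (hγ : ∀ z ∈ escapingSingularSet f, IsRayTailFrom f z (γ z))
    (hD : IsCompatibleChoice f γ D δ) :
    ∃ τ', IsFundamentalHand f γ (baseDomain D δ) n τ' ∧ MapsTo f τ τ' ∧
      IsComponentOf (f '' τ) (τ' \ removedTails f γ (baseDomain D δ) (n + 1)) := by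
  obtain ⟨v, hv, himage⟩ := hτ.isComponentOf_image hf hS hγ hD
  refine ⟨connectedComponentIn (handStage f γ (baseDomain D δ) (n + 1)) v, ⟨v, hv.1, rfl⟩, ?_,
    v, ⟨mem_connectedComponentIn hv.1, hv.2⟩, himage.trans (connectedComponentIn_diff_eq hv)⟩
  rw [mapsTo_iff_image_subset, himage]
  exact connectedComponentIn_mono v sdiff_subset

end IsFundamentalHand

theorem mainTheorem8_general (f : ℂ → ℂ) (hf : ClassB f) (hS : (escapingSingularSet f).Finite)
    (γ : ℂ → Set ℂ) (hγ : ∀ z ∈ escapingSingularSet f, IsRayTailFrom f z (γ z))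
    (D δ : Set ℂ) (hD : IsCompatibleChoice f γ D δ) :
    (∀ (n : ℕ) (τ : Set ℂ), IsFundamentalHand f γ (baseDomain D δ) n τ →
      ¬ Bornology.IsBounded τ ∧ IsSimplyConnected τ) ∧
    (∀ (n : ℕ) (τ τ' : Set ℂ), IsFundamentalHand f γ (baseDomain D δ) n τ →
      IsFundamentalHand f γ (baseDomain D δ) n τ' → τ ≠ τ' → Disjoint τ τ') ∧
    (∀ (n : ℕ) (τ : Set ℂ), 1 ≤ n → IsFundamentalHand f γ (baseDomain D δ) n τ →
      InjOn f τ ∧ ∃ τ' : Set ℂ, IsFundamentalHand f γ (baseDomain D δ) (n - 1) τ' ∧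
        MapsTo f τ τ' ∧
        IsComponentOf (f '' τ) (τ' \ removedTails f γ (baseDomain D δ) n)) := by
  have hdiff := hf.1.1
  refine ⟨fun n τ hτ => ⟨hτ.not_isBounded hf hS hγ hD, hτ.isSimplyConnected hdiff hS hγ hD⟩,
    fun n τ τ' hτ hτ' hne => hτ.disjoint hτ' hne, fun n τ hn hτ => ?_⟩
  obtain ⟨m, rfl⟩ := Nat.exists_eq_succ_of_ne_zero (Nat.one_le_iff_ne_zero.1 hn)
  exact ⟨hτ.injOn hdiff hS hγ hD, hτ.exists_image hdiff hS hγ hD⟩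

theorem mainTheorem8 (f : ℂ → ℂ) (hf : ClassB f) (hcrin : Criniferous f)
    (hAV : juliaSet f ∩ asymptoticValues f = ∅)
    (hP : Bornology.IsBounded (postsingularSet f \ escapingSet f))
    (hS : (escapingSingularSet f).Finite)
    (γ : ℂ → Set ℂ) (hγ : ∀ z ∈ escapingSingularSet f, IsRayTailFrom f z (γ z))
    (D δ : Set ℂ) (hD : IsCompatibleChoice f γ D δ) :
    (∀ (n : ℕ) (τ : Set ℂ), IsFundamentalHand f γ (baseDomain D δ) n τ →
      ¬ Bornology.IsBounded τ ∧ IsSimplyConnected τ) ∧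
    (∀ (n : ℕ) (τ τ' : Set ℂ), IsFundamentalHand f γ (baseDomain D δ) n τ →
      IsFundamentalHand f γ (baseDomain D δ) n τ' → τ ≠ τ' → Disjoint τ τ') ∧
    (∀ (n : ℕ) (τ : Set ℂ), 1 ≤ n → IsFundamentalHand f γ (baseDomain D δ) n τ →
      InjOn f τ ∧ ∃ τ' : Set ℂ, IsFundamentalHand f γ (baseDomain D δ) (n - 1) τ' ∧
        MapsTo f τ τ' ∧
        IsComponentOf (f '' τ) (τ' \ removedTails f γ (baseDomain D δ) n)) :=
  mainTheorem8_general f hf hS γ hγ D δ hD
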